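/- Let $\Omega\subset\mathbb{R}^2$, let $f,u:\Omega\to\mathbb{R}$ be smooth, and let $x_0$ be an interior point of $\Omega$ with $\nabla u(x_0)\neq 0$. Put $\nu(z)=\sqrt{1+z^2}$ and $g(z)=1/(1+z^2)$. The Euclidean amoeba distance of $x,y\in\Omega$ is $$d(x,y)=\inf_c\int_0^1\sqrt{\|c'(t)\|^2+|(f\circ c)'(t)|^2}\,\mathrm{d}t ,$$ the infimum being over all regular $C^1$ curves $c:[0,1]\to\Omega$ from $x$ to $y$; the amoeba is $\mathcal{A}_\varrho=\{x\in\Omega : d(x_0,x)\le\varrho\}$, and $p=p_\varrho$ denotes its area. For $0<k<p$ the value of $u$ at rank $k$ in $\mathcal{A}_\varrho$ is the least $m$ such that $\{x\in\mathcal{A}_\varrho : u(x)\le m\}$ has area at least $k$. Let $M_\varrho(B)$ be the value at rank $p/2+B$; thus $M_\varrho(0)$ is the median of $u$, and $M_\varrho(B)$ is one step at $x_0$ of the amoeba active contour filter biased by $B$. All derivatives below are taken at $x_0$. Let $\eta=\nabla u/|\nabla u|$, $\chi=\nabla f/|\nabla f|$ (any unit vector if $\nabla f=0$), let $\zeta$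 and $\xi$ be $\chi$ and $\eta$ rotated by $\pi/2$, and let $\alpha$ be the angle from $\chi$ to $\eta$, i.e. $\eta=\cos\alpha\,\chi+\sin\alpha\,\zeta$. Let $$\mathcal{L}=\frac{u_{\xi\xi}}{\nu(|\nabla f|\sin\alpha)^2}-|\nabla u|\bigl(H_1f_{\chi\chi}+2H_2f_{\chi\zeta}+H_3f_{\zeta\zeta}\bigr),$$ $$\begin{pmatrix}H_1&H_2\\H_2&H_3\end{pmatrix}=\tfrac32\,\nu(|\nabla f|\sin\alpha)\int_{\alpha-\pi/2}^{\alpha+\pi/2}\frac{\nu'(|\nabla f|\cos\vartheta)}{\nu(|\nabla f|\cos\vartheta)^4}\begin{pmatrix}\cos^2\vartheta&\sin\vartheta\cos\vartheta\\ \sin\vartheta\cos\vartheta&\sin^2\vartheta\end{pmatrix}\mathrm{d}\vartheta$$ be the right-hand side of the amoeba active contour equation. Say that the bias $B(\varrho)$ *approximates the force term* $\gamma(\varrho)F$ if, as $\varrho\to0^+$ and with $\tau=\varrho^2/6$, * eventually $0<p/2+B<p$, and $\{x\in\mathcal{A}_\varrho: u(x)\le M_\varrho(B)\}$ has area exactly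 $p/2+B$; * $M_\varrho(B)-M_\varrho(0)=\tau\,\gamma(\varrho)F+o(\tau\,\gamma(\varrho))$; * whenever $\gamma(\varrho)\to\gamma_0\in\mathbb{R}$, then $M_\varrho(B)=u(x_0)+\tau\,(\mathcal{L}+\gamma_0F)+o(\tau)$, so that a step of the filter approximates an explicit time step of size $\tau$ of $u_t=\mathcal{L}+\gamma_0F$. Then the following hold. 1. **Fixed offset bias** (rank $p/2+b$). If $b=b(\varrho)=o(\varrho^2)$, then $B=b$ approximates the force term $\gamma_bF_b$ with $F_b=|\nabla u|\,\nu(|\nabla f|\sin\alpha)$ and $\gamma_b=3b/\varrho^3$. 2. **Quantile bias** (rank $p/2+qp$). If $q=q(\varrho)\to0$, then $B=qp$ approximates the force term $\gamma_qF_q$ with $$F_q=|\nabla u|\sqrt{\frac{1+|\nabla f|^2\sin^2\alpha}{1+|\nabla f|^2}},\qquad \gamma_q=\frac{3\pi q}{\varrho}.$$ Moreover, for every $q\in(-\frac12,\frac12)$ independent of $\varrho$, for all sufficiently small $\varrho>0$ the rank $p/2+qp$ is proper and attained exactly as in the first item above, and $M_\varrho(qp)=u(x_0)+\varrho\,C(q)F_q+o(\varrho)$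 as $\varrho\to0^+$, where $C(q)$ is the number $c$ for which the part of the unit disk with first coordinate at most $c$ has area $(\frac12+q)\pi$; and $C(q)/q\to\pi/2$ as $q\to0$. 3. **Quadratic bias** (rank $p/2+rp^2$). If $r=r(\varrho)$ satisfies $r\varrho^2\to0$ (for instance, if $r$ is constant), then $B=rp^2$ approximates the force term $\gamma_rF_r$ with $F_r=|\nabla u|\,\nu(|\nabla f|\sin\alpha)/\nu(|\nabla f|)^2$ and $\gamma_r=3\pi^2\varrho r$. 4. **Rotationally symmetric case.** If $f$ and $u$ depend on $\Omega$ only on the distance from a common centre, then $F_b=|\nabla u|$ (constant weight), $g(|\nabla f|)\,|\nabla u|\le F_q\le|\nabla u|$ (the weight lies between the constant weight and the $g$-weight), and $F_r=g(|\nabla f|)\,|\nabla u|$ (the $g$-weighted force). -/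

import Mathlib

open MeasureTheory Set Filter Topology
open scoped ContDiff ENNReal Asymptotics

noncomputable section

namespace Amoeba

/-- The image plane with its Euclidean norm. -/
abbrev Plane : Type := EuclideanSpace ℝ (Fin 2)

/-- The function `ν` of the Euclidean amoeba metric (contrast scale `β = 1`). -/
def nu (z : ℝ) : ℝ := Real.sqrt (1 + z ^ 2)

/-- The edge-stopping function belonging to the Euclidean amoeba metric (Perona-Malik). -/
def edgeStop (z : ℝ) : ℝ := 1 / (1 + z ^ 2)

/-- `c` restricted to `[0,1]` is a regular curve in `Ω` from `p` to `q`. -/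
structure IsRegularCurve (Ω : Set Plane) (p q : Plane) (c : ℝ → Plane) : Prop where
  contDiffOn : ContDiffOn ℝ 1 c (Icc 0 1)
  regular : ∀ t ∈ Icc (0 : ℝ) 1, derivWithin c (Icc 0 1) t ≠ 0
  mapsTo : MapsTo c (Icc 0 1) Ω
  source : c 0 = p
  target : c 1 = q

/-- Length of `c : [0,1] → Ω` in the Euclidean amoeba metric of the image `f`:
the integral of `√(‖c'‖² + |(f ∘ c)'|²)`. -/
def curveLength (f : Plane → ℝ) (c : ℝ → Plane) : ℝ≥0∞ :=
  ∫⁻ t in Icc (0 : ℝ) 1, ENNReal.ofReal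
    (Real.sqrt (‖derivWithin c (Icc 0 1) t‖ ^ 2 + |derivWithin (f ∘ c) (Icc 0 1) t| ^ 2))

/-- Euclidean amoeba distance on `Ω` induced by `f` (`∞` if no regular curve joins the points). -/
def amoebaDist (Ω : Set Plane) (f : Plane → ℝ) (p q : Plane) : ℝ≥0∞ :=
  ⨅ (c : ℝ → Plane) (_ : IsRegularCurve Ω p q c), curveLength f c

/-- The amoeba: the ball of radius `ρ` about `x₀` in the amoeba distance. -/
def amoeba (Ω : Set Plane) (f : Plane → ℝ) (x₀ : Plane) (ρ : ℝ) : Set Plane :=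
  {x | x ∈ Ω ∧ amoebaDist Ω f x₀ x ≤ ENNReal.ofReal ρ}

/-- Two-dimensional Lebesgue measure as a real number. -/
def area (S : Set Plane) : ℝ := volume.real S

/-- The value at rank `k` in the (ascending) order of the values of `u` on `A`,
where ranks are measured by area: the least `m` such that `u ≤ m` on a part of `A`
of area at least `k`. -/
def rankValue (A : Set Plane) (u : Plane → ℝ) (k : ℝ) : ℝ :=
  sInf {m : ℝ | k ≤ area {x | x ∈ A ∧ u x ≤ m}}

/-- `k` is a proper rank for `A`, and the value at rank `k` cuts off exactly the area `k`. -/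
def RankAttained (A : Set Plane) (u : Plane → ℝ) (k : ℝ) : Prop :=
  0 < k ∧ k < area A ∧ area {x | x ∈ A ∧ u x ≤ rankValue A u k} = k

/-- The rank `p / 2 + bias p` that a biased median selects in the amoeba, `p` being its area. -/
def biasedRank (Ω : Set Plane) (f : Plane → ℝ) (x₀ : Plane) (ρ : ℝ) (bias : ℝ → ℝ) : ℝ :=
  area (amoeba Ω f x₀ ρ) / 2 + bias (area (amoeba Ω f x₀ ρ))

/-- One step at `x₀` of the biased amoeba active contour filter on the level-set function `u`,
with amoebas of radius `ρ` generated by the image `f`. -/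
def biasedStep (Ω : Set Plane) (f u : Plane → ℝ) (x₀ : Plane) (ρ : ℝ) (bias : ℝ → ℝ) : ℝ :=
  rankValue (amoeba Ω f x₀ ρ) u (biasedRank Ω f x₀ ρ bias)

/-- The unbiased step: the median of `u` on the amoeba. -/
def medianStep (Ω : Set Plane) (f u : Plane → ℝ) (x₀ : Plane) (ρ : ℝ) : ℝ :=
  rankValue (amoeba Ω f x₀ ρ) u (area (amoeba Ω f x₀ ρ) / 2)

/-- Rotation by a right angle. -/
def rot (v : Plane) : Plane := !₂[-(v 1), v 0]

/-- The unit vector at angle `θ` from the unit vector `χ`. -/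
def dir (χ : Plane) (θ : ℝ) : Plane := Real.cos θ • χ + Real.sin θ • rot χ

/-- Second directional derivative `h_{vw}` at `x`. -/
def d2 (h : Plane → ℝ) (x v w : Plane) : ℝ := fderiv ℝ (fderiv ℝ h) x v w

/-- `(3/2) ν(s sin α) ∫ ν'(s cos θ) / ν(s cos θ)⁴ · k(θ) dθ` over `[α - π/2, α + π/2]`. -/
def hCoeff (s α : ℝ) (k : ℝ → ℝ) : ℝ :=
  3 / 2 * nu (s * Real.sin α) *
    ∫ θ in (α - Real.pi / 2)..(α + Real.pi / 2),
      deriv nu (s * Real.cos θ) / nu (s * Real.cos θ) ^ 4 * k θ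

/-- Right-hand side at `x` of the amoeba active contour equation
`u_t = G u_{ξξ} - |∇u| (H₁ f_{χχ} + 2 H₂ f_{χζ} + H₃ f_{ζζ})`. Here `χ` is the unit vector in
the direction of `∇f`, `ζ ⟂ χ`, and `α` is the angle from `χ` to `η = ∇u / |∇u|`, `ξ ⟂ η`. -/
def contourRHS (f u : Plane → ℝ) (x χ : Plane) (α : ℝ) : ℝ :=
  1 / nu (‖gradient f x‖ * Real.sin α) ^ 2 * d2 u x (rot (dir χ α)) (rot (dir χ α))
    - ‖gradient u x‖ *
      (hCoeff ‖gradient f x‖ α (fun θ => Real.cos θ ^ 2) * d2 f x χ χ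
        + 2 * hCoeff ‖gradient f x‖ α (fun θ => Real.sin θ * Real.cos θ) * d2 f x χ (rot χ)
        + hCoeff ‖gradient f x‖ α (fun θ => Real.sin θ ^ 2) * d2 f x (rot χ) (rot χ))

/-- Force belonging to a fixed offset bias; `a = |∇u|`, `s = |∇f|`. -/
def offsetForce (a s α : ℝ) : ℝ := a * nu (s * Real.sin α)

/-- Force belonging to a quantile bias; `a = |∇u|`, `s = |∇f|`. -/
def quantileForce (a s α : ℝ) : ℝ :=
  a * Real.sqrt ((1 + s ^ 2 * Real.sin α ^ 2) / (1 + s ^ 2))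

/-- Force belonging to a quadratic bias; `a = |∇u|`, `s = |∇f|`. -/
def quadraticForce (a s α : ℝ) : ℝ := a * (nu (s * Real.sin α) / nu s ^ 2)

/-- The biased steps (with a bias that may depend on `ρ`) produce the force term `γ(ρ) F` in the
amoeba active contour equation as `ρ → 0+`, the time step being `τ = ρ² / 6`:
the rank in question is a proper one; compared to the unbiased step, the bias contributes
`τ γ(ρ) F` up to a relative error that tends to zero; and if `γ(ρ) → γ₀`, one step is, up to
`o(τ)`, an explicit time step of size `τ` of `u_t = contourRHS + γ₀ F`. -/
def ApproximatesForce (Ω : Set Plane) (f u : Plane → ℝ) (x₀ χ : Plane) (α : ℝ)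
    (bias : ℝ → ℝ → ℝ) (γ : ℝ → ℝ) (F : ℝ) : Prop :=
  (∀ᶠ ρ in 𝓝[>] (0 : ℝ),
    RankAttained (amoeba Ω f x₀ ρ) u (biasedRank Ω f x₀ ρ (bias ρ))) ∧
  ((fun ρ : ℝ => biasedStep Ω f u x₀ ρ (bias ρ) - medianStep Ω f u x₀ ρ
      - ρ ^ 2 / 6 * (γ ρ * F)) =o[𝓝[>] (0 : ℝ)] fun ρ : ℝ => ρ ^ 2 / 6 * γ ρ) ∧
  (∀ γ₀ : ℝ, Tendsto γ (𝓝[>] (0 : ℝ)) (𝓝 γ₀) →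
    Tendsto (fun ρ : ℝ => (biasedStep Ω f u x₀ ρ (bias ρ) - u x₀) / (ρ ^ 2 / 6))
      (𝓝[>] (0 : ℝ)) (𝓝 (contourRHS f u x₀ χ α + γ₀ * F)))

/-- Signed distance from the centre of the chord of the unit disk that cuts off
the fraction `1/2 + q` of its area. -/
def diskOffset (q : ℝ) : ℝ :=
  rankValue (Metric.closedBall (0 : Plane) 1) (fun x => x 0) (Real.pi / 2 + q * Real.pi)

/-- On `Ω`, the function `h` depends only on the distance from `z`. -/
def RotSymmetricAbout (Ω : Set Plane) (z : Plane) (h : Plane → ℝ) : Prop :=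
  ∀ x ∈ Ω, ∀ y ∈ Ω, dist x z = dist y z → h x = h y

end Amoeba

end

/-!
Up to `o(ρ²)`, the amoeba distance from `x₀` to a point near the sphere of radius `ρ` is the length
of the chord between the points of the graph of `f`. Hence, at scale `ρ`, the amoeba is the unit
ball of the norm `√(|v|² + (∇f · v)²)`, corrected at first order in `ρ` by the cubic form
`(∇f · v) D²f(v, v)`. A shear along the level line of `u` turns `u` into a linear function up to
`o(ρ)`, and changes the cubic form by a multiple of `u_ξξ`. The area below a level of `u` is then an
invertible function of the level. Near the middle level its slope is given by the length of a chord
of the ellipse, which converts a bias into a force; and its value there differs from half the area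
by the first-order imbalance of the two halves of the amoeba, an integral of the cubic form over a
half circle, which is the right-hand side of the contour equation.
-/

noncomputable section

namespace Amoeba

/-! ### The function `ν` and areas cut off from the unit disk -/

lemma nu_sq (z : ℝ) : nu z ^ 2 = 1 + z ^ 2 := Real.sq_sqrt (by positivity)

lemma one_le_nu (z : ℝ) : 1 ≤ nu z := Real.one_le_sqrt.2 (by nlinarith [sq_nonneg z])

lemma nu_pos (z : ℝ) : 0 < nu z := one_pos.trans_le (one_le_nu z)

lemma nu_neg (z : ℝ) : nu (-z) = nu z := by rw [nu, nu, neg_sq]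

lemma continuous_nu : Continuous nu := by unfold nu; fun_prop

lemma hasDerivAt_nu (z : ℝ) : HasDerivAt nu (z / nu z) z := by
  have h : HasDerivAt (fun z : ℝ => 1 + z ^ 2) (2 * z) z := by
    simpa using (hasDerivAt_pow 2 z).const_add 1
  convert! h.sqrt (by positivity) using 1
  rw [nu, mul_div_mul_left _ _ two_ne_zero]

lemma tendsto_of_forall_eventually_mem_Icc {ι : Type*} {l : Filter ι} {x : ι → ℝ} {φ ψ : ℝ → ℝ}
    {L : ℝ} (hφ : Tendsto φ (𝓝[>] 0) (𝓝 L)) (hψ : Tendsto ψ (𝓝[>] 0) (𝓝 L))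
    (hx : ∀ ε > 0, ∀ᶠ i in l, x i ∈ Icc (φ ε) (ψ ε)) : Tendsto x l (𝓝 L) := by
  refine tendsto_order.2 ⟨fun y hy => ?_, fun y hy => ?_⟩
  · obtain ⟨ε, hyε, hε⟩ := ((hφ.eventually_const_lt hy).and self_mem_nhdsWithin).exists
    exact (hx ε hε).mono fun i hi => hyε.trans_le hi.1
  · obtain ⟨ε, hyε, hε⟩ := ((hψ.eventually_lt_const hy).and self_mem_nhdsWithin).exists
    exact (hx ε hε).mono fun i hi => hi.2.trans_lt hyε

lemma tendsto_of_tendsto_monotone {ι : Type*} {l : Filter ι} {G : ι → ℝ → ℝ} {g : ℝ → ℝ}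
    {t : ι → ℝ} {c : ℝ} (hG : ∀ᶠ i in l, Monotone (G i))
    (hlim : ∀ x, Tendsto (fun i => G i x) l (𝓝 (g x)))
    (hlt : ∀ x < c, g x < g c) (hgt : ∀ x > c, g c < g x)
    (ht : Tendsto (fun i => G i (t i)) l (𝓝 (g c))) : Tendsto t l (𝓝 c) := by
  refine tendsto_order.2 ⟨fun x hx => ?_, fun x hx => ?_⟩
  · filter_upwards [hG, (hlim x).eventually_lt ht (hlt x hx)] with i hi hlt
    exact hi.reflect_lt hlt
  · filter_upwards [hG, ht.eventually_lt (hlim x) (hgt x hx)] with i hi hlt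
    exact hi.reflect_lt hlt

lemma apply_sInf_eq_of_continuous_of_monotone {G : ℝ → ℝ} (hG : Continuous G) (hmono : Monotone G)
    {k m₀ m₁ : ℝ} (h0 : G m₀ < k) (h1 : k ≤ G m₁) : G (sInf {m | k ≤ G m}) = k := by
  have hlb : m₀ ∈ lowerBounds {m | k ≤ G m} := fun m hm => (hmono.reflect_lt (h0.trans_le hm)).le
  have hmem : k ≤ G (sInf {m | k ≤ G m}) :=
    (isClosed_le continuous_const hG).csInf_mem ⟨m₁, h1⟩ ⟨m₀, hlb⟩
  obtain ⟨m, hm, hmk⟩ :=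
    intermediate_value_Icc (le_csInf ⟨m₁, h1⟩ hlb) hG.continuousOn ⟨h0.le, hmem⟩
  rw [le_antisymm (csInf_le ⟨m₀, hlb⟩ hmk.ge) hm.2, hmk]

/-- The area of the part of the unit disk with first coordinate at most `c`. -/
def discArea (c : ℝ) : ℝ := volume.real {w : ℝ × ℝ | w.1 ^ 2 + w.2 ^ 2 ≤ 1 ∧ w.1 ≤ c}

lemma volume_real_snd_slice_disc (x : ℝ) :
    volume.real {z : ℝ | x ^ 2 + z ^ 2 ≤ 1} = 2 * Real.sqrt (1 - x ^ 2) := by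
  rcases lt_or_ge (1 - x ^ 2) 0 with hx | hx
  · have : {z : ℝ | x ^ 2 + z ^ 2 ≤ 1} = ∅ :=
      eq_empty_of_forall_notMem fun z (hz : x ^ 2 + z ^ 2 ≤ 1) => by nlinarith [sq_nonneg z]
    simp [this, Real.sqrt_eq_zero_of_nonpos hx.le]
  · have : {z : ℝ | x ^ 2 + z ^ 2 ≤ 1} = Icc (-Real.sqrt (1 - x ^ 2)) (Real.sqrt (1 - x ^ 2)) := by
      ext z
      rw [mem_Icc, ← abs_le, ← Real.sqrt_sq_eq_abs, Real.sqrt_le_sqrt_iff hx, le_sub_iff_add_le']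
      rfl
    rw [this, Real.volume_real_Icc_of_le (by linarith [Real.sqrt_nonneg (1 - x ^ 2)])]
    ring

lemma isClosed_disc_inter (c : ℝ) :
    IsClosed {w : ℝ × ℝ | w.1 ^ 2 + w.2 ^ 2 ≤ 1 ∧ w.1 ≤ c} := by
  rw [ofPred_and]
  exact (isClosed_le (by fun_prop) (by fun_prop)).inter (isClosed_le (by fun_prop) (by fun_prop))

lemma volume_disc_inter_ne_top (c : ℝ) :
    volume {w : ℝ × ℝ | w.1 ^ 2 + w.2 ^ 2 ≤ 1 ∧ w.1 ≤ c} ≠ ⊤ := by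
  refine ((measure_mono ?_).trans_lt
    (isCompact_Icc (a := ((-1, -1) : ℝ × ℝ)) (b := (1, 1))).measure_lt_top).ne
  rintro ⟨x, y⟩ ⟨h, -⟩
  have hx : |x| ≤ 1 := abs_le_one_iff_mul_self_le_one.2 (by nlinarith [sq_nonneg y])
  have hy : |y| ≤ 1 := abs_le_one_iff_mul_self_le_one.2 (by nlinarith [sq_nonneg x])
  exact ⟨⟨(abs_le.1 hx).1, (abs_le.1 hy).1⟩, ⟨(abs_le.1 hx).2, (abs_le.1 hy).2⟩⟩

lemma volume_real_eq_integral_slices {S : Set (ℝ × ℝ)} (hS : MeasurableSet S)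
    (hfin : volume S ≠ ⊤) : volume.real S = ∫ x, volume.real (Prod.mk x ⁻¹' S) := by
  rw [Measure.volume_eq_prod] at *
  simp_rw [measureReal_def]
  rw [integral_toReal (measurable_measure_prodMk_left hS).aemeasurable
    (Measure.ae_measure_lt_top hS hfin), Measure.prod_apply hS]

lemma discArea_eq_integral (c : ℝ) : discArea c = ∫ x in (-1)..c, 2 * Real.sqrt (1 - x ^ 2) := by
  have hcont : Continuous fun x : ℝ => 2 * Real.sqrt (1 - x ^ 2) := by fun_prop
  have hzero : ∀ x ∉ Icc (-1 : ℝ) 1, 2 * Real.sqrt (1 - x ^ 2) = 0 := fun x hx => by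
    have hx' : 1 < |x| := lt_of_not_ge fun h => hx (abs_le.1 h)
    rw [Real.sqrt_eq_zero_of_nonpos (by nlinarith [sq_abs x]), mul_zero]
  have hint : Integrable fun x : ℝ => 2 * Real.sqrt (1 - x ^ 2) :=
    hcont.integrable_of_hasCompactSupport (.intro isCompact_Icc hzero)
  have hslice : ∀ x : ℝ, volume.real {z : ℝ | x ^ 2 + z ^ 2 ≤ 1 ∧ x ≤ c}
      = (Iic c).indicator (fun x => 2 * Real.sqrt (1 - x ^ 2)) x := fun x => by
    by_cases hx : x ≤ c
    · simp [hx, volume_real_snd_slice_disc]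
    · simp [hx]
  calc discArea c = ∫ x, volume.real {z : ℝ | x ^ 2 + z ^ 2 ≤ 1 ∧ x ≤ c} :=
        volume_real_eq_integral_slices (isClosed_disc_inter c).measurableSet
          (volume_disc_inter_ne_top c)
    _ = ∫ x in Iic c, 2 * Real.sqrt (1 - x ^ 2) := by
        rw [funext hslice, integral_indicator measurableSet_Iic]
    _ = _ := by
        have hIic : ∫ x in Iic (-1 : ℝ), 2 * Real.sqrt (1 - x ^ 2) = 0 :=
          setIntegral_eq_zero_of_forall_eq_zero fun x (hx : x ≤ -1) => by
            rw [Real.sqrt_eq_zero_of_nonpos (by nlinarith), mul_zero]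
        rw [← intervalIntegral.integral_Iic_sub_Iic hint.integrableOn hint.integrableOn, hIic,
          sub_zero]

lemma hasDerivAt_discArea (c : ℝ) : HasDerivAt discArea (2 * Real.sqrt (1 - c ^ 2)) c := by
  have hcont : Continuous fun x : ℝ => 2 * Real.sqrt (1 - x ^ 2) := by fun_prop
  rw [funext discArea_eq_integral]
  exact intervalIntegral.integral_hasDerivAt_right (hcont.intervalIntegrable _ _)
    (hcont.stronglyMeasurableAtFilter _ _) hcont.continuousAt

lemma continuous_discArea : Continuous discArea :=
  continuous_iff_continuousAt.2 fun c => (hasDerivAt_discArea c).continuousAt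

lemma monotone_discArea : Monotone discArea :=
  monotone_of_deriv_nonneg (fun c => (hasDerivAt_discArea c).differentiableAt) fun c => by
    rw [(hasDerivAt_discArea c).deriv]
    positivity

lemma strictMonoOn_discArea : StrictMonoOn discArea (Icc (-1) 1) :=
  strictMonoOn_of_deriv_pos (convex_Icc _ _) continuous_discArea.continuousOn fun c hc => by
    rw [interior_Icc] at hc
    rw [(hasDerivAt_discArea c).deriv]
    have : 0 < 1 - c ^ 2 := by nlinarith [hc.1, hc.2]
    positivity

lemma discArea_add_discArea_neg (c : ℝ) : discArea c + discArea (-c) = Real.pi := by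
  have hcont : Continuous fun x : ℝ => 2 * Real.sqrt (1 - x ^ 2) := by fun_prop
  have hneg : discArea (-c) = ∫ x in c..1, 2 * Real.sqrt (1 - x ^ 2) := by
    have h := intervalIntegral.integral_comp_neg (a := c) (b := 1)
      fun x : ℝ => 2 * Real.sqrt (1 - x ^ 2)
    simp only [neg_sq] at h
    rw [discArea_eq_integral, h]
  rw [hneg, discArea_eq_integral, intervalIntegral.integral_add_adjacent_intervals
    (hcont.intervalIntegrable _ _) (hcont.intervalIntegrable _ _),
    intervalIntegral.integral_const_mul, integral_sqrt_one_sub_sq]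
  ring

lemma discArea_zero : discArea 0 = Real.pi / 2 := by
  have := discArea_add_discArea_neg 0
  rw [neg_zero] at this
  linarith

lemma discArea_of_le_neg_one {c : ℝ} (hc : c ≤ -1) : discArea c = 0 := by
  refine le_antisymm ?_ measureReal_nonneg
  calc discArea c ≤ discArea (-1) := monotone_discArea hc
    _ = 0 := by rw [discArea_eq_integral, intervalIntegral.integral_same]

lemma discArea_of_one_le {c : ℝ} (hc : 1 ≤ c) : discArea c = Real.pi := by
  rw [← discArea_add_discArea_neg c, discArea_of_le_neg_one (neg_le_neg hc), add_zero]

lemma discArea_lt_discArea {x c : ℝ} (hc : c ∈ Ioc (-1) 1) (hx : x < c) :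
    discArea x < discArea c := by
  have hmax : max x (-1) < c := max_lt hx hc.1
  exact (monotone_discArea (le_max_left _ _)).trans_lt (strictMonoOn_discArea
    ⟨le_max_right _ _, hmax.le.trans hc.2⟩ ⟨hc.1.le, hc.2⟩ hmax)

lemma discArea_lt_discArea' {x c : ℝ} (hc : c ∈ Ico (-1) 1) (hx : c < x) :
    discArea c < discArea x := by
  have hneg := discArea_lt_discArea (x := -x) (c := -c)
    ⟨neg_lt_neg hc.2, by linarith [hc.1]⟩ (neg_lt_neg hx)
  linarith [discArea_add_discArea_neg c, discArea_add_discArea_neg x]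

lemma discArea_mem_Ioo {c : ℝ} (hc : c ∈ Ioo (-1) 1) : discArea c ∈ Ioo 0 Real.pi := by
  rw [← discArea_of_le_neg_one le_rfl, ← discArea_of_one_le le_rfl]
  exact ⟨discArea_lt_discArea ⟨hc.1, hc.2.le⟩ hc.1, discArea_lt_discArea' ⟨hc.1.le, hc.2⟩ hc.2⟩

lemma norm_rot (e : Plane) : ‖rot e‖ = ‖e‖ := by
  simp [EuclideanSpace.norm_eq, rot, Fin.sum_univ_two, add_comm]

lemma inner_self_rot (e : Plane) : inner ℝ e (rot e) = 0 := by
  simp [rot, PiLp.inner_apply, Fin.sum_univ_two, mul_comm]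

/-- Coordinates of the plane with respect to `e` and `rot e`. -/
def frame (e : Plane) (w : ℝ × ℝ) : Plane := w.1 • e + w.2 • rot e

lemma continuous_frame (e : Plane) : Continuous (frame e) := by unfold frame; fun_prop

lemma norm_frame_sq {e : Plane} (he : ‖e‖ = 1) (w : ℝ × ℝ) :
    ‖frame e w‖ ^ 2 = w.1 ^ 2 + w.2 ^ 2 := by
  rw [frame, norm_add_sq_real, norm_smul, norm_smul, norm_rot, he, inner_smul_left,
    inner_smul_right, inner_self_rot]
  simp

lemma area_eq_volume_preimage_frame {e : Plane} (he : ‖e‖ = 1) (S : Set Plane) :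
    area S = volume.real (frame e ⁻¹' S) := by
  have he' : e 0 * e 0 - -e 1 * e 1 = 1 := by
    have := EuclideanSpace.norm_sq_eq e
    rw [he, Fin.sum_univ_two, Real.norm_eq_abs, Real.norm_eq_abs, sq_abs, sq_abs] at this
    linarith
  set cartesian : ℝ × ℝ ≃ᵐ Plane :=
    MeasurableEquiv.finTwoArrow.symm.trans (MeasurableEquiv.toLp 2 (Fin 2 → ℝ))
  have hpres : MeasurePreserving cartesian :=
    (PiLp.volume_preserving_toLp (Fin 2)).comp (volume_preserving_finTwoArrow ℝ).symm
  set L := Matrix.toLin (Module.Basis.finTwoProd ℝ) (Module.Basis.finTwoProd ℝ)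
    !![e 0, -e 1; e 1, e 0] with hL
  have hdet : LinearMap.det L = 1 := by
    rw [hL, LinearMap.det_toLin, Matrix.det_fin_two_of, he']
  have hcomp : frame e = cartesian ∘ L := by
    ext w i
    have hw : cartesian (L w) = !₂[(L w).1, (L w).2] := rfl
    rw [Function.comp_apply, hw, hL, Matrix.toLin_finTwoProd_apply]
    fin_cases i <;> simp [frame, rot] <;> ring
  rw [hcomp, preimage_comp, measureReal_def,
    Measure.addHaar_preimage_linearMap volume (by simp [hdet]), hpres.measure_preimage_equiv,
    hdet, inv_one, abs_one, ENNReal.ofReal_one, one_mul, area, measureReal_def]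

lemma area_closedBall_inter_halfPlane (c : ℝ) :
    area {x : Plane | x ∈ Metric.closedBall (0 : Plane) 1 ∧ x 0 ≤ c} = discArea c := by
  have he : ‖(!₂[1, 0] : Plane)‖ = 1 := by simp [EuclideanSpace.norm_eq]
  rw [area_eq_volume_preimage_frame he, discArea]
  congr 1
  ext w
  simp only [mem_preimage, mem_ofPred_eq, mem_closedBall_zero_iff]
  rw [← sq_le_one_iff₀ (norm_nonneg _), norm_frame_sq he]
  simp [frame, rot]

lemma discArea_diskOffset {q : ℝ} (hq : q ∈ Ioo (-(1 / 2) : ℝ) (1 / 2)) :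
    discArea (diskOffset q) = Real.pi / 2 + q * Real.pi := by
  have hπ := Real.pi_pos
  have hdef : diskOffset q = sInf {m | Real.pi / 2 + q * Real.pi ≤ discArea m} := by
    simp_rw [diskOffset, rankValue, area_closedBall_inter_halfPlane]
  rw [hdef]
  refine apply_sInf_eq_of_continuous_of_monotone continuous_discArea monotone_discArea
    (m₀ := -1) (m₁ := 1) ?_ ?_
  · rw [discArea_of_le_neg_one le_rfl]; nlinarith [hq.1]
  · rw [discArea_of_one_le le_rfl]; nlinarith [hq.2]

lemma diskOffset_mem_Ioo {q : ℝ} (hq : q ∈ Ioo (-(1 / 2) : ℝ) (1 / 2)) :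
    diskOffset q ∈ Ioo (-1 : ℝ) 1 := by
  have hπ := Real.pi_pos
  have hdisc := discArea_diskOffset hq
  constructor <;> by_contra! hle
  · rw [discArea_of_le_neg_one hle] at hdisc; nlinarith [hq.1]
  · rw [discArea_of_one_le hle] at hdisc; nlinarith [hq.2]

lemma tendsto_of_tendsto_discArea {ι : Type*} {l : Filter ι} {t : ι → ℝ} {c : ℝ}
    (hc : c ∈ Ioo (-1) 1) (ht : Tendsto (fun i => discArea (t i)) l (𝓝 (discArea c))) :
    Tendsto t l (𝓝 c) :=
  tendsto_of_tendsto_monotone (G := fun _ => discArea) (.of_forall fun _ => monotone_discArea)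
    (fun _ => tendsto_const_nhds) (fun _ => discArea_lt_discArea ⟨hc.1, hc.2.le⟩)
    (fun _ => discArea_lt_discArea' ⟨hc.1.le, hc.2⟩) ht

lemma diskOffset_zero : diskOffset 0 = 0 := by
  have h0 : (0 : ℝ) ∈ Ioo (-(1 / 2) : ℝ) (1 / 2) := by norm_num
  refine strictMonoOn_discArea.injOn (Ioo_subset_Icc_self (diskOffset_mem_Ioo h0)) (by norm_num) ?_
  rw [discArea_diskOffset h0, discArea_zero, zero_mul, add_zero]

lemma hasDerivAt_diskOffset_zero : HasDerivAt diskOffset (Real.pi / 2) 0 := by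
  have hmem : ∀ᶠ q : ℝ in 𝓝 0, q ∈ Ioo (-(1 / 2) : ℝ) (1 / 2) :=
    Ioo_mem_nhds (by norm_num) (by norm_num)
  have hleft : ∀ᶠ q in 𝓝 0, discArea (diskOffset q) = Real.pi / 2 + q * Real.pi :=
    hmem.mono fun q => discArea_diskOffset
  have htend : Tendsto diskOffset (𝓝 0) (𝓝 0) := by
    refine tendsto_of_tendsto_discArea (by norm_num)
      (Tendsto.congr' (hleft.mono fun _ => Eq.symm) ?_)
    rw [discArea_zero]
    exact Continuous.tendsto' (by fun_prop) _ _ (by ring)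
  have hderiv : HasDerivAt (fun c => (discArea c - Real.pi / 2) / Real.pi) (2 / Real.pi)
      (diskOffset 0) := by
    rw [diskOffset_zero]
    simpa using ((hasDerivAt_discArea 0).sub_const (Real.pi / 2)).div_const Real.pi
  have hcont : ContinuousAt diskOffset 0 := by rwa [ContinuousAt, diskOffset_zero]
  have := HasDerivAt.of_local_left_inverse hcont hderiv (by positivity)
    (hleft.mono fun q hq => by rw [hq]; field_simp; ring)
  rwa [inv_div] at this

lemma tendsto_diskOffset_div :
    Tendsto (fun q : ℝ => diskOffset q / q) (𝓝[≠] (0 : ℝ)) (𝓝 (Real.pi / 2)) := by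
  simpa [slope_fun_def, diskOffset_zero, div_eq_inv_mul] using
    hasDerivAt_iff_tendsto_slope.1 hasDerivAt_diskOffset_zero

/-! ### Ranks and levels -/

/-- The area of the part of `A ρ` on which `u ≤ u x₀ + ρ t`, in units of `ρ²`. -/
def levelArea (A : ℝ → Set Plane) (u : Plane → ℝ) (x₀ : Plane) (ρ t : ℝ) : ℝ :=
  area {x | x ∈ A ρ ∧ u x ≤ u x₀ + ρ * t} / ρ ^ 2

/-- The level `t` for which `u x₀ + ρ t` is the value of `u` at rank `k ρ` in `A ρ`. -/
def rankLevel (A : ℝ → Set Plane) (u : Plane → ℝ) (x₀ : Plane) (k : ℝ → ℝ) (ρ : ℝ) : ℝ :=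
  (rankValue (A ρ) u (k ρ) - u x₀) / ρ

/-- The asymptotics, as `ρ → 0+`, of the areas that the level sets of `u` cut off from sets `A ρ`
of size `ρ` about `x₀`: the area of `A ρ` is `p₀ ρ²` to leading order, `F` is the growth rate of
`u` normal to its level line, in units in which `A ρ` looks like a unit disk, and `L` measures the
imbalance between the two halves of `A ρ`. -/
structure RankAsymptotics (A : ℝ → Set Plane) (u : Plane → ℝ) (x₀ : Plane) (p₀ F L : ℝ) :
    Prop where
  area_pos : 0 < p₀
  rate_pos : 0 < F
  monotone : ∀ᶠ ρ in 𝓝[>] 0, Monotone (levelArea A u x₀ ρ)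
  continuous : ∀ᶠ ρ in 𝓝[>] 0, Continuous (levelArea A u x₀ ρ)
  exists_level : ∃ t ≥ F, ∀ᶠ ρ in 𝓝[>] 0,
    levelArea A u x₀ ρ (-t) = 0 ∧ levelArea A u x₀ ρ t = area (A ρ) / ρ ^ 2
  tendsto_levelArea : ∀ t, Tendsto (fun ρ => levelArea A u x₀ ρ t) (𝓝[>] 0)
    (𝓝 (p₀ / Real.pi * discArea (t / F)))
  strip : (fun p : ℝ × ℝ × ℝ => levelArea A u x₀ p.1 p.2.2 - levelArea A u x₀ p.1 p.2.1
      - 2 * p₀ / (Real.pi * F) * (p.2.2 - p.2.1))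
    =o[𝓝[>] 0 ×ˢ 𝓝 0 ×ˢ 𝓝 0] fun p => p.2.2 - p.2.1
  asymmetry : Tendsto (fun ρ => (area (A ρ) / ρ ^ 2 / 2 - levelArea A u x₀ ρ 0) / ρ) (𝓝[>] 0)
    (𝓝 (p₀ * L / (3 * Real.pi * F)))

namespace RankAsymptotics

variable {A : ℝ → Set Plane} {u : Plane → ℝ} {x₀ : Plane} {p₀ F L : ℝ}

lemma tendsto_area (h : RankAsymptotics A u x₀ p₀ F L) :
    Tendsto (fun ρ => area (A ρ) / ρ ^ 2) (𝓝[>] 0) (𝓝 p₀) := by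
  obtain ⟨t, htF, ht⟩ := h.exists_level
  have hdisc : p₀ / Real.pi * discArea (t / F) = p₀ := by
    rw [discArea_of_one_le ((one_le_div h.rate_pos).2 htF), div_mul_cancel₀ _ Real.pi_ne_zero]
  exact (hdisc ▸ h.tendsto_levelArea t).congr' (ht.mono fun ρ => And.right)

lemma levelArea_rankLevel (h : RankAsymptotics A u x₀ p₀ F L) {k : ℝ → ℝ}
    (hk : ∀ᶠ ρ in 𝓝[>] 0, 0 < k ρ ∧ k ρ ≤ area (A ρ)) :
    ∀ᶠ ρ in 𝓝[>] 0, levelArea A u x₀ ρ (rankLevel A u x₀ k ρ) = k ρ / ρ ^ 2 := by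
  obtain ⟨t, -, ht⟩ := h.exists_level
  filter_upwards [hk, ht, h.monotone, h.continuous, self_mem_nhdsWithin]
    with ρ ⟨hk0, hkA⟩ ⟨hneg, hpos⟩ hmono hcont (hρ : 0 < ρ)
  have hρ2 : 0 < ρ ^ 2 := by positivity
  have harea : ∀ m, area {x | x ∈ A ρ ∧ u x ≤ m} / ρ ^ 2
      = levelArea A u x₀ ρ ((m - u x₀) / ρ) := fun m => by
    rw [levelArea, mul_div_cancel₀ _ hρ.ne', add_sub_cancel]
  have hset : {m | k ρ ≤ area {x | x ∈ A ρ ∧ u x ≤ m}}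
      = {m | k ρ / ρ ^ 2 ≤ levelArea A u x₀ ρ ((m - u x₀) / ρ)} := by
    simp_rw [← harea, div_le_div_iff_of_pos_right hρ2]
  rw [rankLevel, rankValue, hset]
  refine apply_sInf_eq_of_continuous_of_monotone
    (G := fun m => levelArea A u x₀ ρ ((m - u x₀) / ρ)) (m₀ := u x₀ + ρ * -t)
    (m₁ := u x₀ + ρ * t) (hcont.comp (by fun_prop)) (fun m m' hm => hmono (by gcongr)) ?_ ?_
  · rw [add_sub_cancel_left, mul_div_cancel_left₀ _ hρ.ne', hneg]
    positivity
  · rw [add_sub_cancel_left, mul_div_cancel_left₀ _ hρ.ne', hpos]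
    gcongr

lemma eventually_rank_proper (h : RankAsymptotics A u x₀ p₀ F L) {k : ℝ → ℝ} {κ : ℝ}
    (hκ : κ ∈ Ioo 0 p₀) (hk : Tendsto (fun ρ => k ρ / ρ ^ 2) (𝓝[>] 0) (𝓝 κ)) :
    ∀ᶠ ρ in 𝓝[>] 0, 0 < k ρ ∧ k ρ < area (A ρ) := by
  filter_upwards [hk.eventually_const_lt hκ.1, hk.eventually_lt h.tendsto_area hκ.2,
    self_mem_nhdsWithin] with ρ hpos hlt (hρ : 0 < ρ)
  have hρ2 : 0 < ρ ^ 2 := by positivity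
  exact ⟨(div_pos_iff_of_pos_right hρ2).1 hpos, (div_lt_div_iff_of_pos_right hρ2).1 hlt⟩

lemma eventually_levelArea_rankLevel (h : RankAsymptotics A u x₀ p₀ F L) {k : ℝ → ℝ} {κ : ℝ}
    (hκ : κ ∈ Ioo 0 p₀) (hk : Tendsto (fun ρ => k ρ / ρ ^ 2) (𝓝[>] 0) (𝓝 κ)) :
    ∀ᶠ ρ in 𝓝[>] 0, levelArea A u x₀ ρ (rankLevel A u x₀ k ρ) = k ρ / ρ ^ 2 :=
  h.levelArea_rankLevel ((h.eventually_rank_proper hκ hk).mono fun _ hρ => ⟨hρ.1, hρ.2.le⟩)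

lemma eventually_rankAttained (h : RankAsymptotics A u x₀ p₀ F L) {k : ℝ → ℝ} {κ : ℝ}
    (hκ : κ ∈ Ioo 0 p₀) (hk : Tendsto (fun ρ => k ρ / ρ ^ 2) (𝓝[>] 0) (𝓝 κ)) :
    ∀ᶠ ρ in 𝓝[>] 0, RankAttained (A ρ) u (k ρ) := by
  filter_upwards [h.eventually_rank_proper hκ hk, h.eventually_levelArea_rankLevel hκ hk,
    self_mem_nhdsWithin] with ρ hproper hlevel (hρ : 0 < ρ)
  refine ⟨hproper.1, hproper.2, ?_⟩
  have hρ2 : ρ ^ 2 ≠ 0 := by positivity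
  rwa [levelArea, rankLevel, mul_div_cancel₀ _ hρ.ne', add_sub_cancel, div_left_inj' hρ2] at hlevel

lemma tendsto_rankLevel (h : RankAsymptotics A u x₀ p₀ F L) {k : ℝ → ℝ} {c : ℝ}
    (hc : c ∈ Ioo (-1) 1)
    (hk : Tendsto (fun ρ => k ρ / ρ ^ 2) (𝓝[>] 0) (𝓝 (p₀ / Real.pi * discArea c))) :
    Tendsto (rankLevel A u x₀ k) (𝓝[>] 0) (𝓝 (F * c)) := by
  have hp := h.area_pos
  have hF := h.rate_pos
  have hdisc := discArea_mem_Ioo hc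
  have hκ : p₀ / Real.pi * discArea c ∈ Ioo 0 p₀ := by
    refine ⟨mul_pos (by positivity) hdisc.1, ?_⟩
    rw [div_mul_eq_mul_div, div_lt_iff₀ Real.pi_pos]
    exact mul_lt_mul_of_pos_left hdisc.2 hp
  have hFc : F * c / F = c := mul_div_cancel_left₀ c hF.ne'
  refine tendsto_of_tendsto_monotone h.monotone h.tendsto_levelArea (fun x hx => ?_)
    (fun x hx => ?_) ?_
  · gcongr
    exact discArea_lt_discArea (by rw [hFc]; exact ⟨hc.1, hc.2.le⟩) (by gcongr)
  · gcongr
    exact discArea_lt_discArea' (by rw [hFc]; exact ⟨hc.1.le, hc.2⟩) (by gcongr)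
  · rw [hFc]
    exact hk.congr' ((h.eventually_levelArea_rankLevel hκ hk).mono fun _ => Eq.symm)

lemma half_mem_Ioo (h : RankAsymptotics A u x₀ p₀ F L) : p₀ / 2 ∈ Ioo 0 p₀ :=
  ⟨half_pos h.area_pos, half_lt_self h.area_pos⟩

lemma tendsto_rankLevel_zero (h : RankAsymptotics A u x₀ p₀ F L) {k : ℝ → ℝ}
    (hk : Tendsto (fun ρ => k ρ / ρ ^ 2) (𝓝[>] 0) (𝓝 (p₀ / 2))) :
    Tendsto (rankLevel A u x₀ k) (𝓝[>] 0) (𝓝 0) := by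
  have hdisc : p₀ / 2 = p₀ / Real.pi * discArea 0 := by rw [discArea_zero]; field_simp
  simpa only [mul_zero] using h.tendsto_rankLevel (c := 0) (by norm_num) (hdisc ▸ hk)

lemma isEquivalent_levelArea_sub (h : RankAsymptotics A u x₀ p₀ F L) {t₁ t₂ : ℝ → ℝ}
    (h₁ : Tendsto t₁ (𝓝[>] 0) (𝓝 0)) (h₂ : Tendsto t₂ (𝓝[>] 0) (𝓝 0)) :
    Asymptotics.IsEquivalent (𝓝[>] 0)
      (fun ρ => levelArea A u x₀ ρ (t₂ ρ) - levelArea A u x₀ ρ (t₁ ρ))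
      (fun ρ => 2 * p₀ / (Real.pi * F) * (t₂ ρ - t₁ ρ)) := by
  have hp := h.area_pos
  have hF := h.rate_pos
  exact (h.strip.comp_tendsto (tendsto_id.prodMk (h₁.prodMk h₂))).trans_isBigO
    (Asymptotics.isBigO_self_const_mul (by positivity) _ _)

lemma isLittleO_rankLevel_sub (h : RankAsymptotics A u x₀ p₀ F L) {k₁ k₂ : ℝ → ℝ}
    (h₁ : Tendsto (fun ρ => k₁ ρ / ρ ^ 2) (𝓝[>] 0) (𝓝 (p₀ / 2)))
    (h₂ : Tendsto (fun ρ => k₂ ρ / ρ ^ 2) (𝓝[>] 0) (𝓝 (p₀ / 2))) :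
    (fun ρ => 2 * p₀ / (Real.pi * F) * (rankLevel A u x₀ k₂ ρ - rankLevel A u x₀ k₁ ρ)
        - (k₂ ρ - k₁ ρ) / ρ ^ 2)
      =o[𝓝[>] 0] fun ρ => (k₂ ρ - k₁ ρ) / ρ ^ 2 := by
  have hequiv := (h.isEquivalent_levelArea_sub (h.tendsto_rankLevel_zero h₁)
    (h.tendsto_rankLevel_zero h₂)).symm
  refine hequiv.congr_right ?_
  filter_upwards [h.eventually_levelArea_rankLevel h.half_mem_Ioo h₁,
    h.eventually_levelArea_rankLevel h.half_mem_Ioo h₂] with ρ hρ₁ hρ₂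
  rw [hρ₁, hρ₂, sub_div]

lemma tendsto_half_area (h : RankAsymptotics A u x₀ p₀ F L) :
    Tendsto (fun ρ => area (A ρ) / 2 / ρ ^ 2) (𝓝[>] 0) (𝓝 (p₀ / 2)) :=
  (h.tendsto_area.div_const 2).congr fun _ => div_right_comm _ _ _

lemma tendsto_median (h : RankAsymptotics A u x₀ p₀ F L) :
    Tendsto (fun ρ => (rankValue (A ρ) u (area (A ρ) / 2) - u x₀) / (ρ ^ 2 / 6)) (𝓝[>] 0)
      (𝓝 L) := by
  have hp := h.area_pos
  have hF := h.rate_pos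
  set t := rankLevel A u x₀ fun ρ => area (A ρ) / 2 with ht
  have hequiv := h.isEquivalent_levelArea_sub tendsto_const_nhds
    (h.tendsto_rankLevel_zero h.tendsto_half_area)
  have hlim : Tendsto (fun ρ => 2 * p₀ / (Real.pi * F) * (t ρ - 0) / ρ) (𝓝[>] 0)
      (𝓝 (p₀ * L / (3 * Real.pi * F))) := by
    refine (hequiv.div Asymptotics.IsEquivalent.refl).tendsto_nhds (h.asymmetry.congr' ?_)
    filter_upwards [h.eventually_levelArea_rankLevel h.half_mem_Ioo h.tendsto_half_area]
      with ρ hρ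
    rw [Pi.div_apply, hρ, div_right_comm]
  have hL : 3 * Real.pi * F / p₀ * (p₀ * L / (3 * Real.pi * F)) = L := by field_simp
  rw [← hL]
  refine (hlim.const_mul _).congr' ?_
  filter_upwards [self_mem_nhdsWithin] with ρ (hρ : 0 < ρ)
  rw [ht, rankLevel]
  field_simp
  ring

lemma isLittleO_rankValue_sub_median (h : RankAsymptotics A u x₀ p₀ F L) {B γ : ℝ → ℝ} {F' : ℝ}
    (hB : Tendsto (fun ρ => B ρ / ρ ^ 2) (𝓝[>] 0) (𝓝 0))
    (hγ : (fun ρ => Real.pi * F / p₀ * (3 * B ρ / ρ ^ 3) - γ ρ * F') =o[𝓝[>] 0] γ) :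
    (fun ρ => rankValue (A ρ) u (area (A ρ) / 2 + B ρ) - rankValue (A ρ) u (area (A ρ) / 2)
        - ρ ^ 2 / 6 * (γ ρ * F')) =o[𝓝[>] 0] fun ρ => ρ ^ 2 / 6 * γ ρ := by
  have hp := h.area_pos
  have hF := h.rate_pos
  have hk : Tendsto (fun ρ => (area (A ρ) / 2 + B ρ) / ρ ^ 2) (𝓝[>] 0) (𝓝 (p₀ / 2)) := by
    simpa only [add_div, add_zero] using h.tendsto_half_area.add hB
  have hsub := h.isLittleO_rankLevel_sub h.tendsto_half_area hk
  simp only [add_sub_cancel_left] at hsub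
  set t := rankLevel A u x₀ fun ρ => area (A ρ) / 2 + B ρ with ht
  set t₀ := rankLevel A u x₀ fun ρ => area (A ρ) / 2 with ht₀
  have hBγ : (fun ρ => B ρ / ρ ^ 3) =O[𝓝[>] 0] γ := by
    have hγF : (fun ρ => γ ρ * F') =O[𝓝[>] 0] γ := by
      simpa only [mul_comm] using Asymptotics.isBigO_const_mul_self F' γ _
    have hsum := hγ.isBigO.add hγF
    simp only [sub_add_cancel, mul_div_assoc, ← mul_assoc] at hsum
    exact (Asymptotics.isBigO_const_mul_left_iff (by positivity)).1 hsum
  have hlevel : (fun ρ => ρ * (2 * p₀ / (Real.pi * F) * (t ρ - t₀ ρ) - B ρ / ρ ^ 2))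
      =o[𝓝[>] 0] fun ρ => ρ ^ 2 / 6 * γ ρ := by
    refine ((Asymptotics.isBigO_refl id _).mul_isLittleO hsub).trans_isBigO ?_
    have hscale : (fun ρ : ℝ => ρ ^ 2) =O[𝓝[>] 0] fun ρ => ρ ^ 2 / 6 := by
      simpa only [div_eq_inv_mul] using Asymptotics.isBigO_self_const_mul (by norm_num) _ _
    refine (hscale.mul hBγ).congr' ?_ .rfl
    filter_upwards [self_mem_nhdsWithin] with ρ (hρ : 0 < ρ)
    rw [id]
    field_simp
  have hforce : (fun ρ => ρ ^ 2 / 6 * (Real.pi * F / p₀ * (3 * B ρ / ρ ^ 3) - γ ρ * F'))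
      =o[𝓝[>] 0] fun ρ => ρ ^ 2 / 6 * γ ρ := (Asymptotics.isBigO_refl _ _).mul_isLittleO hγ
  refine ((hlevel.const_mul_left (Real.pi * F / (2 * p₀))).add hforce).congr' ?_ .rfl
  filter_upwards [self_mem_nhdsWithin] with ρ (hρ : 0 < ρ)
  simp only [ht, ht₀, rankLevel]
  field_simp
  ring

lemma tendsto_rankValue (h : RankAsymptotics A u x₀ p₀ F L) {B γ : ℝ → ℝ} {F' γ₀ : ℝ}
    (hB : Tendsto (fun ρ => B ρ / ρ ^ 2) (𝓝[>] 0) (𝓝 0))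
    (hγ : (fun ρ => Real.pi * F / p₀ * (3 * B ρ / ρ ^ 3) - γ ρ * F') =o[𝓝[>] 0] γ)
    (hγ₀ : Tendsto γ (𝓝[>] 0) (𝓝 γ₀)) :
    Tendsto (fun ρ => (rankValue (A ρ) u (area (A ρ) / 2 + B ρ) - u x₀) / (ρ ^ 2 / 6)) (𝓝[>] 0)
      (𝓝 (L + γ₀ * F')) := by
  have hbias := (h.isLittleO_rankValue_sub_median hB hγ).trans_isBigO
    ((Asymptotics.isBigO_refl (fun ρ : ℝ => ρ ^ 2 / 6) _).mul (hγ₀.isBigO_one ℝ))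
  simp only [mul_one] at hbias
  have hlim := (h.tendsto_median.add hbias.tendsto_div_nhds_zero).add (hγ₀.mul_const F')
  rw [add_zero] at hlim
  refine hlim.congr' ?_
  filter_upwards [self_mem_nhdsWithin] with ρ (hρ : 0 < ρ)
  field_simp
  ring

variable {Ω : Set Plane} {f : Plane → ℝ} {χ : Plane} {α : ℝ}

lemma approximatesForce {bias : ℝ → ℝ → ℝ} {γ : ℝ → ℝ} {F' : ℝ}
    (h : RankAsymptotics (amoeba Ω f x₀) u x₀ p₀ F (contourRHS f u x₀ χ α))
    (hB : Tendsto (fun ρ => bias ρ (area (amoeba Ω f x₀ ρ)) / ρ ^ 2) (𝓝[>] 0) (𝓝 0))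
    (hγ : (fun ρ => Real.pi * F / p₀ * (3 * bias ρ (area (amoeba Ω f x₀ ρ)) / ρ ^ 3) - γ ρ * F')
      =o[𝓝[>] 0] γ) :
    ApproximatesForce Ω f u x₀ χ α bias γ F' := by
  refine ⟨h.eventually_rankAttained h.half_mem_Ioo ?_, h.isLittleO_rankValue_sub_median hB hγ,
    fun γ₀ hγ₀ => h.tendsto_rankValue hB hγ hγ₀⟩
  simpa only [biasedRank, add_div, add_zero] using h.tendsto_half_area.add hB

lemma approximatesForce_offset
    (h : RankAsymptotics (amoeba Ω f x₀) u x₀ p₀ F (contourRHS f u x₀ χ α)) {b : ℝ → ℝ}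
    (hb : b =o[𝓝[>] 0] fun ρ : ℝ => ρ ^ 2) :
    ApproximatesForce Ω f u x₀ χ α (fun ρ _ => b ρ) (fun ρ => 3 * b ρ / ρ ^ 3)
      (Real.pi * F / p₀) := by
  refine h.approximatesForce hb.tendsto_div_nhds_zero ?_
  simp only [mul_comm (Real.pi * F / p₀), sub_self]
  exact Asymptotics.isLittleO_zero _ _

lemma approximatesForce_quantile
    (h : RankAsymptotics (amoeba Ω f x₀) u x₀ p₀ F (contourRHS f u x₀ χ α)) {q : ℝ → ℝ}
    (hq : Tendsto q (𝓝[>] 0) (𝓝 0)) :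
    ApproximatesForce Ω f u x₀ χ α (fun ρ p => q ρ * p) (fun ρ => 3 * Real.pi * q ρ / ρ) F := by
  have hp := h.area_pos
  refine h.approximatesForce ?_ ?_
  · simpa only [mul_div_assoc, zero_mul] using hq.mul h.tendsto_area
  · have hratio : Tendsto (fun ρ => F * (area (amoeba Ω f x₀ ρ) / ρ ^ 2 / p₀ - 1)) (𝓝[>] 0)
        (𝓝 0) := by
      simpa [div_self hp.ne'] using ((h.tendsto_area.div_const p₀).sub_const 1).const_mul F
    refine (((Asymptotics.isLittleO_one_iff ℝ).2 hratio).mul_isBigO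
      (Asymptotics.isBigO_refl (fun ρ => 3 * Real.pi * q ρ / ρ) _)).congr' ?_ (by simp)
    filter_upwards [self_mem_nhdsWithin] with ρ (hρ : 0 < ρ)
    field_simp

lemma approximatesForce_quadratic
    (h : RankAsymptotics (amoeba Ω f x₀) u x₀ p₀ F (contourRHS f u x₀ χ α)) {r : ℝ → ℝ}
    (hr : Tendsto (fun ρ => r ρ * ρ ^ 2) (𝓝[>] 0) (𝓝 0)) :
    ApproximatesForce Ω f u x₀ χ α (fun ρ p => r ρ * p ^ 2)
      (fun ρ => 3 * Real.pi ^ 2 * ρ * r ρ) (p₀ * F / Real.pi) := by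
  have hp := h.area_pos
  refine h.approximatesForce ?_ ?_
  · have hlim := hr.mul (h.tendsto_area.pow 2)
    rw [zero_mul] at hlim
    refine hlim.congr' ?_
    filter_upwards [self_mem_nhdsWithin] with ρ (hρ : 0 < ρ)
    field_simp
  · have hratio : Tendsto (fun ρ => p₀ * F / Real.pi *
        ((area (amoeba Ω f x₀ ρ) / ρ ^ 2 / p₀) ^ 2 - 1)) (𝓝[>] 0) (𝓝 0) := by
      simpa [div_self hp.ne'] using
        (((h.tendsto_area.div_const p₀).pow 2).sub_const 1).const_mul (p₀ * F / Real.pi)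
    refine (((Asymptotics.isLittleO_one_iff ℝ).2 hratio).mul_isBigO
      (Asymptotics.isBigO_refl (fun ρ => 3 * Real.pi ^ 2 * ρ * r ρ) _)).congr' ?_ (by simp)
    filter_upwards [self_mem_nhdsWithin] with ρ (hρ : 0 < ρ)
    field_simp

lemma tendsto_quantile_rank (h : RankAsymptotics A u x₀ p₀ F L) (q : ℝ) :
    Tendsto (fun ρ => (area (A ρ) / 2 + q * area (A ρ)) / ρ ^ 2) (𝓝[>] 0)
      (𝓝 ((1 / 2 + q) * p₀)) :=
  (h.tendsto_area.const_mul (1 / 2 + q)).congr fun ρ => by ring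

lemma eventually_rankAttained_quantile (h : RankAsymptotics A u x₀ p₀ F L) {q : ℝ}
    (hq : q ∈ Ioo (-(1 / 2) : ℝ) (1 / 2)) :
    ∀ᶠ ρ in 𝓝[>] 0, RankAttained (A ρ) u (area (A ρ) / 2 + q * area (A ρ)) :=
  h.eventually_rankAttained ⟨mul_pos (by linarith [hq.1]) h.area_pos,
    mul_lt_of_lt_one_left h.area_pos (by linarith [hq.2])⟩ (h.tendsto_quantile_rank q)

lemma tendsto_rankValue_quantile (h : RankAsymptotics A u x₀ p₀ F L) {q : ℝ}
    (hq : q ∈ Ioo (-(1 / 2) : ℝ) (1 / 2)) :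
    Tendsto (fun ρ => (rankValue (A ρ) u (area (A ρ) / 2 + q * area (A ρ)) - u x₀) / ρ) (𝓝[>] 0)
      (𝓝 (diskOffset q * F)) := by
  have hdisc : (1 / 2 + q) * p₀ = p₀ / Real.pi * discArea (diskOffset q) := by
    rw [discArea_diskOffset hq]
    field_simp
  rw [mul_comm]
  exact h.tendsto_rankLevel (diskOffset_mem_Ioo hq) (hdisc ▸ h.tendsto_quantile_rank q)

end RankAsymptotics

/-! ### Perturbed ellipses -/

/-- The quadratic form `|w|² + ⟨b, w⟩²`, the first fundamental form of a graph of slope `b`. -/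
def graphNormSq (b w : ℝ × ℝ) : ℝ := w.1 ^ 2 + w.2 ^ 2 + (b.1 * w.1 + b.2 * w.2) ^ 2

lemma continuous_graphNormSq (b : ℝ × ℝ) : Continuous (graphNormSq b) := by
  unfold graphNormSq; fun_prop

lemma graphNormSq_nonneg (b w : ℝ × ℝ) : 0 ≤ graphNormSq b w := by
  unfold graphNormSq; positivity

lemma graphNormSq_neg (b w : ℝ × ℝ) : graphNormSq b (-w) = graphNormSq b w := by
  simp only [graphNormSq, Prod.fst_neg, Prod.snd_neg]; ring

lemma norm_sq_le_graphNormSq (b w : ℝ × ℝ) : ‖w‖ ^ 2 ≤ graphNormSq b w := by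
  rw [Prod.norm_def, graphNormSq]
  rcases max_choice ‖w.1‖ ‖w.2‖ with h | h <;> rw [h, Real.norm_eq_abs, sq_abs] <;>
    nlinarith [sq_nonneg w.1, sq_nonneg w.2, sq_nonneg (b.1 * w.1 + b.2 * w.2)]

lemma norm_le_of_graphNormSq_le {b w : ℝ × ℝ} {R : ℝ} (hR : 0 ≤ R)
    (h : graphNormSq b w ≤ R ^ 2) : ‖w‖ ≤ R :=
  (sq_le_sq₀ (norm_nonneg w) hR).1 ((norm_sq_le_graphNormSq b w).trans h)

/-- The sets `A ρ` are, up to `o(ρ)`, given by `|w|² + ⟨b, w⟩² + ρ T w ≤ 1`, as `ρ → 0+`. Whether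
the centre belongs to `A ρ` is left open. -/
structure IsPerturbedEllipse (b : ℝ × ℝ) (T : ℝ × ℝ → ℝ) (A : ℝ → Set (ℝ × ℝ)) : Prop where
  norm_le : ∀ᶠ ρ in 𝓝[>] 0, ∀ w ∈ A ρ, ‖w‖ ≤ 2
  graphNormSq_add_le : ∀ ε > 0, ∀ᶠ ρ in 𝓝[>] 0, ∀ w ∈ A ρ,
    graphNormSq b w + ρ * T w ≤ 1 + ε * ρ
  mem : ∀ ε > 0, ∀ᶠ ρ in 𝓝[>] 0, ∀ w, ‖w‖ ≤ 2 → w ≠ 0 →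
    graphNormSq b w + ρ * T w ≤ 1 - ε * ρ → w ∈ A ρ

/-- The functions `U ρ` converge to `w ↦ a * w.1`, in `C¹` with respect to the first variable, and
up to `o(ρ)` on the line `w.1 = 0`, as `ρ → 0+`. -/
structure IsStraightened (a : ℝ) (U : ℝ → ℝ × ℝ → ℝ) : Prop where
  continuousOn : ∀ᶠ ρ in 𝓝[>] 0, ContinuousOn (U ρ) {w | ‖w‖ ≤ 2}
  abs_sub_sub_le : ∀ ε > 0, ∀ᶠ ρ in 𝓝[>] 0, ∀ y₁ y₂ z : ℝ, ‖(y₁, z)‖ ≤ 2 → ‖(y₂, z)‖ ≤ 2 →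
    |U ρ (y₂, z) - U ρ (y₁, z) - a * (y₂ - y₁)| ≤ ε * |y₂ - y₁|
  abs_base_le : ∀ ε > 0, ∀ᶠ ρ in 𝓝[>] 0, ∀ z : ℝ, |z| ≤ 2 → |U ρ (0, z)| ≤ ε * ρ

/-- The area of the part of `A` on which `U ≤ t`. -/
def subArea (A : Set (ℝ × ℝ)) (U : ℝ × ℝ → ℝ) (t : ℝ) : ℝ := volume.real {w | w ∈ A ∧ U w ≤ t}

lemma volume_ne_top_of_norm_le {S : Set (ℝ × ℝ)} {R : ℝ} (hS : ∀ w ∈ S, ‖w‖ ≤ R) :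
    volume S ≠ ⊤ :=
  ((isBounded_iff_forall_norm_le.2 ⟨R, hS⟩).measure_lt_top).ne

lemma eventually_nhdsGT_mul_le (c : ℝ) {ε : ℝ} (hε : 0 < ε) : ∀ᶠ ρ : ℝ in 𝓝[>] 0, ρ * c ≤ ε := by
  have h : Tendsto (fun ρ : ℝ => ρ * c) (𝓝 0) (𝓝 0) := by
    simpa using (tendsto_id (x := 𝓝 (0 : ℝ))).mul_const c
  exact (h.mono_left nhdsWithin_le_nhds).eventually_le_const hε

lemma exists_abs_le_of_continuous {T : ℝ × ℝ → ℝ} (hT : Continuous T) (R : ℝ) :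
    ∃ M, ∀ w, ‖w‖ ≤ R → |T w| ≤ M := by
  obtain ⟨M, hM⟩ :=
    (isCompact_closedBall (0 : ℝ × ℝ) R).exists_bound_of_continuousOn hT.continuousOn
  exact ⟨M, fun w hw => hM w (mem_closedBall_zero_iff.2 hw)⟩

namespace IsPerturbedEllipse

variable {b : ℝ × ℝ} {T : ℝ × ℝ → ℝ} {A : ℝ → Set (ℝ × ℝ)}

lemma graphNormSq_le (h : IsPerturbedEllipse b T A) (hT : Continuous T) {ε : ℝ} (hε : 0 < ε) :
    ∀ᶠ ρ in 𝓝[>] 0, ∀ w ∈ A ρ, graphNormSq b w ≤ 1 + ε := by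
  obtain ⟨M, hM⟩ := exists_abs_le_of_continuous hT 2
  filter_upwards [h.norm_le, h.graphNormSq_add_le 1 one_pos, eventually_nhdsGT_mul_le (M + 1) hε,
    self_mem_nhdsWithin] with ρ hnorm hle hρε (hρ : 0 < ρ) w hw
  nlinarith [hle w hw, neg_abs_le (T w), hM w (hnorm w hw)]

lemma mem_of_graphNormSq_le (h : IsPerturbedEllipse b T A) (hT : Continuous T) {ε : ℝ}
    (hε : 0 < ε) :
    ∀ᶠ ρ in 𝓝[>] 0, ∀ w, w ≠ 0 → graphNormSq b w ≤ 1 - ε → w ∈ A ρ := by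
  obtain ⟨M, hM⟩ := exists_abs_le_of_continuous hT 2
  filter_upwards [h.mem 1 one_pos, eventually_nhdsGT_mul_le (M + 1) hε,
    self_mem_nhdsWithin] with ρ hmem hρε (hρ : 0 < ρ) w hw0 hw
  have hnorm : ‖w‖ ≤ 2 := norm_le_of_graphNormSq_le two_pos.le (by linarith)
  exact hmem w hnorm hw0 (by nlinarith [le_abs_self (T w), hM w hnorm])

lemma neg (h : IsPerturbedEllipse b T A) (hT : ∀ w, T (-w) = -T w) :
    IsPerturbedEllipse b (fun w => -T w) fun ρ => -A ρ where
  norm_le := h.norm_le.mono fun ρ hρ w hw => norm_neg w ▸ hρ _ hw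
  graphNormSq_add_le ε hε := (h.graphNormSq_add_le ε hε).mono fun ρ hρ w hw => by
    simpa only [graphNormSq_neg, hT] using hρ _ hw
  mem ε hε := (h.mem ε hε).mono fun ρ hρ w hw hw0 hle =>
    hρ _ ((norm_neg w).trans_le hw) (neg_ne_zero.2 hw0) (by rwa [graphNormSq_neg, hT])

end IsPerturbedEllipse

namespace IsStraightened

variable {a : ℝ} {U : ℝ → ℝ × ℝ → ℝ}

lemma abs_sub_le (h : IsStraightened a U) {ε : ℝ} (hε : 0 < ε) :
    ∀ᶠ ρ in 𝓝[>] 0, ∀ w, ‖w‖ ≤ 2 → |U ρ w - a * w.1| ≤ ε * (|w.1| + ρ) := by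
  filter_upwards [h.abs_sub_sub_le ε hε, h.abs_base_le ε hε] with ρ hincr hbase w hw
  have hw2 : |w.2| ≤ 2 := (norm_snd_le w).trans hw
  have hline := hincr 0 w.1 w.2 (by simpa [Prod.norm_def] using hw2) hw
  rw [sub_zero] at hline
  calc |U ρ w - a * w.1| = |(U ρ w - U ρ (0, w.2) - a * w.1) + U ρ (0, w.2)| := by ring_nf
    _ ≤ ε * |w.1| + ε * ρ := (abs_add_le _ _).trans (add_le_add hline (hbase _ hw2))
    _ = ε * (|w.1| + ρ) := by ring

lemma abs_sub_le_const (h : IsStraightened a U) {ε : ℝ} (hε : 0 < ε) :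
    ∀ᶠ ρ in 𝓝[>] 0, ∀ w, ‖w‖ ≤ 2 → |U ρ w - a * w.1| ≤ ε := by
  filter_upwards [h.abs_sub_le (ε := ε / 3) (by positivity), eventually_nhdsGT_mul_le 1 one_pos]
    with ρ hU hρ w hw
  have hw1 : |w.1| ≤ 2 := (norm_fst_le w).trans hw
  calc |U ρ w - a * w.1| ≤ ε / 3 * (|w.1| + ρ) := hU w hw
    _ ≤ ε / 3 * (2 + 1) := by gcongr; linarith
    _ = ε := by ring

end IsStraightened

lemma volume_graphNormSq_le_inter {b : ℝ × ℝ} {s a r : ℝ} (hs : s ^ 2 = b.1 ^ 2 + b.2 ^ 2)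
    (ha : 0 < a) (hr : 0 < r) (t : ℝ) :
    volume.real {w | graphNormSq b w ≤ r ∧ a * w.1 ≤ t}
      = r / nu s * discArea (t / (a * nu b.2 / nu s * Real.sqrt r)) := by
  have hνs := nu_pos s
  have hν := nu_pos b.2
  have := Real.sqrt_pos.2 hr
  set L := Matrix.toLin (Module.Basis.finTwoProd ℝ) (Module.Basis.finTwoProd ℝ)
    !![nu s / nu b.2 / √r, 0; b.1 * b.2 / nu b.2 / √r, nu b.2 / √r] with hL
  have hdet : LinearMap.det L = nu s / r := by
    rw [hL, LinearMap.det_toLin, Matrix.det_fin_two_of, zero_mul, sub_zero]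
    field_simp
    rw [Real.sq_sqrt hr.le]
  have hnorm (w : ℝ × ℝ) : (L w).1 ^ 2 + (L w).2 ^ 2 = graphNormSq b w / r := by
    rw [hL, Matrix.toLin_finTwoProd_apply, graphNormSq]
    field_simp
    have hνs2 : nu s ^ 2 = 1 + (b.1 ^ 2 + b.2 ^ 2) := by rw [nu_sq, hs]
    rw [Real.sq_sqrt hr.le, nu_sq b.2]
    linear_combination r * w.1 ^ 2 * hνs2
  have hfst (w : ℝ × ℝ) :
      (L w).1 ≤ t / (a * nu b.2 / nu s * √r) ↔ a * w.1 ≤ t := by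
    have : (L w).1 = a * w.1 / (a * nu b.2 / nu s * √r) := by
      rw [hL, Matrix.toLin_finTwoProd_apply]
      field_simp
      ring
    rw [this, div_le_div_iff_of_pos_right (by positivity)]
  have hpre : {w | graphNormSq b w ≤ r ∧ a * w.1 ≤ t}
      = L ⁻¹' {w | w.1 ^ 2 + w.2 ^ 2 ≤ 1 ∧ w.1 ≤ t / (a * nu b.2 / nu s * √r)} := by
    ext w
    rw [mem_preimage, mem_ofPred_eq, mem_ofPred_eq, hnorm, hfst, div_le_one hr]
  rw [hpre, measureReal_def, Measure.addHaar_preimage_linearMap volume (by rw [hdet]; positivity),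
    hdet, inv_div, abs_of_pos (by positivity), ENNReal.toReal_mul,
    ENNReal.toReal_ofReal (by positivity), discArea, measureReal_def]

lemma tendsto_volume_graphNormSq_le_inter {b : ℝ × ℝ} {s a t₀ : ℝ} (hs : s ^ 2 = b.1 ^ 2 + b.2 ^ 2)
    (ha : 0 < a) {ι : Type*} {l : Filter ι} {r t : ι → ℝ} (hr : Tendsto r l (𝓝 1))
    (ht : Tendsto t l (𝓝 t₀)) :
    Tendsto (fun i => volume.real {w | graphNormSq b w ≤ r i ∧ a * w.1 ≤ t i}) l
      (𝓝 (1 / nu s * discArea (t₀ / (a * nu b.2 / nu s)))) := by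
  have hF : a * nu b.2 / nu s ≠ 0 := (div_pos (mul_pos ha (nu_pos _)) (nu_pos _)).ne'
  have hlim : Tendsto (fun i => r i / nu s * discArea (t i / (a * nu b.2 / nu s * √(r i)))) l
      (𝓝 (1 / nu s * discArea (t₀ / (a * nu b.2 / nu s * √1)))) :=
    (hr.div_const _).mul (continuous_discArea.continuousAt.tendsto.comp
      (ht.div (hr.sqrt.const_mul _) (by rwa [Real.sqrt_one, mul_one])))
  rw [Real.sqrt_one, mul_one] at hlim
  exact hlim.congr' ((hr.eventually_const_lt one_pos).mono fun i hi =>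
    (volume_graphNormSq_le_inter hs ha hi _).symm)

lemma volume_graphNormSq_le_inter_ne_top (b : ℝ × ℝ) (r : ℝ) (P : ℝ × ℝ → Prop) :
    volume {w | graphNormSq b w ≤ r ∧ P w} ≠ ⊤ :=
  volume_ne_top_of_norm_le (R := √r) fun w hw => Real.le_sqrt_of_sq_le
    ((norm_sq_le_graphNormSq b w).trans hw.1)

section

variable {b : ℝ × ℝ} {T : ℝ × ℝ → ℝ} {A : ℝ → Set (ℝ × ℝ)} {a : ℝ} {U : ℝ → ℝ × ℝ → ℝ}

lemma eventually_subArea_mem_Icc (hA : IsPerturbedEllipse b T A) (hT : Continuous T)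
    (hU : IsStraightened a U) (t : ℝ) {ε : ℝ} (hε : 0 < ε) :
    ∀ᶠ ρ in 𝓝[>] 0, subArea (A ρ) (U ρ) t ∈
      Icc (volume.real {w | graphNormSq b w ≤ 1 - ε ∧ a * w.1 ≤ t - ε})
        (volume.real {w | graphNormSq b w ≤ 1 + ε ∧ a * w.1 ≤ t + ε}) := by
  filter_upwards [hA.norm_le, hA.graphNormSq_le hT hε, hA.mem_of_graphNormSq_le hT hε,
    hU.abs_sub_le_const hε] with ρ hnorm hle hmem hUρ
  constructor
  · rw [measureReal_def, ← measure_sdiff_null (measure_singleton (0 : ℝ × ℝ)), ← measureReal_def]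
    refine measureReal_mono ?_ (volume_ne_top_of_norm_le fun w hw => hnorm w hw.1)
    rintro w ⟨⟨hw, hwt⟩, hw0⟩
    have hwA := hmem w hw0 hw
    exact ⟨hwA, by linarith [(abs_le.1 (hUρ w (hnorm w hwA))).2]⟩
  · refine measureReal_mono ?_ (volume_graphNormSq_le_inter_ne_top _ _ _)
    rintro w ⟨hw, hwt⟩
    exact ⟨hle w hw, by linarith [(abs_le.1 (hUρ w (hnorm w hw))).1]⟩

lemma tendsto_subArea {s : ℝ} (hs : s ^ 2 = b.1 ^ 2 + b.2 ^ 2) (ha : 0 < a)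
    (hA : IsPerturbedEllipse b T A) (hT : Continuous T) (hU : IsStraightened a U) (t : ℝ) :
    Tendsto (fun ρ => subArea (A ρ) (U ρ) t) (𝓝[>] 0)
      (𝓝 (1 / nu s * discArea (t / (a * nu b.2 / nu s)))) := by
  have hid : Tendsto (fun ε : ℝ => ε) (𝓝[>] 0) (𝓝 0) := nhdsWithin_le_nhds
  refine tendsto_of_forall_eventually_mem_Icc
    (tendsto_volume_graphNormSq_le_inter hs ha (r := fun ε => 1 - ε) (t := fun ε => t - ε) ?_ ?_)
    (tendsto_volume_graphNormSq_le_inter hs ha (r := fun ε => 1 + ε) (t := fun ε => t + ε) ?_ ?_)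
    fun ε hε => eventually_subArea_mem_Icc hA hT hU t hε
  · simpa using hid.const_sub 1
  · simpa using hid.const_sub t
  · simpa using hid.const_add 1
  · simpa using hid.const_add t

lemma eventually_subArea_extreme (ha : 0 < a) (hA : IsPerturbedEllipse b T A)
    (hU : IsStraightened a U) :
    ∀ᶠ ρ in 𝓝[>] 0, subArea (A ρ) (U ρ) (-(3 * a)) = 0 ∧
      subArea (A ρ) (U ρ) (3 * a) = volume.real (A ρ) := by
  filter_upwards [hA.norm_le, hU.abs_sub_le_const (half_pos ha)] with ρ hnorm hUρ
  have hlt : ∀ w ∈ A ρ, |U ρ w| < 3 * a := fun w hw => by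
    have hw1 := abs_le.1 ((norm_fst_le w).trans (hnorm w hw))
    have hw2 := abs_le.1 (hUρ w (hnorm w hw))
    exact abs_lt.2 ⟨by nlinarith, by nlinarith⟩
  have hempty : {w | w ∈ A ρ ∧ U ρ w ≤ -(3 * a)} = ∅ :=
    eq_empty_of_forall_notMem fun w hw => hw.2.not_gt (abs_lt.1 (hlt w hw.1)).1
  have hall : {w | w ∈ A ρ ∧ U ρ w ≤ 3 * a} = A ρ :=
    sep_eq_self_iff_mem_true.2 fun w hw => (abs_lt.1 (hlt w hw)).2.le
  rw [subArea, subArea, hempty, hall, measureReal_empty]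
  exact ⟨rfl, rfl⟩

end

section

variable {a ε t₁ t₂ : ℝ} {g : ℝ → ℝ}

lemma volume_preimage_Ioc_le {S : Set ℝ}
    (hg : ∀ y₁ ∈ S, ∀ y₂ ∈ S, |g y₂ - g y₁ - a * (y₂ - y₁)| ≤ ε * |y₂ - y₁|) (hε : ε < a) :
    volume (S ∩ g ⁻¹' Ioc t₁ t₂) ≤ ENNReal.ofReal ((t₂ - t₁) / (a - ε)) := by
  refine (Real.volume_le_diam _).trans (Metric.ediam_le fun y₁ hy₁ y₂ hy₂ => ?_)
  rw [edist_dist, Real.dist_eq]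
  refine ENNReal.ofReal_le_ofReal ((le_div_iff₀ (sub_pos.2 hε)).2 ?_)
  have hincr := hg y₂ hy₂.1 y₁ hy₁.1
  have hslope : |a * (y₁ - y₂)| ≤ |g y₁ - g y₂| + |g y₁ - g y₂ - a * (y₁ - y₂)| := by
    simpa using abs_sub (g y₁ - g y₂) (g y₁ - g y₂ - a * (y₁ - y₂))
  have hdiff : |g y₁ - g y₂| ≤ t₂ - t₁ :=
    abs_sub_le_iff.2 ⟨by linarith [hy₁.2.2, hy₂.2.1], by linarith [hy₂.2.2, hy₁.2.1]⟩
  rw [abs_mul] at hslope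
  nlinarith [le_abs_self a, abs_nonneg (y₁ - y₂)]

lemma le_volume_preimage_Ioc {l r : ℝ} (hcont : ContinuousOn g (Icc l r)) (hlr : l ≤ r)
    (hg : ∀ y₁ ∈ Icc l r, ∀ y₂ ∈ Icc l r, |g y₂ - g y₁ - a * (y₂ - y₁)| ≤ ε * |y₂ - y₁|)
    (hε : |ε| < a) (hl : g l ≤ t₁) (ht : t₁ ≤ t₂) (hr : t₂ ≤ g r) :
    ENNReal.ofReal ((t₂ - t₁) / (a + ε)) ≤ volume (Icc l r ∩ g ⁻¹' Ioc t₁ t₂) := by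
  obtain ⟨hε₁, hε₂⟩ := abs_lt.1 hε
  have hmono : StrictMonoOn g (Icc l r) := fun y₁ hy₁ y₂ hy₂ hlt => by
    have := hg y₁ hy₁ y₂ hy₂
    rw [abs_of_pos (sub_pos.2 hlt)] at this
    nlinarith [(abs_le.1 this).1]
  obtain ⟨y₁, hy₁, rfl⟩ := intermediate_value_Icc hlr hcont ⟨hl, ht.trans hr⟩
  obtain ⟨y₂, hy₂, rfl⟩ := intermediate_value_Icc hlr hcont ⟨hl.trans ht, hr⟩
  have hy : y₁ ≤ y₂ := (hmono.le_iff_le hy₁ hy₂).1 ht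
  have hincr := (abs_le.1 (hg y₁ hy₁ y₂ hy₂)).2
  rw [abs_of_nonneg (sub_nonneg.2 hy)] at hincr
  calc ENNReal.ofReal ((g y₂ - g y₁) / (a + ε)) ≤ ENNReal.ofReal (y₂ - y₁) := by
        refine ENNReal.ofReal_le_ofReal ((div_le_iff₀ (by linarith)).2 (by linarith))
    _ = volume (Ioc y₁ y₂) := Real.volume_Ioc.symm
    _ ≤ _ := measure_mono fun y hy => by
        have hyI : y ∈ Icc l r := ⟨hy₁.1.trans hy.1.le, hy.2.trans hy₂.2⟩
        exact ⟨hyI, hmono hy₁ hyI hy.1, hmono.monotoneOn hyI hy₂ hy.2⟩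

end

/-- The part of the slab `|w.2| ≤ h` of the square `‖w‖ ≤ 2` on which `t₁ < U w ≤ t₂`. -/
def strip (U : ℝ × ℝ → ℝ) (h t₁ t₂ : ℝ) : Set (ℝ × ℝ) :=
  {w | ‖w‖ ≤ 2 ∧ |w.2| ≤ h ∧ U w ∈ Ioc t₁ t₂}

section

variable {U : ℝ × ℝ → ℝ} {h t₁ t₂ : ℝ}

lemma measurableSet_norm_le_and_le (hU : ContinuousOn U {w | ‖w‖ ≤ 2}) (t : ℝ) :
    MeasurableSet {w | ‖w‖ ≤ 2 ∧ U w ≤ t} :=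
  (hU.preimage_isClosed_of_isClosed (isClosed_le continuous_norm continuous_const)
    isClosed_Iic).measurableSet

lemma subArea_sub_subArea {A : Set (ℝ × ℝ)} (hA : ∀ w ∈ A, ‖w‖ ≤ 2)
    (hU : ContinuousOn U {w | ‖w‖ ≤ 2}) (ht : t₁ ≤ t₂) :
    subArea A U t₂ - subArea A U t₁ = volume.real {w | w ∈ A ∧ U w ∈ Ioc t₁ t₂} := by
  have hle : {w | w ∈ A ∧ U w ≤ t₂} ∩ {w | ‖w‖ ≤ 2 ∧ U w ≤ t₁} = {w | w ∈ A ∧ U w ≤ t₁} := by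
    ext w
    exact ⟨fun hw => ⟨hw.1.1, hw.2.2⟩, fun hw => ⟨⟨hw.1, hw.2.trans ht⟩, hA w hw.1, hw.2⟩⟩
  have hgt : {w | w ∈ A ∧ U w ≤ t₂} \ {w | ‖w‖ ≤ 2 ∧ U w ≤ t₁}
      = {w | w ∈ A ∧ U w ∈ Ioc t₁ t₂} := by
    ext w
    exact ⟨fun hw => ⟨hw.1.1, lt_of_not_ge fun hle => hw.2 ⟨hA w hw.1.1, hle⟩, hw.1.2⟩,
      fun hw => ⟨⟨hw.1, hw.2.2⟩, fun hle => hle.2.not_gt hw.2.1⟩⟩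
  have hsplit := measureReal_inter_add_sdiff (μ := volume) (s := {w | w ∈ A ∧ U w ≤ t₂})
    (measurableSet_norm_le_and_le hU t₁) (volume_ne_top_of_norm_le fun w hw => hA w hw.1)
  rw [hle, hgt] at hsplit
  rw [subArea, subArea, ← hsplit, add_sub_cancel_left]

lemma measurableSet_strip (hU : ContinuousOn U {w | ‖w‖ ≤ 2}) :
    MeasurableSet (strip U h t₁ t₂) := by
  have : strip U h t₁ t₂ = ({w | ‖w‖ ≤ 2 ∧ U w ≤ t₂} \ {w | ‖w‖ ≤ 2 ∧ U w ≤ t₁})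
      ∩ {w | |w.2| ≤ h} := by
    ext w
    simp only [strip, mem_ofPred_eq, mem_inter_iff, Set.mem_sdiff, mem_Ioc, not_and, not_le]
    tauto
  rw [this]
  exact ((measurableSet_norm_le_and_le hU t₂).diff (measurableSet_norm_le_and_le hU t₁)).inter
    (isClosed_le (by fun_prop) continuous_const).measurableSet

lemma preimage_strip_of_abs_le {z : ℝ} (hz : |z| ≤ h) (hz2 : |z| ≤ 2) :
    (fun y => (y, z)) ⁻¹' strip U h t₁ t₂ = Icc (-2) 2 ∩ (fun y => U (y, z)) ⁻¹' Ioc t₁ t₂ := by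
  ext y
  simp only [strip, mem_preimage, mem_ofPred_eq, Prod.norm_def, Real.norm_eq_abs, max_le_iff,
    hz, hz2, and_true, true_and, mem_inter_iff]
  rw [mem_Icc, ← abs_le]

lemma volume_strip_eq_lintegral (hU : ContinuousOn U {w | ‖w‖ ≤ 2}) (hh : h ≤ 2) :
    volume (strip U h t₁ t₂)
      = ∫⁻ z in Icc (-h) h, volume (Icc (-2) 2 ∩ (fun y => U (y, z)) ⁻¹' Ioc t₁ t₂) := by
  rw [Measure.volume_eq_prod, Measure.prod_apply_symm (measurableSet_strip hU),
    ← lintegral_indicator measurableSet_Icc]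
  refine lintegral_congr fun z => ?_
  by_cases hz : z ∈ Icc (-h) h
  · rw [indicator_of_mem hz, preimage_strip_of_abs_le (abs_le.2 hz) ((abs_le.2 hz).trans hh)]
  · rw [indicator_of_notMem hz]
    exact measure_mono_null (fun y hy => hz (abs_le.1 hy.2.1)) measure_empty

variable {a ε : ℝ}

lemma volume_real_strip_le (hU : ContinuousOn U {w | ‖w‖ ≤ 2}) (hh : h ∈ Icc 0 2)
    (hincr : ∀ y₁ y₂ z : ℝ, ‖(y₁, z)‖ ≤ 2 → ‖(y₂, z)‖ ≤ 2 →
      |U (y₂, z) - U (y₁, z) - a * (y₂ - y₁)| ≤ ε * |y₂ - y₁|) (hε : ε < a) (ht : t₁ ≤ t₂) :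
    volume.real (strip U h t₁ t₂) ≤ 2 * h / (a - ε) * (t₂ - t₁) := by
  have : 0 ≤ a - ε := (sub_pos.2 hε).le
  have : 0 ≤ t₂ - t₁ := sub_nonneg.2 ht
  have hh0 := hh.1
  refine ENNReal.toReal_le_of_le_ofReal (by positivity) ?_
  calc volume (strip U h t₁ t₂)
      ≤ ∫⁻ _ in Icc (-h) h, ENNReal.ofReal ((t₂ - t₁) / (a - ε)) := by
        rw [volume_strip_eq_lintegral hU hh.2]
        refine setLIntegral_mono measurable_const fun z hz => ?_
        have hz2 := (abs_le.2 hz).trans hh.2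
        exact volume_preimage_Ioc_le (fun y₁ hy₁ y₂ hy₂ => hincr y₁ y₂ z
          (max_le (abs_le.2 hy₁) hz2) (max_le (abs_le.2 hy₂) hz2)) hε
    _ = ENNReal.ofReal (2 * h / (a - ε) * (t₂ - t₁)) := by
        rw [setLIntegral_const, Real.volume_Icc, ← ENNReal.ofReal_mul (by positivity)]
        congr 1
        ring

lemma le_volume_real_strip (hU : ContinuousOn U {w | ‖w‖ ≤ 2}) (hh : h ∈ Icc 0 2)
    (hincr : ∀ y₁ y₂ z : ℝ, ‖(y₁, z)‖ ≤ 2 → ‖(y₂, z)‖ ≤ 2 →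
      |U (y₂, z) - U (y₁, z) - a * (y₂ - y₁)| ≤ ε * |y₂ - y₁|) (hε : |ε| < a) (ht : t₁ ≤ t₂)
    (hl : ∀ z, |z| ≤ 2 → U (-2, z) ≤ t₁) (hr : ∀ z, |z| ≤ 2 → t₂ ≤ U (2, z)) :
    2 * h / (a + ε) * (t₂ - t₁) ≤ volume.real (strip U h t₁ t₂) := by
  have hbound : 0 ≤ (t₂ - t₁) / (a + ε) :=
    div_nonneg (sub_nonneg.2 ht) (by linarith [(abs_lt.1 hε).1])
  have hfin : volume (strip U h t₁ t₂) ≠ ⊤ := volume_ne_top_of_norm_le fun w hw => hw.1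
  refine (ENNReal.ofReal_le_iff_le_toReal hfin).1 ?_
  calc ENNReal.ofReal (2 * h / (a + ε) * (t₂ - t₁))
      = ∫⁻ _ in Icc (-h) h, ENNReal.ofReal ((t₂ - t₁) / (a + ε)) := by
        rw [setLIntegral_const, Real.volume_Icc, ← ENNReal.ofReal_mul hbound]
        congr 1
        ring
    _ ≤ volume (strip U h t₁ t₂) := by
        rw [volume_strip_eq_lintegral hU hh.2]
        refine setLIntegral_mono' measurableSet_Icc fun z hz => ?_
        have hz2 := (abs_le.2 hz).trans hh.2
        have hmem : ∀ y ∈ Icc (-2 : ℝ) 2, ‖(y, z)‖ ≤ 2 := fun y hy => max_le (abs_le.2 hy) hz2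
        exact le_volume_preimage_Ioc (hU.comp (by fun_prop) hmem) (by norm_num)
          (fun y₁ hy₁ y₂ hy₂ => hincr y₁ y₂ z (hmem _ hy₁) (hmem _ hy₂)) hε (hl z hz2) ht
          (hr z hz2)

end

lemma exists_abs_graphNormSq_sub_le (b : ℝ × ℝ) :
    ∃ C > 0, ∀ w, ‖w‖ ≤ 2 → |graphNormSq b w - (nu b.2 * w.2) ^ 2| ≤ C * |w.1| := by
  obtain ⟨M, hM⟩ := exists_abs_le_of_continuous
    (T := fun w => (1 + b.1 ^ 2) * w.1 + 2 * b.1 * b.2 * w.2) (by fun_prop) 2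
  refine ⟨|M| + 1, by positivity, fun w hw => ?_⟩
  have hfactor : graphNormSq b w - (nu b.2 * w.2) ^ 2
      = ((1 + b.1 ^ 2) * w.1 + 2 * b.1 * b.2 * w.2) * w.1 := by
    rw [graphNormSq, mul_pow, nu_sq]
    ring
  rw [hfactor, abs_mul]
  gcongr
  linarith [hM w hw, le_abs_self M]

lemma IsStraightened.eventually_abs_fst_le {a : ℝ} {U : ℝ → ℝ × ℝ → ℝ} (hU : IsStraightened a U)
    (ha : 0 < a) {δ : ℝ} (hδ : 0 < δ) :
    ∀ᶠ p : ℝ × ℝ × ℝ in 𝓝[>] 0 ×ˢ 𝓝 0 ×ˢ 𝓝 0,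
      ∀ w, ‖w‖ ≤ 2 → U p.1 w ∈ Ioc p.2.1 p.2.2 → |w.1| ≤ δ := by
  have hδ' : 0 < a * δ / 2 := by positivity
  have ht₁ : ∀ᶠ t : ℝ in 𝓝 0, -(a * δ / 2) ≤ t := eventually_ge_nhds (by linarith)
  have ht₂ : ∀ᶠ t : ℝ in 𝓝 0, t ≤ a * δ / 2 := eventually_le_nhds hδ'
  filter_upwards [(hU.abs_sub_le_const hδ').prod_mk (ht₁.prod_mk ht₂)]
    with ⟨ρ, t₁, t₂⟩ ⟨hUρ, ht₁, ht₂⟩ w hw hwt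
  have := abs_le.1 (hUρ w hw)
  simp only [mem_Ioc] at hwt ht₁ ht₂ this
  refine abs_le.2 ⟨?_, ?_⟩ <;> nlinarith

section

variable {b : ℝ × ℝ} {T : ℝ × ℝ → ℝ} {A : ℝ → Set (ℝ × ℝ)} {a : ℝ} {U : ℝ → ℝ × ℝ → ℝ}

lemma eventually_subset_strip (hA : IsPerturbedEllipse b T A) (hT : Continuous T)
    (hU : IsStraightened a U) (ha : 0 < a) {h : ℝ} (hh : 1 < nu b.2 * h) :
    ∀ᶠ p : ℝ × ℝ × ℝ in 𝓝[>] 0 ×ˢ 𝓝 0 ×ˢ 𝓝 0,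
      {w | w ∈ A p.1 ∧ U p.1 w ∈ Ioc p.2.1 p.2.2} ⊆ strip (U p.1) h p.2.1 p.2.2 := by
  obtain ⟨C, hC, hCw⟩ := exists_abs_graphNormSq_sub_le b
  have hδ : 0 < ((nu b.2 * h) ^ 2 - 1) / (1 + C) := div_pos (by nlinarith) (by positivity)
  set δ := ((nu b.2 * h) ^ 2 - 1) / (1 + C) with hδdef
  rw [eq_div_iff (by positivity)] at hδdef
  filter_upwards [hA.norm_le.prod_inl _, (hA.graphNormSq_le hT hδ).prod_inl _,
    hU.eventually_abs_fst_le ha hδ] with p hnorm hle hfst w ⟨hwA, hwt⟩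
  have hw := hnorm w hwA
  refine ⟨hw, ?_, hwt⟩
  have hsq : (nu b.2 * |w.2|) ^ 2 ≤ (nu b.2 * h) ^ 2 := by
    rw [mul_pow, sq_abs, ← mul_pow]
    nlinarith [hle w hwA, (abs_le.1 (hCw w hw)).1, hfst w hw hwt]
  exact le_of_mul_le_mul_left (le_of_sq_le_sq hsq (by linarith)) (nu_pos _)

lemma eventually_strip_subset (hA : IsPerturbedEllipse b T A) (hT : Continuous T)
    (hU : IsStraightened a U) (ha : 0 < a) {h : ℝ} (h0 : 0 ≤ h) (hh : nu b.2 * h < 1) :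
    ∀ᶠ p : ℝ × ℝ × ℝ in 𝓝[>] 0 ×ˢ 𝓝 0 ×ˢ 𝓝 0,
      strip (U p.1) h p.2.1 p.2.2 \ {0} ⊆ {w | w ∈ A p.1 ∧ U p.1 w ∈ Ioc p.2.1 p.2.2} := by
  obtain ⟨C, hC, hCw⟩ := exists_abs_graphNormSq_sub_le b
  have hν := nu_pos b.2
  have hδ : 0 < (1 - (nu b.2 * h) ^ 2) / (1 + C) :=
    div_pos (sub_pos.2 ((sq_lt_one_iff₀ (by positivity)).2 hh)) (by positivity)
  set δ := (1 - (nu b.2 * h) ^ 2) / (1 + C) with hδdef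
  rw [eq_div_iff (by positivity)] at hδdef
  filter_upwards [(hA.mem_of_graphNormSq_le hT hδ).prod_inl _, hU.eventually_abs_fst_le ha hδ]
    with p hmem hfst w ⟨⟨hw, hwh, hwt⟩, hw0⟩
  have hsq : (nu b.2 * w.2) ^ 2 ≤ (nu b.2 * h) ^ 2 := by
    rw [mul_pow, mul_pow, ← sq_abs w.2]
    gcongr
  exact ⟨hmem w hw0 (by nlinarith [(abs_le.1 (hCw w hw)).2, hfst w hw hwt]), hwt⟩

lemma eventually_subArea_sub_mem_Icc (hA : IsPerturbedEllipse b T A) (hT : Continuous T)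
    (hU : IsStraightened a U) (ha : 0 < a) {ε : ℝ} (hε : ε ∈ Ioo 0 1) (hεa : ε < a) :
    ∀ᶠ p : ℝ × ℝ × ℝ in 𝓝[>] 0 ×ˢ 𝓝 0 ×ˢ 𝓝 0, p.2.1 ≤ p.2.2 →
      subArea (A p.1) (U p.1) p.2.2 - subArea (A p.1) (U p.1) p.2.1 ∈
        Icc (2 * ((1 - ε) / nu b.2) / (a + ε) * (p.2.2 - p.2.1))
          (2 * ((1 + ε) / nu b.2) / (a - ε) * (p.2.2 - p.2.1)) := by
  have hν := nu_pos b.2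
  have hν1 := one_le_nu b.2
  have hlo : (1 - ε) / nu b.2 ∈ Icc (0 : ℝ) 2 :=
    ⟨div_nonneg (by linarith [hε.2]) hν.le, (div_le_iff₀ hν).2 (by linarith [hε.1])⟩
  have hhi : (1 + ε) / nu b.2 ∈ Icc (0 : ℝ) 2 :=
    ⟨div_nonneg (by linarith [hε.1]) hν.le, (div_le_iff₀ hν).2 (by linarith [hε.2])⟩
  have ht₁ : ∀ᶠ t : ℝ in 𝓝 0, -a ≤ t := eventually_ge_nhds (by linarith)
  have ht₂ : ∀ᶠ t : ℝ in 𝓝 0, t ≤ a := eventually_le_nhds ha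
  filter_upwards [(hA.norm_le.and (hU.continuousOn.and ((hU.abs_sub_sub_le ε hε.1).and
      (hU.abs_sub_le_const ha)))).prod_mk (ht₁.prod_mk ht₂),
    eventually_subset_strip hA hT hU ha (h := (1 + ε) / nu b.2)
      (by rw [mul_div_cancel₀ _ hν.ne']; linarith [hε.1]),
    eventually_strip_subset hA hT hU ha hlo.1
      (by rw [mul_div_cancel₀ _ hν.ne']; linarith [hε.1])]
    with ⟨ρ, t₁, t₂⟩ ⟨⟨hnorm, hcont, hincr, hline⟩, ht₁, ht₂⟩ hupper hlower ht
  have hnorm_line : ∀ y z : ℝ, |y| = 2 → |z| ≤ 2 → ‖(y, z)‖ ≤ 2 := fun y z hy hz => max_le hy.le hz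
  rw [subArea_sub_subArea hnorm hcont ht]
  constructor
  · refine (le_volume_real_strip hcont hlo hincr (by rwa [abs_of_pos hε.1]) ht
      (fun z hz => ?_) (fun z hz => ?_)).trans ?_
    · have := (abs_le.1 (hline (-2, z) (hnorm_line _ _ (by norm_num) hz))).2
      simp only at this ht₁
      linarith
    · have := (abs_le.1 (hline (2, z) (hnorm_line _ _ (by norm_num) hz))).1
      simp only at this ht₂
      linarith
    · rw [measureReal_def, ← measure_sdiff_null (measure_singleton (0 : ℝ × ℝ)), ← measureReal_def]
      exact measureReal_mono hlower (volume_ne_top_of_norm_le fun w hw => hnorm w hw.1)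
  · exact (measureReal_mono hupper (volume_ne_top_of_norm_le fun w hw => hw.1)).trans
      (volume_real_strip_le hcont hhi hincr hεa ht)

lemma isLittleO_subArea_sub (hA : IsPerturbedEllipse b T A) (hT : Continuous T)
    (hU : IsStraightened a U) (ha : 0 < a) :
    (fun p : ℝ × ℝ × ℝ => subArea (A p.1) (U p.1) p.2.2 - subArea (A p.1) (U p.1) p.2.1
      - 2 / (a * nu b.2) * (p.2.2 - p.2.1)) =o[𝓝[>] 0 ×ˢ 𝓝 0 ×ˢ 𝓝 0] fun p => p.2.2 - p.2.1 := by
  have hν := nu_pos b.2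
  have hlim (σ : ℝ) : Tendsto (fun ε : ℝ => 2 * ((1 + σ * ε) / nu b.2) / (a - σ * ε)) (𝓝[>] 0)
      (𝓝 (2 / (a * nu b.2))) := by
    have : ContinuousAt (fun ε : ℝ => 2 * ((1 + σ * ε) / nu b.2) / (a - σ * ε)) 0 :=
      ContinuousAt.div (by fun_prop) (by fun_prop) (by simpa using ha.ne')
    convert! this.tendsto.mono_left nhdsWithin_le_nhds using 2
    field_simp
    simp [ha.ne']
  refine Asymptotics.isLittleO_iff.2 fun c hc => ?_
  have hlo_lim := (hlim (-1)).eventually_const_le (show 2 / (a * nu b.2) - c < _ by linarith)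
  have hhi_lim := (hlim 1).eventually_le_const (show _ < 2 / (a * nu b.2) + c by linarith)
  obtain ⟨ε, hlo, hhi, hε0, hε⟩ :=
    (hlo_lim.and (hhi_lim.and (Ioo_mem_nhdsGT (lt_min one_pos ha)))).exists
  obtain ⟨hε1, hεa⟩ := lt_min_iff.1 hε
  simp only [neg_mul, one_mul, ← sub_eq_add_neg, sub_neg_eq_add] at hlo hhi
  have hswap : Tendsto (fun p : ℝ × ℝ × ℝ => (p.1, p.2.swap)) (𝓝[>] 0 ×ˢ 𝓝 0 ×ˢ 𝓝 0)
      (𝓝[>] 0 ×ˢ 𝓝 0 ×ˢ 𝓝 0) :=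
    tendsto_fst.prodMk (tendsto_prod_swap.comp tendsto_snd)
  have hordered := eventually_subArea_sub_mem_Icc hA hT hU ha ⟨hε0, hε1⟩ hεa
  filter_upwards [hordered, hswap.eventually hordered] with ⟨ρ, t₁, t₂⟩ h₁₂ h₂₁
  simp only [Prod.swap_prod_mk, Real.norm_eq_abs] at h₁₂ h₂₁ ⊢
  rcases le_total t₁ t₂ with ht | ht
  · rw [abs_of_nonneg (sub_nonneg.2 ht)]
    refine abs_le.2 ⟨?_, ?_⟩ <;> nlinarith [(h₁₂ ht).1, (h₁₂ ht).2]
  · rw [abs_of_nonpos (sub_nonpos.2 ht)]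
    refine abs_le.2 ⟨?_, ?_⟩ <;> nlinarith [(h₂₁ ht).1, (h₂₁ ht).2]

lemma monotone_subArea {A : Set (ℝ × ℝ)} {U : ℝ × ℝ → ℝ} (hA : ∀ w ∈ A, ‖w‖ ≤ 2) :
    Monotone (subArea A U) := fun _ _ ht =>
  measureReal_mono (fun _ hw => ⟨hw.1, hw.2.trans ht⟩)
    (volume_ne_top_of_norm_le fun w hw => hA w hw.1)

lemma eventually_continuous_subArea (hA : ∀ᶠ ρ in 𝓝[>] 0, ∀ w ∈ A ρ, ‖w‖ ≤ 2)
    (hU : IsStraightened a U) (ha : 0 < a) :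
    ∀ᶠ ρ in 𝓝[>] 0, Continuous (subArea (A ρ) (U ρ)) := by
  filter_upwards [hA, hU.continuousOn, hU.abs_sub_sub_le _ (half_pos ha)]
    with ρ hnorm hcont hincr
  refine (LipschitzWith.of_le_add_mul (Real.toNNReal (2 * 2 / (a - a / 2)))
    fun t₁ t₂ => ?_).continuous
  rw [Real.coe_toNNReal _ (by rw [sub_half]; positivity), Real.dist_eq, ← sub_le_iff_le_add']
  rcases le_total t₁ t₂ with ht | ht
  · exact (sub_nonpos.2 (monotone_subArea hnorm ht)).trans (by rw [sub_half]; positivity)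
  · rw [abs_of_nonneg (sub_nonneg.2 ht), subArea_sub_subArea hnorm hcont ht]
    have hsub : {w | w ∈ A ρ ∧ U ρ w ∈ Ioc t₂ t₁} ⊆ strip (U ρ) 2 t₂ t₁ := fun w hw =>
      ⟨hnorm w hw.1, (norm_snd_le w).trans (hnorm w hw.1), hw.2⟩
    exact (measureReal_mono hsub (volume_ne_top_of_norm_le fun w hw => hw.1)).trans
      (volume_real_strip_le hcont ⟨two_pos.le, le_rfl⟩ hincr (by linarith) ht)

end

/-- The point of the unit circle at angle `φ`. -/
def circlePoint (φ : ℝ) : ℝ × ℝ := (Real.cos φ, Real.sin φ)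

lemma continuous_circlePoint : Continuous circlePoint := by unfold circlePoint; fun_prop

lemma lintegral_polar_region {α β : ℝ} {R : ℝ → ℝ} (hR : Measurable R) (hR0 : ∀ φ, 0 ≤ R φ) :
    ∫⁻ p in {p : ℝ × ℝ | p.2 ∈ Ioo α β ∧ p.1 ∈ Ioc 0 (R p.2)}, ENNReal.ofReal p.1
      = ∫⁻ φ in Ioo α β, ENNReal.ofReal (R φ ^ 2 / 2) := by
  have hmeas : MeasurableSet {p : ℝ × ℝ | p.2 ∈ Ioo α β ∧ p.1 ∈ Ioc 0 (R p.2)} :=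
    (measurable_snd measurableSet_Ioo).inter
      ((measurableSet_lt measurable_const measurable_fst).inter
        (measurableSet_le measurable_fst (hR.comp measurable_snd)))
  rw [← lintegral_indicator hmeas, Measure.volume_eq_prod, lintegral_prod_symm _
    ((by fun_prop : Measurable fun p : ℝ × ℝ => ENNReal.ofReal p.1).indicator hmeas).aemeasurable,
    ← lintegral_indicator measurableSet_Ioo]
  refine lintegral_congr fun φ => ?_
  by_cases hφ : φ ∈ Ioo α β
  · have hslice : ∀ r, {p : ℝ × ℝ | p.2 ∈ Ioo α β ∧ p.1 ∈ Ioc 0 (R p.2)}.indicator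
        (fun p => ENNReal.ofReal p.1) (r, φ)
        = (Ioc 0 (R φ)).indicator (fun r => ENNReal.ofReal r) r := fun r => by
      simp only [indicator, mem_ofPred_eq, hφ, true_and]
    simp_rw [hslice]
    rw [indicator_of_mem hφ, lintegral_indicator measurableSet_Ioc,
      ← ofReal_integral_eq_lintegral_ofReal (f := fun r => r)
        (μ := volume.restrict (Ioc 0 (R φ))) continuous_id'.integrableOn_Ioc
        ((ae_restrict_mem measurableSet_Ioc).mono fun r hr => hr.1.le),
      ← intervalIntegral.integral_of_le (hR0 φ), integral_id, zero_pow two_ne_zero, sub_zero]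
  · rw [indicator_of_notMem hφ]
    refine lintegral_eq_zero_of_ae_eq_zero (.of_forall fun r => indicator_of_notMem ?_ _)
    exact fun hr => hφ hr.1

lemma volume_real_eq_integral_polar {S : Set (ℝ × ℝ)} (hS : MeasurableSet S) {α β : ℝ}
    (hαβ : α ≤ β) {R : ℝ → ℝ} (hR : Continuous R) (hR0 : ∀ φ, 0 ≤ R φ)
    (hmem : ∀ r φ, 0 < r → (r • circlePoint φ ∈ S ∧ φ ∈ Ioo (-Real.pi) Real.pi ↔
      φ ∈ Ioo α β ∧ r ≤ R φ)) :
    volume.real S = ∫ φ in α..β, R φ ^ 2 / 2 := by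
  have hpre : polarCoord.symm ⁻¹' S ∩ polarCoord.target
      = {p : ℝ × ℝ | p.2 ∈ Ioo α β ∧ p.1 ∈ Ioc 0 (R p.2)} := by
    ext ⟨r, φ⟩
    rw [polarCoord_target, mem_inter_iff, mem_preimage, polarCoord_symm_apply]
    have := hmem r φ
    simp only [circlePoint, Prod.smul_mk, smul_eq_mul] at this
    simp only [mem_prod, mem_Ioi, mem_ofPred_eq, mem_Ioc]
    tauto
  have hpreS : MeasurableSet (polarCoord.symm ⁻¹' S) := continuous_polarCoord_symm.measurable hS
  have hvol : volume S = ∫⁻ φ in Ioo α β, ENNReal.ofReal (R φ ^ 2 / 2) := by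
    rw [← lintegral_polar_region hR.measurable hR0, ← hpre, ← lintegral_indicator_one hS,
      ← lintegral_comp_polarCoord_symm, ← setLIntegral_indicator hpreS]
    refine lintegral_congr fun p => ?_
    by_cases hp : p ∈ polarCoord.symm ⁻¹' S
    · rw [indicator_of_mem hp, indicator_of_mem (mem_preimage.1 hp), Pi.one_apply, smul_eq_mul,
        mul_one]
    · rw [indicator_of_notMem hp, indicator_of_notMem (mt mem_preimage.2 hp), smul_zero]
  rw [measureReal_def, hvol, intervalIntegral.integral_of_le hαβ, integral_Ioc_eq_integral_Ioo,
    integral_eq_lintegral_of_nonneg_ae (.of_forall fun φ => by positivity)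
      (by fun_prop)]

section Sector

variable {b : ℝ × ℝ} {T : ℝ × ℝ → ℝ}

/-- The norm whose square is the first fundamental form `graphNormSq b`. -/
def graphNorm (b w : ℝ × ℝ) : ℝ := √(graphNormSq b w)

lemma continuous_graphNorm (b : ℝ × ℝ) : Continuous (graphNorm b) :=
  (continuous_graphNormSq b).sqrt

lemma graphNorm_sq (b w : ℝ × ℝ) : graphNorm b w ^ 2 = graphNormSq b w :=
  Real.sq_sqrt (graphNormSq_nonneg b w)

lemma norm_le_graphNorm (b w : ℝ × ℝ) : ‖w‖ ≤ graphNorm b w :=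
  norm_le_of_graphNormSq_le (Real.sqrt_nonneg _) (graphNorm_sq b w).ge

lemma graphNorm_smul (b : ℝ × ℝ) {r : ℝ} (hr : 0 ≤ r) (w : ℝ × ℝ) :
    graphNorm b (r • w) = r * graphNorm b w := by
  have : graphNormSq b (r • w) = r ^ 2 * graphNormSq b w := by
    simp only [graphNormSq, Prod.smul_fst, Prod.smul_snd, smul_eq_mul]; ring
  rw [graphNorm, this, Real.sqrt_mul (sq_nonneg r), Real.sqrt_sq hr, graphNorm]

lemma one_le_graphNorm_circlePoint (b : ℝ × ℝ) (φ : ℝ) : 1 ≤ graphNorm b (circlePoint φ) := by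
  refine Real.one_le_sqrt.2 ?_
  rw [graphNormSq, circlePoint]
  nlinarith [Real.sin_sq_add_cos_sq φ, sq_nonneg (b.1 * Real.cos φ + b.2 * Real.sin φ)]

/-- The half `0 < w.1` of a perturbed ellipse, in which the cubic perturbation of the form
`graphNormSq b` is replaced by its value on the unit ellipse. -/
def sector (b : ℝ × ℝ) (T : ℝ × ℝ → ℝ) (ρ c : ℝ) : Set (ℝ × ℝ) :=
  {w | 0 < w.1 ∧ graphNormSq b w ≤ 1 + ρ * (c - T w / graphNorm b w ^ 3)}

/-- The first variation of the area of the half `0 < w.1` of the ellipse `graphNormSq b w ≤ 1`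
under the perturbation `T`, up to a factor. -/
def asymmetry (b : ℝ × ℝ) (T : ℝ × ℝ → ℝ) : ℝ :=
  ∫ φ in -(Real.pi / 2)..(Real.pi / 2), T (circlePoint φ) / graphNorm b (circlePoint φ) ^ 5

lemma asymmetry_neg : asymmetry b (fun w => -T w) = -asymmetry b T := by
  simp only [asymmetry, neg_div, intervalIntegral.integral_neg]

lemma measurableSet_sector (hT : Continuous T) (ρ c : ℝ) : MeasurableSet (sector b T ρ c) := by
  have hnormSq := (continuous_graphNormSq b).measurable
  have hnorm := (continuous_graphNorm b).measurable
  have hTm := hT.measurable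
  exact (measurableSet_lt measurable_const measurable_fst).inter
    (measurableSet_le hnormSq (by fun_prop))

lemma smul_circlePoint_mem_sector_iff (hT3 : ∀ (r : ℝ) w, T (r • w) = r ^ 3 * T w) {ρ c r φ : ℝ}
    (hr : 0 < r) :
    r • circlePoint φ ∈ sector b T ρ c ∧ φ ∈ Ioo (-Real.pi) Real.pi ↔
      φ ∈ Ioo (-(Real.pi / 2)) (Real.pi / 2) ∧
      (r * graphNorm b (circlePoint φ)) ^ 2
        ≤ 1 + ρ * (c - T (circlePoint φ) / graphNorm b (circlePoint φ) ^ 3) := by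
  have hpi := Real.pi_pos
  have hcos : 0 < Real.cos φ ∧ φ ∈ Ioo (-Real.pi) Real.pi
      ↔ φ ∈ Ioo (-(Real.pi / 2)) (Real.pi / 2) := by
    refine ⟨fun ⟨hcos, hφ⟩ => ?_, fun hφ => ⟨Real.cos_pos_of_mem_Ioo hφ, by linarith [hφ.1],
      by linarith [hφ.2]⟩⟩
    by_contra hnot
    refine hcos.not_ge ?_
    rw [← Real.cos_abs]
    refine Real.cos_nonpos_of_pi_div_two_le_of_le ?_ (by linarith [abs_lt.2 hφ])
    rwa [mem_Ioo, ← abs_lt, not_lt] at hnot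
  rw [sector, mem_ofPred_eq, ← graphNorm_sq, graphNorm_smul b hr.le, hT3, mul_pow r _ 3,
    mul_div_mul_left _ _ (by positivity), Prod.smul_fst, smul_eq_mul, mul_pos_iff_of_pos_left hr,
    circlePoint, and_right_comm, hcos]

lemma volume_real_sector (hT : Continuous T) (hT3 : ∀ (r : ℝ) w, T (r • w) = r ^ 3 * T w)
    {ρ c : ℝ}
    (hpos : ∀ φ, 0 ≤ 1 + ρ * (c - T (circlePoint φ) / graphNorm b (circlePoint φ) ^ 3)) :
    volume.real (sector b T ρ c) = (1 + ρ * c) *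
      (∫ φ in -(Real.pi / 2)..(Real.pi / 2), 1 / (2 * graphNorm b (circlePoint φ) ^ 2))
        - ρ * asymmetry b T / 2 := by
  have hNpos : ∀ φ, 0 < graphNorm b (circlePoint φ) := fun φ =>
    one_pos.trans_le (one_le_graphNorm_circlePoint b φ)
  have hN : Continuous fun φ => graphNorm b (circlePoint φ) :=
    (continuous_graphNorm b).comp continuous_circlePoint
  have hTc : Continuous fun φ => T (circlePoint φ) := hT.comp continuous_circlePoint
  have hdiv : ∀ n, Continuous fun φ => T (circlePoint φ) / graphNorm b (circlePoint φ) ^ n :=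
    fun n => hTc.div (hN.pow n) fun φ => (pow_pos (hNpos φ) n).ne'
  have hinv : Continuous fun φ => 1 / (2 * graphNorm b (circlePoint φ) ^ 2) :=
    continuous_const.div (by fun_prop) fun φ => by have := hNpos φ; positivity
  have hvol := volume_real_eq_integral_polar (α := -(Real.pi / 2)) (β := Real.pi / 2)
    (R := fun φ => √(1 + ρ * (c - T (circlePoint φ) / graphNorm b (circlePoint φ) ^ 3))
      / graphNorm b (circlePoint φ)) (measurableSet_sector hT ρ c)
    (by linarith [Real.pi_pos])
    ((((continuous_const.sub (hdiv 3)).const_mul ρ).const_add 1).sqrt.div hN fun φ =>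
      (hNpos φ).ne')
    (fun φ => div_nonneg (Real.sqrt_nonneg _) (hNpos φ).le)
    (fun r φ hr => by
      rw [smul_circlePoint_mem_sector_iff hT3 hr, le_div_iff₀ (hNpos φ),
        Real.le_sqrt (mul_pos hr (hNpos φ)).le (hpos φ)])
  rw [hvol, asymmetry, mul_div_assoc, ← intervalIntegral.integral_div,
    ← intervalIntegral.integral_const_mul, ← intervalIntegral.integral_const_mul,
    ← intervalIntegral.integral_sub (hinv.const_mul _ |>.intervalIntegrable _ _)
      (((hdiv 5).div_const 2).const_mul ρ |>.intervalIntegrable _ _)]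
  refine intervalIntegral.integral_congr fun φ _ => ?_
  have := (hNpos φ).ne'
  simp only [div_pow, Real.sq_sqrt (hpos φ)]
  field_simp
  ring

end Sector

section HalfArea

variable {b : ℝ × ℝ} {T : ℝ × ℝ → ℝ} {A : ℝ → Set (ℝ × ℝ)}

lemma abs_cube_sub_one_le {n : ℝ} (hn : n ∈ Icc 0 2) : |n ^ 3 - 1| ≤ 3 * |n ^ 2 - 1| := by
  have h3 : n ^ 3 - 1 = (n ^ 2 + n + 1) * (n - 1) := by ring
  have h2 : n ^ 2 - 1 = (n + 1) * (n - 1) := by ring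
  have hn0 := hn.1
  rw [h3, h2, abs_mul, abs_mul, abs_of_nonneg (by positivity : 0 ≤ n ^ 2 + n + 1),
    abs_of_nonneg (by positivity : 0 ≤ n + 1), ← mul_assoc]
  gcongr
  nlinarith [hn.2]

-- Far from the unit circle `n = 1` the perturbation is too small to matter, and near it `n ^ 3`
-- may be replaced by `1`.
lemma abs_cube_sub_one_mul_le {M ε ρ x n : ℝ} (hn : n ∈ Icc 0 2) (hM : |x| ≤ M) (hρ : 0 < ρ)
    (hρε : ρ * (3 * M * (2 * ε + 8 * M)) ≤ ε) (hclose : |n ^ 2 - 1| ≤ ρ * (2 * ε + 8 * M)) :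
    |ρ * x * (n ^ 3 - 1)| ≤ ε * ρ := by
  have hM0 := (abs_nonneg x).trans hM
  calc |ρ * x * (n ^ 3 - 1)| = ρ * (|x| * |n ^ 3 - 1|) := by
        rw [abs_mul, abs_mul, abs_of_pos hρ, mul_assoc]
    _ ≤ ρ * (M * (3 * (ρ * (2 * ε + 8 * M)))) := by
        have := abs_cube_sub_one_le hn
        gcongr
        linarith
    _ = ρ * (ρ * (3 * M * (2 * ε + 8 * M))) := by ring
    _ ≤ ε * ρ := by nlinarith

lemma sq_le_of_sq_add_mul_cube_le {M ε ρ x n : ℝ} (hn : n ∈ Icc 0 2) (hM : |x| ≤ M) (hε : 0 < ε)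
    (hρ : 0 < ρ) (hρε : ρ * (3 * M * (2 * ε + 8 * M)) ≤ ε)
    (h : n ^ 2 + ρ * x * n ^ 3 ≤ 1 + ε * ρ) : n ^ 2 ≤ 1 + ρ * (2 * ε - x) := by
  have hM0 := (abs_nonneg x).trans hM
  have hx := abs_le.1 hM
  have hn3 : n ^ 3 ∈ Icc (0 : ℝ) 8 :=
    ⟨pow_nonneg hn.1 3, (pow_le_pow_left₀ hn.1 hn.2 3).trans (by norm_num)⟩
  rcases lt_or_ge (n ^ 2 - 1) (-(ρ * (2 * ε + 8 * M))) with hfar | hnear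
  · nlinarith
  · have hub : n ^ 2 - 1 ≤ ρ * (2 * ε + 8 * M) := by
      have : -x * n ^ 3 ≤ 8 * M := by nlinarith [hn3.1, hn3.2]
      nlinarith
    have := (abs_le.1 (abs_cube_sub_one_mul_le hn hM hρ hρε (abs_le.2 ⟨hnear, hub⟩))).1
    linarith

lemma sq_add_mul_cube_le_of_sq_le {M ε ρ x n : ℝ} (hn : n ∈ Icc 0 2) (hM : |x| ≤ M) (hε : 0 < ε)
    (hρ : 0 < ρ) (hρε : ρ * (3 * M * (2 * ε + 8 * M)) ≤ ε)
    (h : n ^ 2 ≤ 1 + ρ * (-(2 * ε) - x)) : n ^ 2 + ρ * x * n ^ 3 ≤ 1 - ε * ρ := by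
  have hM0 := (abs_nonneg x).trans hM
  have hx := abs_le.1 hM
  have hn3 : n ^ 3 ∈ Icc (0 : ℝ) 8 :=
    ⟨pow_nonneg hn.1 3, (pow_le_pow_left₀ hn.1 hn.2 3).trans (by norm_num)⟩
  rcases lt_or_ge (n ^ 2 - 1) (-(ρ * (2 * ε + 8 * M))) with hfar | hnear
  · have : x * n ^ 3 ≤ 8 * M := by nlinarith [hn3.1, hn3.2]
    nlinarith
  · have hub : n ^ 2 - 1 ≤ ρ * (2 * ε + 8 * M) := by nlinarith
    have := (abs_le.1 (abs_cube_sub_one_mul_le hn hM hρ hρε (abs_le.2 ⟨hnear, hub⟩))).2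
    linarith

lemma exists_abs_div_graphNorm_cube_le (hT : Continuous T)
    (hT3 : ∀ (r : ℝ) w, T (r • w) = r ^ 3 * T w) : ∃ M, ∀ w, |T w / graphNorm b w ^ 3| ≤ M := by
  obtain ⟨M, hM⟩ := exists_abs_le_of_continuous hT 1
  refine ⟨M, fun w => ?_⟩
  rw [div_eq_inv_mul, ← inv_pow, ← hT3]
  refine hM _ ?_
  have hN : 0 ≤ graphNorm b w := Real.sqrt_nonneg _
  rw [norm_smul, norm_inv, Real.norm_of_nonneg hN, inv_mul_eq_div]
  exact div_le_one_of_le₀ (norm_le_graphNorm b w) hN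

lemma IsPerturbedEllipse.subset_sector (hA : IsPerturbedEllipse b T A) (hT : Continuous T)
    (hT3 : ∀ (r : ℝ) w, T (r • w) = r ^ 3 * T w) {ε : ℝ} (hε : 0 < ε) :
    ∀ᶠ ρ in 𝓝[>] 0, A ρ ∩ {w | 0 < w.1} ⊆ sector b T ρ (2 * ε) := by
  obtain ⟨M, hM⟩ := exists_abs_div_graphNorm_cube_le (b := b) hT hT3
  filter_upwards [hA.graphNormSq_add_le ε hε, hA.graphNormSq_le hT (ε := 3) (by norm_num),
    eventually_nhdsGT_mul_le (3 * M * (2 * ε + 8 * M)) hε, self_mem_nhdsWithin]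
    with ρ hadd hle hρε (hρ : 0 < ρ) w ⟨hwA, (hw1 : 0 < w.1)⟩
  have hN : 0 < graphNorm b w :=
    (hw1.trans_le ((le_abs_self _).trans (norm_fst_le w))).trans_le (norm_le_graphNorm b w)
  have hN2 : graphNorm b w ≤ 2 := Real.sqrt_le_iff.2 ⟨two_pos.le, by linarith [hle w hwA]⟩
  refine ⟨hw1, ?_⟩
  rw [← graphNorm_sq]
  refine sq_le_of_sq_add_mul_cube_le ⟨hN.le, hN2⟩ (hM w) hε hρ hρε ?_
  rw [graphNorm_sq, mul_assoc, div_mul_cancel₀ _ (by positivity)]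
  exact hadd w hwA

lemma IsPerturbedEllipse.sector_subset (hA : IsPerturbedEllipse b T A) (hT : Continuous T)
    (hT3 : ∀ (r : ℝ) w, T (r • w) = r ^ 3 * T w) {ε : ℝ} (hε : 0 < ε) :
    ∀ᶠ ρ in 𝓝[>] 0, sector b T ρ (-(2 * ε)) ⊆ A ρ ∩ {w | 0 < w.1} := by
  obtain ⟨M, hM⟩ := exists_abs_div_graphNorm_cube_le (b := b) hT hT3
  filter_upwards [hA.mem ε hε, eventually_nhdsGT_mul_le M one_pos,
    eventually_nhdsGT_mul_le (3 * M * (2 * ε + 8 * M)) hε, self_mem_nhdsWithin]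
    with ρ hmem hρM hρε (hρ : 0 < ρ) w ⟨hw1, hw⟩
  have hnorm := norm_le_graphNorm b w
  have hN : 0 < graphNorm b w :=
    (hw1.trans_le ((le_abs_self _).trans (norm_fst_le w))).trans_le hnorm
  have hN2 : graphNorm b w ≤ 2 :=
    Real.sqrt_le_iff.2 ⟨two_pos.le, by nlinarith [(abs_le.1 (hM w)).1]⟩
  refine ⟨hmem w (hnorm.trans hN2) (fun h0 => hw1.ne' (by rw [h0, Prod.fst_zero])) ?_, hw1⟩
  rw [← graphNorm_sq] at hw
  have := sq_add_mul_cube_le_of_sq_le ⟨hN.le, hN2⟩ (hM w) hε hρ hρε hw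
  rwa [graphNorm_sq, mul_assoc, div_mul_cancel₀ _ (by positivity)] at this

lemma volume_sector_ne_top (hT : Continuous T) (hT3 : ∀ (r : ℝ) w, T (r • w) = r ^ 3 * T w)
    (ρ c : ℝ) : volume (sector b T ρ c) ≠ ⊤ := by
  obtain ⟨M, hM⟩ := exists_abs_div_graphNorm_cube_le (b := b) hT hT3
  refine volume_ne_top_of_norm_le (R := √(1 + |ρ| * (|c| + M))) fun w hw => ?_
  have hle : ρ * (c - T w / graphNorm b w ^ 3) ≤ |ρ| * (|c| + M) := by
    refine (le_abs_self _).trans ?_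
    rw [abs_mul]
    gcongr
    exact (abs_sub _ _).trans (by gcongr; exact hM w)
  exact (norm_le_graphNorm b w).trans (Real.sqrt_le_sqrt (hw.2.trans (by gcongr)))

lemma eventually_volume_real_sector (hT : Continuous T)
    (hT3 : ∀ (r : ℝ) w, T (r • w) = r ^ 3 * T w) (c : ℝ) :
    ∀ᶠ ρ in 𝓝[>] 0, volume.real (sector b T ρ c) = (1 + ρ * c) *
      (∫ φ in -(Real.pi / 2)..(Real.pi / 2), 1 / (2 * graphNorm b (circlePoint φ) ^ 2))
        - ρ * asymmetry b T / 2 := by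
  obtain ⟨M, hM⟩ := exists_abs_div_graphNorm_cube_le (b := b) hT hT3
  filter_upwards [eventually_nhdsGT_mul_le (M - c) one_pos, self_mem_nhdsWithin]
    with ρ hρM (hρ : 0 < ρ)
  exact volume_real_sector hT hT3 fun φ => by nlinarith [(abs_le.1 (hM (circlePoint φ))).2]

lemma tendsto_volume_rightHalf_sub_div (hA : IsPerturbedEllipse b T A) (hT : Continuous T)
    (hT3 : ∀ (r : ℝ) w, T (r • w) = r ^ 3 * T w) :
    Tendsto (fun ρ => (volume.real (A ρ ∩ {w | 0 < w.1})
      - ∫ φ in -(Real.pi / 2)..(Real.pi / 2), 1 / (2 * graphNorm b (circlePoint φ) ^ 2)) / ρ)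
      (𝓝[>] 0) (𝓝 (-(asymmetry b T / 2))) := by
  set H := ∫ φ in -(Real.pi / 2)..(Real.pi / 2), 1 / (2 * graphNorm b (circlePoint φ) ^ 2)
  have hlim : ∀ c : ℝ, Tendsto (fun ε => c * ε * H - asymmetry b T / 2) (𝓝[>] 0)
      (𝓝 (-(asymmetry b T / 2))) := fun c => by
    refine (Continuous.tendsto' ?_ 0 _ (by simp)).mono_left nhdsWithin_le_nhds
    fun_prop
  refine tendsto_of_forall_eventually_mem_Icc (hlim (-2)) (hlim 2) fun ε hε => ?_
  filter_upwards [hA.subset_sector hT hT3 hε, hA.sector_subset hT hT3 hε, hA.norm_le,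
    eventually_volume_real_sector (b := b) hT hT3 (2 * ε),
    eventually_volume_real_sector (b := b) hT hT3 (-(2 * ε)), self_mem_nhdsWithin]
    with ρ hsub hsup hnorm houter hinner (hρ : 0 < ρ)
  have hle := measureReal_mono (μ := volume) hsub (volume_sector_ne_top hT hT3 _ _)
  have hge := measureReal_mono (μ := volume) hsup
    (volume_ne_top_of_norm_le fun w hw => hnorm w hw.1)
  rw [mem_Icc, le_div_iff₀ hρ, div_le_iff₀ hρ]
  constructor <;> linarith

lemma tendsto_volume_leftHalf_sub_div (hA : IsPerturbedEllipse b T A) (hT : Continuous T)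
    (hT3 : ∀ (r : ℝ) w, T (r • w) = r ^ 3 * T w) :
    Tendsto (fun ρ => (volume.real (A ρ ∩ {w | w.1 ≤ 0})
      - ∫ φ in -(Real.pi / 2)..(Real.pi / 2), 1 / (2 * graphNorm b (circlePoint φ) ^ 2)) / ρ)
      (𝓝[>] 0) (𝓝 (asymmetry b T / 2)) := by
  have hT_neg : ∀ w, T (-w) = -T w := fun w => by
    rw [← neg_one_smul ℝ, hT3]; ring
  have hvol : ∀ ρ, volume.real (-A ρ ∩ {w | 0 < w.1}) = volume.real (A ρ ∩ {w | w.1 ≤ 0}) :=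
    fun ρ => by
    have hneg : -A ρ ∩ {w | 0 < w.1} = -(A ρ ∩ {w | w.1 < 0}) := by
      ext w; simp
    have hline : volume {w : ℝ × ℝ | w.1 = 0} = 0 :=
      Measure.quasiMeasurePreserving_fst.preimage_null (measure_singleton (0 : ℝ))
    rw [hneg, measureReal_def, Measure.measure_neg, measureReal_def]
    refine congrArg _ (measure_congr ?_)
    filter_upwards [compl_mem_ae_iff.2 hline] with w (hw : w.1 ≠ 0)
    exact propext (and_congr_right fun _ => ⟨fun h : w.1 < 0 => h.le,
      fun h : w.1 ≤ 0 => h.lt_of_ne hw⟩)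
  have h := tendsto_volume_rightHalf_sub_div (hA.neg hT_neg) hT.neg fun r w => by
    rw [hT3, mul_neg]
  simpa only [asymmetry_neg, hvol, neg_div, neg_neg] using h

lemma tendsto_half_volume_sub_div (hA : IsPerturbedEllipse b T A) (hT : Continuous T)
    (hT3 : ∀ (r : ℝ) w, T (r • w) = r ^ 3 * T w) :
    Tendsto (fun ρ => (volume.real (A ρ) / 2 - volume.real (A ρ ∩ {w | w.1 ≤ 0})) / ρ) (𝓝[>] 0)
      (𝓝 (-(asymmetry b T / 2))) := by
  have hdiff := ((tendsto_volume_rightHalf_sub_div hA hT hT3).sub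
    (tendsto_volume_leftHalf_sub_div hA hT hT3)).div_const 2
  rw [show (-(asymmetry b T / 2) - asymmetry b T / 2) / 2 = -(asymmetry b T / 2) by ring] at hdiff
  refine hdiff.congr' ?_
  filter_upwards [hA.norm_le] with ρ hnorm
  have hright : A ρ \ {w | w.1 ≤ 0} = A ρ ∩ {w | 0 < w.1} := by
    ext w; simp
  rw [← measureReal_inter_add_sdiff (s := A ρ) (measurableSet_le measurable_fst measurable_const)
    (volume_ne_top_of_norm_le hnorm), hright]
  ring

end HalfArea

section

variable {b : ℝ × ℝ} {T : ℝ × ℝ → ℝ} {A : ℝ → Set (ℝ × ℝ)} {a : ℝ} {U : ℝ → ℝ × ℝ → ℝ}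

lemma volume_real_sliver_le {η ρ : ℝ} (h : 0 ≤ η * ρ) :
    volume.real {w : ℝ × ℝ | ‖w‖ ≤ 2 ∧ |w.1| ≤ η * ρ} ≤ 8 * η * ρ := by
  have hsub : {w : ℝ × ℝ | ‖w‖ ≤ 2 ∧ |w.1| ≤ η * ρ} ⊆ Icc (-(η * ρ)) (η * ρ) ×ˢ Icc (-2) 2 :=
    fun w hw => ⟨abs_le.1 hw.2, abs_le.1 ((norm_snd_le w).trans hw.1)⟩
  refine (measureReal_mono hsub (isCompact_Icc.prod isCompact_Icc).measure_lt_top.ne).trans_eq ?_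
  rw [measureReal_def, Measure.volume_eq_prod, Measure.prod_prod, Real.volume_Icc, Real.volume_Icc,
    ENNReal.toReal_mul, ENNReal.toReal_ofReal (by linarith), ENNReal.toReal_ofReal (by norm_num)]
  ring

lemma IsStraightened.eventually_abs_fst_le_of_sign (hU : IsStraightened a U) (ha : 0 < a) {η : ℝ}
    (hη : 0 < η) :
    ∀ᶠ ρ in 𝓝[>] 0, ∀ w, ‖w‖ ≤ 2 → ¬(U ρ w ≤ 0 ↔ w.1 ≤ 0) → |w.1| ≤ η * ρ := by
  have hε : 0 < a * η / (1 + η) := by positivity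
  filter_upwards [hU.abs_sub_le hε] with ρ hρ w hw hsign
  have hUw := abs_le.1 (hρ w hw)
  have haw : a * |w.1| ≤ a * η / (1 + η) * (|w.1| + ρ) := by
    rcases lt_or_ge 0 w.1 with hpos | hneg
    · have : U ρ w ≤ 0 := by by_contra h; exact hsign (iff_of_false h hpos.not_ge)
      rw [abs_of_pos hpos] at hUw ⊢
      linarith
    · have : 0 < U ρ w := by by_contra! h; exact hsign (iff_of_true h hneg)
      rw [abs_of_nonpos hneg] at hUw ⊢
      linarith
  rw [div_mul_eq_mul_div, le_div_iff₀ (by positivity)] at haw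
  refine le_of_mul_le_mul_left ?_ ha
  linarith

lemma eventually_abs_subArea_zero_sub_le (hA : ∀ᶠ ρ in 𝓝[>] 0, ∀ w ∈ A ρ, ‖w‖ ≤ 2)
    (hU : IsStraightened a U) (ha : 0 < a) {η : ℝ} (hη : 0 < η) :
    ∀ᶠ ρ in 𝓝[>] 0,
      |volume.real (A ρ ∩ {w | w.1 ≤ 0}) - subArea (A ρ) (U ρ) 0| ≤ 8 * η * ρ := by
  filter_upwards [hA, hU.eventually_abs_fst_le_of_sign ha hη, self_mem_nhdsWithin]
    with ρ hnorm hsign (hρ : 0 < ρ)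
  have hsliver := volume_real_sliver_le (mul_pos hη hρ).le
  have hle : ∀ {S S' : Set (ℝ × ℝ)}, S' ⊆ A ρ →
      S ⊆ S' ∪ {w : ℝ × ℝ | ‖w‖ ≤ 2 ∧ |w.1| ≤ η * ρ} →
      volume.real S ≤ volume.real S' + 8 * η * ρ := fun {S S'} hS' hsub => by
    refine (measureReal_mono hsub (volume_ne_top_of_norm_le (R := 2) ?_)).trans
      ((measureReal_union_le _ _).trans (by gcongr))
    exact fun w hw => hw.elim (fun h => hnorm w (hS' h)) And.left
  have h₁ := hle (S := A ρ ∩ {w | w.1 ≤ 0}) (S' := {w | w ∈ A ρ ∧ U ρ w ≤ 0}) (fun w => And.left)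
    fun w hw => by
      by_cases hUw : U ρ w ≤ 0
      · exact .inl ⟨hw.1, hUw⟩
      · exact .inr ⟨hnorm w hw.1, hsign w (hnorm w hw.1) fun h => hUw (h.2 hw.2)⟩
  have h₂ := hle (S := {w | w ∈ A ρ ∧ U ρ w ≤ 0}) (S' := A ρ ∩ {w | w.1 ≤ 0}) (fun w => And.left)
    fun w hw => by
      by_cases hw1 : w.1 ≤ 0
      · exact .inl ⟨hw.1, hw1⟩
      · exact .inr ⟨hnorm w hw.1, hsign w (hnorm w hw.1) fun h => hw1 (h.1 hw.2)⟩
  rw [← subArea] at h₁ h₂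
  exact abs_sub_le_iff.2 ⟨by linarith, by linarith⟩

lemma tendsto_half_volume_sub_subArea_div (hA : IsPerturbedEllipse b T A) (hT : Continuous T)
    (hT3 : ∀ (r : ℝ) w, T (r • w) = r ^ 3 * T w) (hU : IsStraightened a U) (ha : 0 < a) :
    Tendsto (fun ρ => (volume.real (A ρ) / 2 - subArea (A ρ) (U ρ) 0) / ρ) (𝓝[>] 0)
      (𝓝 (-(asymmetry b T / 2))) := by
  have hsmall : Tendsto (fun ρ => (volume.real (A ρ ∩ {w | w.1 ≤ 0}) - subArea (A ρ) (U ρ) 0) / ρ)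
      (𝓝[>] 0) (𝓝 0) := by
    have hlim : ∀ c : ℝ, Tendsto (fun η => c * η) (𝓝[>] 0) (𝓝 0) := fun c =>
      (Continuous.tendsto' (by fun_prop) 0 _ (mul_zero c)).mono_left nhdsWithin_le_nhds
    refine tendsto_of_forall_eventually_mem_Icc (hlim (-8)) (hlim 8) fun η hη => ?_
    filter_upwards [eventually_abs_subArea_zero_sub_le hA.norm_le hU ha hη, self_mem_nhdsWithin]
      with ρ hle (hρ : 0 < ρ)
    rw [mem_Icc, le_div_iff₀ hρ, div_le_iff₀ hρ, neg_mul, neg_mul, ← abs_le]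
    exact hle
  have h := (tendsto_half_volume_sub_div hA hT hT3).add hsmall
  rw [add_zero] at h
  refine h.congr fun ρ => ?_
  rw [← add_div, sub_add_sub_cancel]

end

section Charted

variable {A : ℝ → Set Plane} {u : Plane → ℝ} {x₀ : Plane} {Φ : ℝ → ℝ × ℝ → Plane} {b : ℝ × ℝ}
  {T : ℝ × ℝ → ℝ} {a s : ℝ}

lemma levelArea_eq_subArea {ρ : ℝ} (hρ : 0 < ρ)
    (hΦ : ∀ S, area S = ρ ^ 2 * volume.real (Φ ρ ⁻¹' S)) (t : ℝ) :
    levelArea A u x₀ ρ t = subArea (Φ ρ ⁻¹' A ρ) (fun w => (u (Φ ρ w) - u x₀) / ρ) t := by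
  rw [levelArea, hΦ, mul_div_cancel_left₀ _ (by positivity), subArea]
  congr 1
  ext w
  simp only [mem_preimage, mem_ofPred_eq, div_le_iff₀ hρ, sub_le_iff_le_add', mul_comm t ρ]

lemma rankAsymptotics_of_chart (hΦ : ∀ ρ > 0, ∀ S, area S = ρ ^ 2 * volume.real (Φ ρ ⁻¹' S))
    (hs : s ^ 2 = b.1 ^ 2 + b.2 ^ 2) (ha : 0 < a) (hT : Continuous T)
    (hT3 : ∀ (r : ℝ) w, T (r • w) = r ^ 3 * T w)
    (hA : IsPerturbedEllipse b T fun ρ => Φ ρ ⁻¹' A ρ)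
    (hU : IsStraightened a fun ρ w => (u (Φ ρ w) - u x₀) / ρ) :
    RankAsymptotics A u x₀ (Real.pi / nu s) (a * nu b.2 / nu s)
      (-(3 / 2 * (a * nu b.2 * asymmetry b T))) := by
  have hνs := nu_pos s
  have hνb := nu_pos b.2
  have hpi := Real.pi_pos
  have hlevel : ∀ᶠ ρ in 𝓝[>] 0, ∀ t, subArea (Φ ρ ⁻¹' A ρ) (fun w => (u (Φ ρ w) - u x₀) / ρ) t
      = levelArea A u x₀ ρ t := by
    filter_upwards [self_mem_nhdsWithin] with ρ hρ t
    exact (levelArea_eq_subArea hρ (hΦ ρ hρ) t).symm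
  have harea : ∀ᶠ ρ in 𝓝[>] 0, volume.real (Φ ρ ⁻¹' A ρ) = area (A ρ) / ρ ^ 2 := by
    filter_upwards [self_mem_nhdsWithin] with ρ (hρ : 0 < ρ)
    rw [hΦ ρ hρ, mul_div_cancel_left₀ _ (by positivity)]
  refine ⟨by positivity, by positivity, ?_, ?_, ⟨3 * a, ?_, ?_⟩, fun t => ?_, ?_, ?_⟩
  · filter_upwards [hA.norm_le, hlevel] with ρ hnorm hρ
    exact funext hρ ▸ monotone_subArea hnorm
  · filter_upwards [eventually_continuous_subArea hA.norm_le hU ha, hlevel] with ρ hcont hρ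
    exact funext hρ ▸ hcont
  · have hle : nu b.2 ≤ nu s := Real.sqrt_le_sqrt (by nlinarith [sq_nonneg b.1])
    rw [ge_iff_le, div_le_iff₀ hνs]
    nlinarith
  · filter_upwards [eventually_subArea_extreme ha hA hU, hlevel, harea] with ρ hρ hlevelρ hareaρ
    rwa [hlevelρ, hlevelρ, hareaρ] at hρ
  · rw [div_div_cancel_left' hpi.ne', ← one_div]
    exact (tendsto_subArea hs ha hA hT hU t).congr' (hlevel.mono fun ρ hρ => hρ t)
  · refine (isLittleO_subArea_sub hA hT hU ha).congr' ?_ .rfl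
    filter_upwards [hlevel.prod_inl _] with p hp
    rw [hp, hp]
    field_simp
  · rw [show Real.pi / nu s * -(3 / 2 * (a * nu b.2 * asymmetry b T))
      / (3 * Real.pi * (a * nu b.2 / nu s)) = -(asymmetry b T / 2) by field_simp]
    refine (tendsto_half_volume_sub_subArea_div hA hT hT3 hU ha).congr' ?_
    filter_upwards [hlevel, harea] with ρ hρ hareaρ
    rw [hρ, hareaρ]

end Charted

/-! ### Coordinates straightening a level line -/

/-- The shear `(y, z) ↦ (y - c z ^ 2, z)`. -/
def shear (c : ℝ) : ℝ × ℝ ≃ᵐ ℝ × ℝ where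
  toFun w := (w.1 - c * w.2 ^ 2, w.2)
  invFun w := (w.1 + c * w.2 ^ 2, w.2)
  left_inv w := by simp
  right_inv w := by simp
  measurable_toFun := by simp only [Equiv.coe_fn_mk]; fun_prop
  measurable_invFun := by simp only [Equiv.coe_fn_symm_mk]; fun_prop

lemma shear_apply (c : ℝ) (w : ℝ × ℝ) : shear c w = (w.1 - c * w.2 ^ 2, w.2) := rfl

lemma measurePreserving_shear (c : ℝ) : MeasurePreserving (shear c) := by
  have hskew : MeasurePreserving (fun p : ℝ × ℝ => (p.1, p.2 - c * p.1 ^ 2))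
      (volume.prod volume) (volume.prod volume) :=
    (MeasurePreserving.id volume).skew_product (g := fun z y => y - c * z ^ 2)
      (by unfold Function.uncurry; fun_prop)
      (.of_forall fun z => (measurePreserving_sub_right volume (c * z ^ 2)).map_eq)
  exact (Measure.measurePreserving_swap.comp hskew).comp Measure.measurePreserving_swap

/-- The coordinates with respect to `e` and `rot e` about `x₀`, rescaled by `ρ`, in which the
line `w.1 = 0` becomes a parabola of curvature `-k`. -/
def chart (x₀ e : Plane) (k ρ : ℝ) (w : ℝ × ℝ) : Plane :=
  x₀ + ρ • frame e (shear (ρ * k / 2) w)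

lemma area_eq_volume_preimage_chart (x₀ : Plane) {e : Plane} (he : ‖e‖ = 1) (k : ℝ) {ρ : ℝ}
    (hρ : 0 < ρ) (S : Set Plane) : area S = ρ ^ 2 * volume.real (chart x₀ e k ρ ⁻¹' S) := by
  have hchart : chart x₀ e k ρ ⁻¹' S = shear (ρ * k / 2) ⁻¹'
      (frame e ⁻¹' ((fun x => ρ • x) ⁻¹' ((fun x => x₀ + x) ⁻¹' S))) := rfl
  rw [hchart, measureReal_def, (measurePreserving_shear _).measure_preimage_equiv,
    ← measureReal_def, ← area_eq_volume_preimage_frame he, area, area, measureReal_def,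
    measureReal_def, Measure.addHaar_preimage_smul volume hρ.ne', measure_preimage_add,
    ENNReal.toReal_mul, ENNReal.toReal_ofReal (abs_nonneg _), finrank_euclideanSpace_fin,
    abs_of_pos (by positivity)]
  field_simp

lemma continuous_chart (x₀ e : Plane) (k : ℝ) :
    Continuous fun p : ℝ × ℝ × ℝ => chart x₀ e k p.1 p.2 := by
  simp only [chart, frame, shear_apply]; fun_prop

lemma eventually_forall_norm_le_of_continuous {X Y : Type*} [TopologicalSpace X]
    [TopologicalSpace Y] {g : Y × ℝ × ℝ → X} (hg : Continuous g) {x : X} {y₀ : Y}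
    (hg₀ : ∀ w, g (y₀, w) = x) {s : Set X} (hs : s ∈ 𝓝 x) (R : ℝ) :
    ∀ᶠ y in 𝓝 y₀, ∀ w, ‖w‖ ≤ R → g (y, w) ∈ s := by
  have := (isCompact_closedBall (0 : ℝ × ℝ) R).eventually_forall_of_forall_eventually
    (x₀ := y₀) (P := fun y w => g (y, w) ∈ s)
    fun w _ => hg.continuousAt.eventually_mem (by rwa [hg₀])
  simpa using this

lemma eventually_chart_mem (x₀ e : Plane) (k : ℝ) {s : Set Plane} (hs : s ∈ 𝓝 x₀) :
    ∀ᶠ ρ in 𝓝[>] (0 : ℝ), ∀ w, ‖w‖ ≤ 2 → chart x₀ e k ρ w ∈ s :=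
  (eventually_forall_norm_le_of_continuous (continuous_chart x₀ e k) (by simp [chart])
    hs 2).filter_mono nhdsWithin_le_nhds

lemma norm_chart_sub_sq (x₀ : Plane) {e : Plane} (he : ‖e‖ = 1) (k ρ : ℝ) (w : ℝ × ℝ) :
    ‖chart x₀ e k ρ w - x₀‖ ^ 2 = ρ ^ 2 * ((w.1 - ρ * k / 2 * w.2 ^ 2) ^ 2 + w.2 ^ 2) := by
  rw [chart, add_sub_cancel_left, norm_smul, mul_pow, norm_frame_sq he, shear_apply,
    Real.norm_eq_abs, sq_abs]

lemma chart_eq_self_iff (x₀ : Plane) {e : Plane} (he : ‖e‖ = 1) (k : ℝ) {ρ : ℝ} (hρ : 0 < ρ)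
    {w : ℝ × ℝ} : chart x₀ e k ρ w = x₀ ↔ w = 0 := by
  refine ⟨fun heq => ?_, fun heq => by simp [heq, chart, frame, shear_apply]⟩
  have hzero := norm_chart_sub_sq x₀ he k ρ w
  rw [heq, sub_self, norm_zero, zero_pow two_ne_zero, zero_eq_mul, or_iff_right (by positivity),
    add_eq_zero_iff_of_nonneg (sq_nonneg _) (sq_nonneg _), sq_eq_zero_iff, sq_eq_zero_iff] at hzero
  exact Prod.ext (by simpa [hzero.2] using hzero.1) hzero.2

lemma eventually_norm_chart_sub_le (x₀ : Plane) {e : Plane} (he : ‖e‖ = 1) (k : ℝ) :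
    ∀ᶠ ρ in 𝓝[>] (0 : ℝ), ∀ w, ‖w‖ ≤ 2 → ‖chart x₀ e k ρ w - x₀‖ ≤ 3 * ρ := by
  have hclose : ∀ᶠ ρ in 𝓝 (0 : ℝ), ∀ w : ℝ × ℝ, ‖w‖ ≤ 2 →
      (w.1 - ρ * k / 2 * w.2 ^ 2) ^ 2 - w.1 ^ 2 ∈ Iic 1 :=
    eventually_forall_norm_le_of_continuous
      (g := fun p : ℝ × ℝ × ℝ => (p.2.1 - p.1 * k / 2 * p.2.2 ^ 2) ^ 2 - p.2.1 ^ 2)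
      (by fun_prop) (by simp) (Iic_mem_nhds zero_lt_one) 2
  filter_upwards [self_mem_nhdsWithin, hclose.filter_mono nhdsWithin_le_nhds] with ρ hρ hclose w hw
  have hρ : 0 < ρ := hρ
  refine (sq_le_sq₀ (norm_nonneg _) (by positivity)).1 ?_
  have hw₁ : w.1 ^ 2 ≤ 2 ^ 2 := sq_le_sq.2 (by simpa using (norm_fst_le w).trans hw)
  have hw₂ : w.2 ^ 2 ≤ 2 ^ 2 := sq_le_sq.2 (by simpa using (norm_snd_le w).trans hw)
  rw [norm_chart_sub_sq x₀ he, mul_pow, mul_comm]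
  gcongr
  have := mem_Iic.1 (hclose w hw)
  linarith

/-! ### Amoeba distance and chords of the graph -/

section Taylor

variable {E G : Type*} [NormedAddCommGroup E] [NormedSpace ℝ E] [NormedAddCommGroup G]
  [NormedSpace ℝ G]

lemma isLittleO_norm_pow_succ_of_hasFDerivAt {g : E → G} {g' : E → E →L[ℝ] G} {n : ℕ}
    (hg : ∀ᶠ v in 𝓝 0, HasFDerivAt g (g' v) v) (hg' : g' =o[𝓝 0] fun v => ‖v‖ ^ n)
    (h0 : g 0 = 0) : g =o[𝓝 0] fun v => ‖v‖ ^ (n + 1) := by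
  refine Asymptotics.isLittleO_iff.2 fun c hc => ?_
  obtain ⟨r, hr, hball⟩ := Metric.nhds_basis_closedBall.eventually_iff.1
    (hg.and (Asymptotics.isLittleO_iff.1 hg' hc))
  filter_upwards [Metric.closedBall_mem_nhds (0 : E) hr] with v hv
  have hsub : Metric.closedBall (0 : E) ‖v‖ ⊆ Metric.closedBall 0 r :=
    Metric.closedBall_subset_closedBall (mem_closedBall_zero_iff.1 hv)
  have := (convex_closedBall (0 : E) ‖v‖).norm_image_sub_le_of_norm_hasFDerivWithin_le
    (f := g) (f' := g') (C := c * ‖v‖ ^ n) (x := 0) (y := v)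
    (fun w hw => (hball (hsub hw)).1.hasFDerivWithinAt)
    (fun w hw => (hball (hsub hw)).2.trans (by
      rw [norm_pow, norm_norm]
      have := mem_closedBall_zero_iff.1 hw
      gcongr))
    (by simp) (by simp)
  rwa [h0, sub_zero, sub_zero, mul_assoc, ← pow_succ, ← norm_norm v, ← norm_pow] at this

lemma isLittleO_taylor_two {f : E → G} {x : E} (hf : ContDiffAt ℝ 2 f x) :
    (fun v => f (x + v) - f x - fderiv ℝ f x v - (2⁻¹ : ℝ) • fderiv ℝ (fderiv ℝ f) x v v)
      =o[𝓝 0] fun v => ‖v‖ ^ 2 := by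
  have htranslate : Tendsto (fun v => x + v) (𝓝 0) (𝓝 x) :=
    Continuous.tendsto' (by fun_prop) _ _ (add_zero x)
  have hdiff : ∀ᶠ v in 𝓝 0, HasFDerivAt f (fderiv ℝ f (x + v)) (x + v) :=
    htranslate.eventually ((hf.eventually (by simp)).mono fun y hy =>
      (hy.differentiableAt (by norm_num)).hasFDerivAt)
  have hdiff₂ : HasFDerivAt (fderiv ℝ f) (fderiv ℝ (fderiv ℝ f) x) x :=
    ((hf.fderiv_right (m := 1) (by norm_num)).differentiableAt (by norm_num)).hasFDerivAt
  have hsymm : IsSymmSndFDerivAt ℝ f x := hf.isSymmSndFDerivAt (by simp)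
  refine isLittleO_norm_pow_succ_of_hasFDerivAt (n := 1)
    (g' := fun v => fderiv ℝ f (x + v) - fderiv ℝ f x - fderiv ℝ (fderiv ℝ f) x v)
    (hdiff.mono fun v hv => ?_) ?_ (by simp)
  · have hquad : HasFDerivAt (fun v => (2⁻¹ : ℝ) • fderiv ℝ (fderiv ℝ f) x v v)
        (fderiv ℝ (fderiv ℝ f) x v) v := by
      convert! (((fderiv ℝ (fderiv ℝ f) x).hasFDerivAt (x := v)).clm_apply
        (hasFDerivAt_id v)).const_smul (2⁻¹ : ℝ) using 1
      ext w
      simp [hsymm.eq w v, ← two_smul ℝ]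
    exact ((((hasFDerivAt_comp_add_left x).2 hv).sub_const _).sub
      (fderiv ℝ f x).hasFDerivAt).sub hquad
  · simpa using (hasFDerivAt_iff_isLittleO_nhds_zero.1 hdiff₂).norm_right

end Taylor

/-- Squared length of the chord between the points of the graph of `f` above `p` and `q`. -/
def chordSq (f : Plane → ℝ) (p q : Plane) : ℝ := ‖q - p‖ ^ 2 + (f q - f p) ^ 2

lemma ofReal_sqrt_chordSq_le_curveLength {Ω : Set Plane} {f : Plane → ℝ} (hf : ContDiffOn ℝ 1 f Ω)
    {p q : Plane} {c : ℝ → Plane} (hc : IsRegularCurve Ω p q c) :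
    ENNReal.ofReal √(chordSq f p q) ≤ curveLength f c := by
  set L := (WithLp.prodContinuousLinearEquiv 2 ℝ Plane ℝ).symm
  have hnorm : ∀ w, ‖L w‖ₑ = ENNReal.ofReal √(‖w.1‖ ^ 2 + |w.2| ^ 2) := fun w => by
    rw [← ofReal_norm, WithLp.prod_norm_eq_of_L2]; rfl
  have hfc : ContDiffOn ℝ 1 (f ∘ c) (Icc 0 1) := hf.comp hc.contDiffOn hc.mapsTo
  have hγ : ContDiffOn ℝ 1 (fun t => L (c t, (f ∘ c) t)) (Icc 0 1) :=
    L.contDiff.comp_contDiffOn (hc.contDiffOn.prodMk hfc)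
  have hderiv : ∀ t ∈ Icc (0 : ℝ) 1, derivWithin (fun t => L (c t, (f ∘ c) t)) (Icc 0 1) t =
      L (derivWithin c (Icc 0 1) t, derivWithin (f ∘ c) (Icc 0 1) t) := fun t ht =>
    (L.hasFDerivAt.comp_hasDerivWithinAt t
      ((hc.contDiffOn.differentiableOn one_ne_zero t ht).hasDerivWithinAt.prodMk
        (hfc.differentiableOn one_ne_zero t ht).hasDerivWithinAt)).derivWithin
      (uniqueDiffOn_Icc zero_lt_one t ht)
  have hchord := enorm_sub_le_lintegral_derivWithin_Icc_of_contDiffOn_Icc hγ zero_le_one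
  rw [← map_sub, hnorm] at hchord
  simp only [Function.comp_apply, hc.source, hc.target, Prod.mk_sub_mk, sq_abs] at hchord
  refine hchord.trans_eq (setLIntegral_congr_fun measurableSet_Icc fun t ht => ?_)
  exact (congrArg (‖·‖ₑ) (hderiv t ht)).trans (hnorm _)

lemma chordSq_le_of_mem_amoeba {Ω : Set Plane} {f : Plane → ℝ} (hf : ContDiffOn ℝ 1 f Ω)
    {p q : Plane} {ρ : ℝ} (hρ : 0 ≤ ρ) (hq : q ∈ amoeba Ω f p ρ) : chordSq f p q ≤ ρ ^ 2 := by
  rw [← Real.sqrt_le_left hρ, ← ENNReal.ofReal_le_ofReal_iff hρ]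
  have hdist : ENNReal.ofReal √(chordSq f p q) ≤ amoebaDist Ω f p q :=
    le_iInf₂ fun c hc => ofReal_sqrt_chordSq_le_curveLength hf hc
  exact hdist.trans hq.2

lemma curveLength_le_of_energy_le {f : Plane → ℝ} {c : ℝ → Plane} {ρ : ℝ} (hρ : 0 < ρ)
    (henergy : ∫⁻ t in Icc (0 : ℝ) 1, ENNReal.ofReal (‖derivWithin c (Icc 0 1) t‖ ^ 2 +
      |derivWithin (f ∘ c) (Icc 0 1) t| ^ 2) ≤ ENNReal.ofReal (ρ ^ 2)) :
    curveLength f c ≤ ENNReal.ofReal ρ := by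
  have hAMGM : ∀ e : ℝ, 0 ≤ e → √e ≤ (2 * ρ)⁻¹ * e + ρ / 2 := fun e he => by
    refine Real.sqrt_le_iff.2 ⟨by positivity, ?_⟩
    have : ((2 * ρ)⁻¹ * e + ρ / 2) ^ 2 = e + ((2 * ρ)⁻¹ * e - ρ / 2) ^ 2 := by field_simp; ring
    linarith [sq_nonneg ((2 * ρ)⁻¹ * e - ρ / 2)]
  set e : ℝ → ℝ := fun t =>
    ‖derivWithin c (Icc 0 1) t‖ ^ 2 + |derivWithin (f ∘ c) (Icc 0 1) t| ^ 2
  calc curveLength f c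
      ≤ ∫⁻ t in Icc (0 : ℝ) 1,
          (ENNReal.ofReal (2 * ρ)⁻¹ * ENNReal.ofReal (e t) + ENNReal.ofReal (ρ / 2)) :=
        lintegral_mono fun t => by
          have he : 0 ≤ e t := by positivity
          rw [← ENNReal.ofReal_mul (by positivity),
            ← ENNReal.ofReal_add (by positivity) (by positivity)]
          exact ENNReal.ofReal_le_ofReal (hAMGM _ he)
    _ = ENNReal.ofReal (2 * ρ)⁻¹ * (∫⁻ t in Icc (0 : ℝ) 1, ENNReal.ofReal (e t)) +
          ENNReal.ofReal (ρ / 2) := by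
        rw [lintegral_add_right _ measurable_const, lintegral_const_mul' _ _ ENNReal.ofReal_ne_top]
        simp
    _ ≤ ENNReal.ofReal (2 * ρ)⁻¹ * ENNReal.ofReal (ρ ^ 2) + ENNReal.ofReal (ρ / 2) := by gcongr
    _ = ENNReal.ofReal ρ := by
        rw [← ENNReal.ofReal_mul (by positivity),
          ← ENNReal.ofReal_add (by positivity) (by positivity)]
        congr 1
        field_simp
        norm_num

lemma integral_deriv_sq_le {h h' : ℝ → ℝ} {δ : ℝ} (hcont : ContinuousOn h' (Icc 0 1))
    (hderiv : ∀ t ∈ Icc (0 : ℝ) 1, HasDerivAt h (h' t) t)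
    (hosc : ∀ s ∈ Icc (0 : ℝ) 1, ∀ t ∈ Icc (0 : ℝ) 1, |h' t - h' s| ≤ δ) :
    ∫ t in (0 : ℝ)..1, h' t ^ 2 ≤ (h 1 - h 0) ^ 2 + δ ^ 2 := by
  set H := h 1 - h 0 with hH
  have hint : IntervalIntegrable h' volume 0 1 :=
    ContinuousOn.intervalIntegrable (by rwa [uIcc_of_le zero_le_one])
  have hint₂ : IntervalIntegrable (fun t => h' t ^ 2) volume 0 1 :=
    ContinuousOn.intervalIntegrable (by rw [uIcc_of_le zero_le_one]; exact hcont.pow 2)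
  have hmean : ∫ t in (0 : ℝ)..1, h' t = H :=
    intervalIntegral.integral_eq_sub_of_hasDerivAt
      (fun t ht => hderiv t (by rwa [uIcc_of_le zero_le_one] at ht)) hint
  obtain ⟨s, hs, hslope⟩ := exists_hasDerivAt_eq_slope h h' zero_lt_one
    (fun t ht => (hderiv t ht).continuousAt.continuousWithinAt)
    fun t ht => hderiv t (Ioo_subset_Icc_self ht)
  rw [sub_zero, div_one, ← hH] at hslope
  have hbound : ∀ t ∈ Icc (0 : ℝ) 1, h' t ^ 2 ≤ 2 * H * h' t + (δ ^ 2 - H ^ 2) := fun t ht => by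
    have := sq_le_sq' (abs_le.1 (hosc s (Ioo_subset_Icc_self hs) t ht)).1
      (abs_le.1 (hosc s (Ioo_subset_Icc_self hs) t ht)).2
    rw [hslope] at this
    linarith
  calc ∫ t in (0 : ℝ)..1, h' t ^ 2
      ≤ ∫ t in (0 : ℝ)..1, (2 * H * h' t + (δ ^ 2 - H ^ 2)) :=
        intervalIntegral.integral_mono_on zero_le_one hint₂
          ((hint.const_mul _).add intervalIntegrable_const) hbound
    _ = H ^ 2 + δ ^ 2 := by
        rw [intervalIntegral.integral_add (hint.const_mul _) intervalIntegrable_const,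
          intervalIntegral.integral_const_mul, hmean, intervalIntegral.integral_const,
          sub_zero, one_smul]
        ring

lemma isRegularCurve_lineMap {Ω : Set Plane} {p q : Plane} (hpq : p ≠ q)
    (hΩ : ∀ t ∈ Icc (0 : ℝ) 1, AffineMap.lineMap p q t ∈ Ω) :
    IsRegularCurve Ω p q ⇑(AffineMap.lineMap p q : ℝ →ᵃ[ℝ] Plane) where
  contDiffOn := (ContinuousAffineMap.lineMap (R := ℝ) p q).contDiff.contDiffOn
  regular t ht := by
    rw [AffineMap.hasDerivWithinAt_lineMap.derivWithin (uniqueDiffOn_Icc zero_lt_one t ht)]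
    exact sub_ne_zero.2 hpq.symm
  mapsTo := hΩ
  source := AffineMap.lineMap_apply_zero p q
  target := AffineMap.lineMap_apply_one p q

lemma abs_fderiv_lineMap_sub_le {f : Plane → ℝ} {S : Set Plane} {K : NNReal} (hS : Convex ℝ S)
    (hLip : LipschitzOnWith K (fderiv ℝ f) S) {p q : Plane} (hp : p ∈ S) (hq : q ∈ S) {s t : ℝ}
    (hs : s ∈ Icc (0 : ℝ) 1) (ht : t ∈ Icc (0 : ℝ) 1) :
    |fderiv ℝ f (AffineMap.lineMap p q t) (q - p) - fderiv ℝ f (AffineMap.lineMap p q s) (q - p)|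
      ≤ K * ‖q - p‖ ^ 2 := by
  have hst : dist t s ≤ 1 := Real.dist_le_of_mem_Icc_01 ht hs
  rw [← sub_apply, ← Real.norm_eq_abs, sq, ← mul_assoc]
  refine ContinuousLinearMap.le_of_opNorm_le _
    ((hLip.norm_sub_le (hS.lineMap_mem hp hq ht) (hS.lineMap_mem hp hq hs)).trans ?_) _
  rw [← dist_eq_norm, dist_lineMap_lineMap, dist_comm p, dist_eq_norm q]
  gcongr
  exact mul_le_of_le_one_left (norm_nonneg _) hst

lemma curveLength_lineMap_le {f : Plane → ℝ} {S : Set Plane} {K : NNReal} (hS : Convex ℝ S)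
    (hf : ∀ x ∈ S, DifferentiableAt ℝ f x) (hLip : LipschitzOnWith K (fderiv ℝ f) S)
    {p q : Plane} (hp : p ∈ S) (hq : q ∈ S) {ρ : ℝ} (hρ : 0 < ρ)
    (hle : chordSq f p q + K ^ 2 * ‖q - p‖ ^ 4 ≤ ρ ^ 2) :
    curveLength f ⇑(AffineMap.lineMap p q : ℝ →ᵃ[ℝ] Plane) ≤ ENNReal.ofReal ρ := by
  set c : ℝ → Plane := ⇑(AffineMap.lineMap p q : ℝ →ᵃ[ℝ] Plane) with hc
  have hunique := uniqueDiffOn_Icc (zero_lt_one (α := ℝ))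
  have hmem : ∀ t ∈ Icc (0 : ℝ) 1, c t ∈ S := fun t ht => hS.lineMap_mem hp hq ht
  have hcd : ∀ t, HasDerivAt c (q - p) t := fun t => AffineMap.hasDerivAt_lineMap
  have hfd : ∀ t ∈ Icc (0 : ℝ) 1, HasDerivAt (f ∘ c) (fderiv ℝ f (c t) (q - p)) t :=
    fun t ht => (hf _ (hmem t ht)).hasFDerivAt.comp_hasDerivAt t (hcd t)
  have hcont : ContinuousOn (fun t => fderiv ℝ f (c t) (q - p)) (Icc 0 1) :=
    (hLip.continuousOn.comp (fun t _ => (hcd t).continuousAt.continuousWithinAt) hmem).clm_apply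
      continuousOn_const
  refine curveLength_le_of_energy_le hρ ?_
  calc ∫⁻ t in Icc (0 : ℝ) 1, ENNReal.ofReal (‖derivWithin c (Icc 0 1) t‖ ^ 2 +
        |derivWithin (f ∘ c) (Icc 0 1) t| ^ 2)
      = ∫⁻ t in Icc (0 : ℝ) 1, ENNReal.ofReal (‖q - p‖ ^ 2 + fderiv ℝ f (c t) (q - p) ^ 2) :=
        setLIntegral_congr_fun measurableSet_Icc fun t ht => by
          simp only [(hcd t).hasDerivWithinAt.derivWithin (hunique t ht),
            (hfd t ht).hasDerivWithinAt.derivWithin (hunique t ht), sq_abs]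
    _ = ENNReal.ofReal (∫ t in Icc (0 : ℝ) 1, (‖q - p‖ ^ 2 + fderiv ℝ f (c t) (q - p) ^ 2)) :=
        (ofReal_integral_eq_lintegral_ofReal
          ((continuousOn_const.add (hcont.pow 2)).integrableOn_compact isCompact_Icc)
          (.of_forall fun t => add_nonneg (sq_nonneg _) (sq_nonneg _))).symm
    _ ≤ ENNReal.ofReal (ρ ^ 2) := by
        refine ENNReal.ofReal_le_ofReal (le_trans ?_ hle)
        have hvar := integral_deriv_sq_le hcont hfd fun s hs t ht =>
          abs_fderiv_lineMap_sub_le hS hLip hp hq hs ht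
        have hint : IntegrableOn (fun t => fderiv ℝ f (c t) (q - p) ^ 2) (Icc 0 1) :=
          (hcont.pow 2).integrableOn_compact isCompact_Icc
        rw [intervalIntegral.integral_of_le zero_le_one, ← integral_Icc_eq_integral_Ioc] at hvar
        rw [integral_add (by simp) hint, chordSq]
        simp only [hc, Function.comp_apply, AffineMap.lineMap_apply_one,
          AffineMap.lineMap_apply_zero, integral_const, measureReal_restrict_apply .univ,
          univ_inter, Real.volume_real_Icc, sub_zero, zero_le_one, sup_of_le_left, one_smul]
          at hvar ⊢
        linarith

lemma exists_mem_amoeba_of_chordSq_add_le {Ω : Set Plane} {f : Plane → ℝ} {x₀ : Plane}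
    (hx₀ : Ω ∈ 𝓝 x₀) (hf : ContDiffAt ℝ 2 f x₀) :
    ∃ K ≥ (0 : ℝ), ∀ᶠ x in 𝓝 x₀, x ≠ x₀ → ∀ ρ > 0,
      chordSq f x₀ x + K * ‖x - x₀‖ ^ 4 ≤ ρ ^ 2 → x ∈ amoeba Ω f x₀ ρ := by
  obtain ⟨K, S, hS, hLip⟩ :=
    (hf.fderiv_right (m := 1) (by norm_num)).exists_lipschitzOnWith
  have hnear : ∀ᶠ x in 𝓝 x₀, ContDiffAt ℝ 2 f x ∧ x ∈ Ω ∧ x ∈ S :=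
    (hf.eventually (by simp)).and (inter_mem hx₀ hS)
  obtain ⟨r, hr, hball⟩ := Metric.nhds_basis_ball.eventually_iff.1 hnear
  refine ⟨K ^ 2, by positivity, ?_⟩
  filter_upwards [Metric.ball_mem_nhds x₀ hr] with x hx hne ρ hρ hle
  have hreg : IsRegularCurve Ω x₀ x ⇑(AffineMap.lineMap x₀ x : ℝ →ᵃ[ℝ] Plane) :=
    isRegularCurve_lineMap hne.symm fun t ht =>
      (hball ((convex_ball x₀ r).lineMap_mem (Metric.mem_ball_self hr) hx ht)).2.1
  exact ⟨(hball hx).2.1, (iInf₂_le _ hreg).trans <|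
    curveLength_lineMap_le (convex_ball x₀ r)
      (fun y hy => (hball hy).1.differentiableAt two_ne_zero)
      (hLip.mono fun y hy => (hball hy).2.2) (Metric.mem_ball_self hr) hx hρ hle⟩

/-! ### The amoeba as a perturbed ellipse -/

/-- The components of the gradient of `h` at `x` with respect to `e` and `rot e`. -/
def frameSlope (h : Plane → ℝ) (x e : Plane) : ℝ × ℝ := (fderiv ℝ h x e, fderiv ℝ h x (rot e))

lemma fderiv_frame (h : Plane → ℝ) (x e : Plane) (w : ℝ × ℝ) :
    fderiv ℝ h x (frame e w) = (frameSlope h x e).1 * w.1 + (frameSlope h x e).2 * w.2 := by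
  simp only [frame, frameSlope, map_add, map_smul, smul_eq_mul]; ring

lemma continuous_d2_diag (h : Plane → ℝ) (x : Plane) : Continuous fun v => d2 h x v v := by
  unfold d2; fun_prop

lemma d2_smul_smul (h : Plane → ℝ) (x v : Plane) (r : ℝ) :
    d2 h x (r • v) (r • v) = r ^ 2 * d2 h x v v := by
  simp only [d2, map_smul, smul_apply, smul_eq_mul]; ring

/-- The second order part of `h` in the coordinates `chart x e k`. -/
def chartQuad (h : Plane → ℝ) (x e : Plane) (k : ℝ) (w : ℝ × ℝ) : ℝ :=
  (d2 h x (frame e w) (frame e w) - k * w.2 ^ 2 * fderiv ℝ h x e) / 2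

lemma continuous_chartQuad (h : Plane → ℝ) (x e : Plane) (k : ℝ) :
    Continuous (chartQuad h x e k) := by
  have := (continuous_d2_diag h x).comp (continuous_frame e)
  simp only [Function.comp_def] at this
  unfold chartQuad; fun_prop

lemma eventually_abs_chart_sub_le {h : Plane → ℝ} {x e : Plane} (hh : ContDiffAt ℝ 2 h x)
    (he : ‖e‖ = 1) (k : ℝ) {ε : ℝ} (hε : 0 < ε) :
    ∀ᶠ ρ in 𝓝[>] (0 : ℝ), ∀ w, ‖w‖ ≤ 2 →
      |(h (chart x e k ρ w) - h x) / ρ - (fderiv ℝ h x (frame e w) + ρ * chartQuad h x e k w)|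
        ≤ ε * ρ := by
  have htaylor : ∀ᶠ y in 𝓝 x, |h y - h x - fderiv ℝ h x (y - x) - 2⁻¹ * d2 h x (y - x) (y - x)|
      ≤ ε / 18 * ‖y - x‖ ^ 2 := by
    have := (Asymptotics.isLittleO_iff.1 (isLittleO_taylor_two hh) (by positivity : 0 < ε / 18))
    have hsub : Tendsto (fun y => y - x) (𝓝 x) (𝓝 0) :=
      Continuous.tendsto' (by fun_prop) _ _ (sub_self x)
    simpa [d2] using hsub.eventually this
  have hquad : ∀ᶠ ρ in 𝓝 (0 : ℝ), ∀ w : ℝ × ℝ, ‖w‖ ≤ 2 →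
      d2 h x (frame e (shear (ρ * k / 2) w)) (frame e (shear (ρ * k / 2) w)) -
        d2 h x (frame e w) (frame e w) ∈ Icc (-ε) ε :=
    eventually_forall_norm_le_of_continuous
      (g := fun p : ℝ × ℝ × ℝ => d2 h x (frame e (shear (p.1 * k / 2) p.2))
        (frame e (shear (p.1 * k / 2) p.2)) - d2 h x (frame e p.2) (frame e p.2))
      (by simp only [d2, frame, shear_apply]; fun_prop) (x := 0) (by simp [shear_apply])
      (Icc_mem_nhds (by linarith) hε) 2
  filter_upwards [self_mem_nhdsWithin, hquad.filter_mono nhdsWithin_le_nhds,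
    eventually_chart_mem x e k htaylor, eventually_norm_chart_sub_le x he k]
    with ρ hρ hquad htaylor hnorm w hw
  have hρ : 0 < ρ := hρ
  set y := frame e (shear (ρ * k / 2) w) with hy
  have hyx : chart x e k ρ w - x = ρ • y := add_sub_cancel_left _ _
  have hlin : fderiv ℝ h x y =
      fderiv ℝ h x (frame e w) - ρ * (k * w.2 ^ 2 * fderiv ℝ h x e) / 2 := by
    simp only [hy, fderiv_frame, shear_apply, frameSlope]; ring
  have hball := pow_le_pow_left₀ (norm_nonneg _) (hnorm w hw) 2
  have ht := (htaylor w hw).trans (mul_le_mul_of_nonneg_left hball (by positivity))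
  rw [hyx, map_smul, d2_smul_smul, smul_eq_mul, hlin] at ht
  have hq : |ρ ^ 2 / 2 * (d2 h x y y - d2 h x (frame e w) (frame e w))| ≤ ρ ^ 2 / 2 * ε := by
    rw [abs_mul, abs_of_pos (by positivity : 0 < ρ ^ 2 / 2)]
    gcongr
    exact abs_le.2 (hquad w hw)
  refine le_of_mul_le_mul_left ?_ hρ
  rw [← abs_of_pos hρ, ← abs_mul, abs_of_pos hρ, mul_sub, mul_div_cancel₀ _ hρ.ne', chartQuad]
  refine (le_of_eq (congrArg _ ?_)).trans <|
    ((abs_add_le _ _).trans (add_le_add ht hq)).trans (le_of_eq ?_) <;> ring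

/-- The third order part of the squared chord length of the graph of `h` in the coordinates
`chart x e k`. -/
def chartCubic (h : Plane → ℝ) (x e : Plane) (k : ℝ) (w : ℝ × ℝ) : ℝ :=
  2 * fderiv ℝ h x (frame e w) * chartQuad h x e k w - k * w.2 ^ 2 * w.1

lemma continuous_chartCubic (h : Plane → ℝ) (x e : Plane) (k : ℝ) :
    Continuous (chartCubic h x e k) := by
  have hQ := continuous_chartQuad h x e k
  have hD := (fderiv ℝ h x).continuous.comp (continuous_frame e)
  unfold chartCubic; fun_prop

lemma chartCubic_smul (h : Plane → ℝ) (x e : Plane) (k r : ℝ) (w : ℝ × ℝ) :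
    chartCubic h x e k (r • w) = r ^ 3 * chartCubic h x e k w := by
  have hframe : frame e (r • w) = r • frame e w := by
    simp only [frame, Prod.smul_fst, Prod.smul_snd, smul_assoc, smul_add]
  simp only [chartCubic, chartQuad, hframe, map_smul, d2_smul_smul, Prod.smul_fst, Prod.smul_snd,
    smul_eq_mul]
  ring

section Chord

variable {f : Plane → ℝ} {x₀ e : Plane}

lemma chordSq_chart_div_sq (f : Plane → ℝ) (x₀ : Plane) (he : ‖e‖ = 1) (k : ℝ) {ρ δ : ℝ}
    (hρ : 0 < ρ) {w : ℝ × ℝ}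
    (hδ : (f (chart x₀ e k ρ w) - f x₀) / ρ =
      fderiv ℝ f x₀ (frame e w) + ρ * (chartQuad f x₀ e k w + δ)) :
    chordSq f x₀ (chart x₀ e k ρ w) / ρ ^ 2 =
      graphNormSq (frameSlope f x₀ e) w + ρ * chartCubic f x₀ e k w +
        ρ * (ρ * (k * w.2 ^ 2) ^ 2 / 4 + ρ * (chartQuad f x₀ e k w + δ) ^ 2 +
          2 * δ * fderiv ℝ f x₀ (frame e w)) := by
  rw [chordSq, norm_chart_sub_sq x₀ he, add_div, ← div_pow, hδ, mul_div_cancel_left₀ _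
    (by positivity), graphNormSq, ← fderiv_frame, chartCubic]
  ring

lemma eventually_abs_chordSq_chart_sub_le (hf : ContDiffAt ℝ 2 f x₀) (he : ‖e‖ = 1) (k : ℝ)
    {ε : ℝ} (hε : 0 < ε) :
    ∀ᶠ ρ in 𝓝[>] (0 : ℝ), ∀ w, ‖w‖ ≤ 2 →
      |chordSq f x₀ (chart x₀ e k ρ w) / ρ ^ 2 -
        (graphNormSq (frameSlope f x₀ e) w + ρ * chartCubic f x₀ e k w)| ≤ ε * ρ := by
  have hcont : Continuous fun p : (ℝ × ℝ) × ℝ × ℝ => p.1.1 * (k * p.2.2 ^ 2) ^ 2 / 4 +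
      p.1.1 * (chartQuad f x₀ e k p.2 + p.1.2) ^ 2 + 2 * p.1.2 * fderiv ℝ f x₀ (frame e p.2) := by
    have hQ := continuous_chartQuad f x₀ e k
    simp only [fderiv_frame]
    fun_prop
  have hsmall := eventually_forall_norm_le_of_continuous hcont (x := 0) (y₀ := 0)
    (fun w => by simp) (Icc_mem_nhds (by linarith : -ε < 0) hε) 2
  rw [Prod.zero_eq_mk, nhds_prod_eq] at hsmall
  obtain ⟨P, hP, Q, hQ, hsmall⟩ := eventually_prod_iff.1 hsmall
  obtain ⟨δ₀, hδ₀, hQ⟩ := Metric.eventually_nhds_iff.1 hQ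
  filter_upwards [self_mem_nhdsWithin, hP.filter_mono nhdsWithin_le_nhds,
    eventually_abs_chart_sub_le hf he k (half_pos hδ₀)] with ρ hρ hP hexp w hw
  have hρ : 0 < ρ := hρ
  set δ := ((f (chart x₀ e k ρ w) - f x₀) / ρ - (fderiv ℝ f x₀ (frame e w) +
    ρ * chartQuad f x₀ e k w)) / ρ with hδ
  have hδ' : |δ| < δ₀ := by
    rw [hδ, abs_div, abs_of_pos hρ, div_lt_iff₀ hρ]
    nlinarith [hexp w hw]
  have herr := abs_le.2 (hsmall hP (hQ (by simpa using hδ')) w hw)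
  rw [chordSq_chart_div_sq f x₀ he k hρ (δ := δ) (by rw [hδ]; field_simp; ring),
    add_sub_cancel_left, abs_mul, abs_of_pos hρ, mul_comm]
  gcongr

lemma eventually_norm_le_of_chart_mem_amoeba {Ω : Set Plane} (hf : ContDiffOn ℝ 1 f Ω)
    (he : ‖e‖ = 1) (k : ℝ) :
    ∀ᶠ ρ in 𝓝[>] (0 : ℝ), ∀ w, chart x₀ e k ρ w ∈ amoeba Ω f x₀ ρ → ‖w‖ ≤ 2 := by
  filter_upwards [self_mem_nhdsWithin, eventually_nhdsGT_mul_le (|k| / 2) one_pos]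
    with ρ hρ hρk w hw
  have hρ : 0 < ρ := hρ
  have hball := le_trans (le_add_of_nonneg_right (sq_nonneg _))
    (chordSq_le_of_mem_amoeba hf hρ.le hw)
  rw [norm_chart_sub_sq x₀ he, mul_le_iff_le_one_right (by positivity)] at hball
  have hw₂ : w.2 ^ 2 ≤ 1 := by nlinarith [sq_nonneg (w.1 - ρ * k / 2 * w.2 ^ 2)]
  have hw₁ : |w.1 - ρ * k / 2 * w.2 ^ 2| ≤ 1 :=
    (sq_le_one_iff_abs_le_one _).1 (by nlinarith [sq_nonneg w.2])
  have hbend : |ρ * k / 2 * w.2 ^ 2| ≤ 1 := by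
    rw [abs_mul, abs_sq, mul_div_assoc, abs_mul, abs_of_pos hρ, abs_div, abs_two]
    exact mul_le_one₀ hρk (sq_nonneg _) hw₂
  refine norm_prod_le_iff.2 ⟨?_, ((sq_le_one_iff_abs_le_one _).1 hw₂).trans one_le_two⟩
  rw [Real.norm_eq_abs]
  linarith [abs_sub_abs_le_abs_sub w.1 (ρ * k / 2 * w.2 ^ 2)]

lemma eventually_chart_mem_amoeba {Ω : Set Plane} (hx₀ : Ω ∈ 𝓝 x₀) (hf : ContDiffAt ℝ 2 f x₀)
    (he : ‖e‖ = 1) (k : ℝ) {ε : ℝ} (hε : 0 < ε) :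
    ∀ᶠ ρ in 𝓝[>] (0 : ℝ), ∀ w, ‖w‖ ≤ 2 → w ≠ 0 →
      graphNormSq (frameSlope f x₀ e) w + ρ * chartCubic f x₀ e k w ≤ 1 - ε * ρ →
      chart x₀ e k ρ w ∈ amoeba Ω f x₀ ρ := by
  obtain ⟨K, hK, hmem⟩ := exists_mem_amoeba_of_chordSq_add_le hx₀ hf
  filter_upwards [self_mem_nhdsWithin, eventually_chart_mem x₀ e k hmem,
    eventually_norm_chart_sub_le x₀ he k,
    eventually_abs_chordSq_chart_sub_le hf he k (half_pos hε),
    eventually_nhdsGT_mul_le (K * 81) (half_pos hε)] with ρ hρ hmem hball hchord hρK w hw hw₀ hlt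
  have hρ : 0 < ρ := hρ
  have herror : K * ‖chart x₀ e k ρ w - x₀‖ ^ 4 ≤ ρ ^ 2 * (ε / 2 * ρ) :=
    calc K * ‖chart x₀ e k ρ w - x₀‖ ^ 4 ≤ K * (3 * ρ) ^ 4 := by gcongr; exact hball w hw
      _ = ρ ^ 3 * (ρ * (K * 81)) := by ring
      _ ≤ ρ ^ 3 * (ε / 2) := by gcongr
      _ = ρ ^ 2 * (ε / 2 * ρ) := by ring
  refine hmem w hw ((chart_eq_self_iff x₀ he k hρ).not.2 hw₀) ρ hρ ?_
  have hle : chordSq f x₀ (chart x₀ e k ρ w) / ρ ^ 2 ≤ 1 - ε / 2 * ρ := by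
    linarith [le_of_abs_le (hchord w hw)]
  rw [div_le_iff₀ (by positivity)] at hle
  linarith

lemma isPerturbedEllipse_chart_preimage_amoeba {Ω : Set Plane} (hf : ContDiffOn ℝ 1 f Ω)
    (hx₀ : Ω ∈ 𝓝 x₀) (hf₂ : ContDiffAt ℝ 2 f x₀) (he : ‖e‖ = 1) (k : ℝ) :
    IsPerturbedEllipse (frameSlope f x₀ e) (chartCubic f x₀ e k)
      fun ρ => chart x₀ e k ρ ⁻¹' amoeba Ω f x₀ ρ where
  norm_le := eventually_norm_le_of_chart_mem_amoeba hf he k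
  graphNormSq_add_le ε hε := by
    filter_upwards [self_mem_nhdsWithin, eventually_norm_le_of_chart_mem_amoeba hf he k,
      eventually_abs_chordSq_chart_sub_le hf₂ he k hε] with ρ hρ hnorm hchord w hw
    have hρ : 0 < ρ := hρ
    have hle : chordSq f x₀ (chart x₀ e k ρ w) / ρ ^ 2 ≤ 1 :=
      div_le_one_of_le₀ (chordSq_le_of_mem_amoeba hf hρ.le hw) (sq_nonneg ρ)
    linarith [neg_le_of_abs_le (hchord w (hnorm w hw))]
  mem _ hε := eventually_chart_mem_amoeba hx₀ hf₂ he k hε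

end Chord

section Straightened

variable {u : Plane → ℝ} {x₀ e : Plane} {a k : ℝ}

lemma eventually_continuousOn_comp_chart (hu : ContDiffAt ℝ 1 u x₀) (e : Plane) (k : ℝ) :
    ∀ᶠ ρ in 𝓝[>] (0 : ℝ), ContinuousOn (fun w => (u (chart x₀ e k ρ w) - u x₀) / ρ)
      {w | ‖w‖ ≤ 2} := by
  filter_upwards [eventually_chart_mem x₀ e k (hu.eventually (by simp))] with ρ hu w hw
  have hchart : Continuous (chart x₀ e k ρ) :=
    (continuous_chart x₀ e k).comp (continuous_const.prodMk continuous_id)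
  have hcomp : ContinuousAt (fun w => u (chart x₀ e k ρ w)) w :=
    (hu w hw).continuousAt.comp hchart.continuousAt
  exact ((hcomp.sub continuousAt_const).div_const ρ).continuousWithinAt

lemma eventually_abs_sub_sub_le_comp_chart (hu : ContDiffAt ℝ 1 u x₀) (he : ‖e‖ = 1) (k : ℝ)
    {ε : ℝ} (hε : 0 < ε) :
    ∀ᶠ ρ in 𝓝[>] (0 : ℝ), ∀ y₁ y₂ z : ℝ, ‖(y₁, z)‖ ≤ 2 → ‖(y₂, z)‖ ≤ 2 →
      |(u (chart x₀ e k ρ (y₂, z)) - u x₀) / ρ - (u (chart x₀ e k ρ (y₁, z)) - u x₀) / ρ -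
        fderiv ℝ u x₀ e * (y₂ - y₁)| ≤ ε * |y₂ - y₁| := by
  have hstrict := Asymptotics.isLittleO_iff.1 (hu.hasStrictFDerivAt one_ne_zero).isLittleO hε
  rw [nhds_prod_eq, eventually_prod_self_iff'] at hstrict
  obtain ⟨S, hS, hstrict⟩ := hstrict
  filter_upwards [self_mem_nhdsWithin, eventually_chart_mem x₀ e k hS] with ρ hρ hmem y₁ y₂ z h₁ h₂
  have hρ : 0 < ρ := hρ
  have hdiff : chart x₀ e k ρ (y₂, z) - chart x₀ e k ρ (y₁, z) = (ρ * (y₂ - y₁)) • e := by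
    simp only [chart, frame, shear_apply]
    module
  have hincr := hstrict _ (hmem _ h₂) _ (hmem _ h₁)
  simp only [hdiff, map_smul, smul_eq_mul, norm_smul, he, Real.norm_eq_abs, abs_mul,
    abs_of_pos hρ, mul_one] at hincr
  refine le_of_mul_le_mul_left (le_trans (le_of_eq ?_) (hincr.trans_eq (mul_left_comm _ _ _))) hρ
  nth_rewrite 1 [← abs_of_pos hρ]
  rw [← abs_mul]
  congr 1
  field_simp
  ring

lemma eventually_abs_base_le_comp_chart (hu : ContDiffAt ℝ 2 u x₀) (he : ‖e‖ = 1)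
    (hrot : fderiv ℝ u x₀ (rot e) = 0) (hk : k * fderiv ℝ u x₀ e = d2 u x₀ (rot e) (rot e))
    {ε : ℝ} (hε : 0 < ε) :
    ∀ᶠ ρ in 𝓝[>] (0 : ℝ), ∀ z : ℝ, |z| ≤ 2 →
      |(u (chart x₀ e k ρ (0, z)) - u x₀) / ρ| ≤ ε * ρ := by
  filter_upwards [eventually_abs_chart_sub_le hu he k hε] with ρ hexp z hz
  have hquad : chartQuad u x₀ e k (0, z) = 0 := by
    simp only [chartQuad, frame, zero_smul, zero_add, d2_smul_smul, ← hk]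
    ring
  have hlin : fderiv ℝ u x₀ (frame e (0, z)) = 0 := by
    rw [fderiv_frame, frameSlope, hrot]; ring
  simpa [hquad, hlin] using hexp (0, z) (norm_prod_le_iff.2 ⟨by simp, hz⟩)

lemma isStraightened_comp_chart (hu : ContDiffAt ℝ 2 u x₀) (he : ‖e‖ = 1)
    (hrot : fderiv ℝ u x₀ (rot e) = 0) (hk : k * fderiv ℝ u x₀ e = d2 u x₀ (rot e) (rot e)) :
    IsStraightened (fderiv ℝ u x₀ e) fun ρ w => (u (chart x₀ e k ρ w) - u x₀) / ρ where
  continuousOn := eventually_continuousOn_comp_chart (hu.of_le one_le_two) e k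
  abs_sub_sub_le _ hε := eventually_abs_sub_sub_le_comp_chart (hu.of_le one_le_two) he k hε
  abs_base_le _ hε := eventually_abs_base_le_comp_chart hu he hrot hk hε

end Straightened

theorem rankAsymptotics_amoeba {Ω : Set Plane} {f u : Plane → ℝ} {x₀ e : Plane}
    (hx₀ : Ω ∈ 𝓝 x₀) (hf : ContDiffOn ℝ 1 f Ω) (hf₂ : ContDiffAt ℝ 2 f x₀)
    (hu : ContDiffAt ℝ 2 u x₀) (he : ‖e‖ = 1) (ha : 0 < fderiv ℝ u x₀ e)
    (hrot : fderiv ℝ u x₀ (rot e) = 0) {k s : ℝ}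
    (hk : k * fderiv ℝ u x₀ e = d2 u x₀ (rot e) (rot e))
    (hs : s ^ 2 = (frameSlope f x₀ e).1 ^ 2 + (frameSlope f x₀ e).2 ^ 2) :
    RankAsymptotics (amoeba Ω f x₀) u x₀ (Real.pi / nu s)
      (fderiv ℝ u x₀ e * nu (frameSlope f x₀ e).2 / nu s)
      (-(3 / 2 * (fderiv ℝ u x₀ e * nu (frameSlope f x₀ e).2 *
        asymmetry (frameSlope f x₀ e) (chartCubic f x₀ e k)))) :=
  rankAsymptotics_of_chart (fun _ hρ => area_eq_volume_preimage_chart x₀ he k hρ) hs ha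
    (continuous_chartCubic f x₀ e k) (chartCubic_smul f x₀ e k)
    (isPerturbedEllipse_chart_preimage_amoeba hf hx₀ hf₂ he k)
    (isStraightened_comp_chart hu he hrot hk)

/-! ### The right-hand side of the contour equation -/

section CurvatureIntegral

variable (b : ℝ × ℝ) (φ : ℝ)

lemma graphNorm_circlePoint :
    graphNorm b (circlePoint φ) = nu (b.1 * Real.cos φ + b.2 * Real.sin φ) := by
  rw [graphNorm, graphNormSq, circlePoint, nu, Real.cos_sq_add_sin_sq]

lemma hasDerivAt_sin_div_graphNorm :
    HasDerivAt (fun φ => Real.sin φ / graphNorm b (circlePoint φ))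
      ((Real.cos φ + b.1 * (b.1 * Real.cos φ + b.2 * Real.sin φ)) /
        graphNorm b (circlePoint φ) ^ 3) φ := by
  simp only [graphNorm_circlePoint]
  set slope := b.1 * Real.cos φ + b.2 * Real.sin φ with hslope
  have hlin : HasDerivAt (fun φ => b.1 * Real.cos φ + b.2 * Real.sin φ)
      (b.1 * -Real.sin φ + b.2 * Real.cos φ) φ :=
    ((Real.hasDerivAt_cos φ).const_mul b.1).add ((Real.hasDerivAt_sin φ).const_mul b.2)
  have hnu : HasDerivAt (fun φ => nu (b.1 * Real.cos φ + b.2 * Real.sin φ))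
      (slope / nu slope * (b.1 * -Real.sin φ + b.2 * Real.cos φ)) φ :=
    HasDerivAt.comp (h₂ := nu) φ (hasDerivAt_nu slope) hlin
  have hpos := nu_pos slope
  convert! (Real.hasDerivAt_sin φ).fun_div hnu hpos.ne' using 1
  rw [← hslope]
  field_simp
  rw [nu_sq, hslope]
  linear_combination -(b.1 * slope) * Real.sin_sq_add_cos_sq φ

lemma continuous_div_graphNorm_circlePoint {T : ℝ × ℝ → ℝ} (hT : Continuous T) (n : ℕ) :
    Continuous fun φ => T (circlePoint φ) / graphNorm b (circlePoint φ) ^ n :=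
  (hT.comp continuous_circlePoint).div
    (((continuous_graphNorm b).comp continuous_circlePoint).pow n) fun φ =>
      (pow_pos (one_pos.trans_le (one_le_graphNorm_circlePoint b φ)) n).ne'

lemma asymmetry_sub_const_mul {T₁ T₂ : ℝ × ℝ → ℝ} (hT₁ : Continuous T₁) (hT₂ : Continuous T₂)
    (k : ℝ) :
    asymmetry b (fun w => T₁ w - k * T₂ w) = asymmetry b T₁ - k * asymmetry b T₂ := by
  simp only [asymmetry, sub_div, mul_div_assoc]
  rw [intervalIntegral.integral_sub
    ((continuous_div_graphNorm_circlePoint b hT₁ 5).intervalIntegrable _ _)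
    (((continuous_div_graphNorm_circlePoint b hT₂ 5).const_mul k).intervalIntegrable _ _),
    intervalIntegral.integral_const_mul]

lemma asymmetry_shear :
    asymmetry b (fun w => w.2 ^ 2 * (w.1 + b.1 * (b.1 * w.1 + b.2 * w.2))) =
      2 / (3 * nu b.2 ^ 3) := by
  have hderiv : ∀ φ, HasDerivAt (fun φ => (Real.sin φ / graphNorm b (circlePoint φ)) ^ 3 / 3)
      ((circlePoint φ).2 ^ 2 * ((circlePoint φ).1 + b.1 * (b.1 * (circlePoint φ).1 +
        b.2 * (circlePoint φ).2)) / graphNorm b (circlePoint φ) ^ 5) φ := fun φ => by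
    convert! ((hasDerivAt_sin_div_graphNorm b φ).fun_pow 3).div_const 3 using 1
    have hpos := one_pos.trans_le (one_le_graphNorm_circlePoint b φ)
    simp only [circlePoint, Nat.cast_ofNat, Nat.reduceSub] at hpos ⊢
    field_simp
  rw [asymmetry, intervalIntegral.integral_eq_sub_of_hasDerivAt (fun φ _ => hderiv φ)
    ((continuous_div_graphNorm_circlePoint b (T := fun w => w.2 ^ 2 *
      (w.1 + b.1 * (b.1 * w.1 + b.2 * w.2))) (by fun_prop) 5).intervalIntegrable _ _)]
  have hnu := nu_pos b.2
  simp only [graphNorm_circlePoint, Real.cos_neg, Real.sin_neg, Real.cos_pi_div_two,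
    Real.sin_pi_div_two, mul_zero, mul_one, zero_add, mul_neg, nu_neg]
  field_simp
  norm_num

end CurvatureIntegral

section Directions

variable {χ : Plane}

lemma rot_dir (χ : Plane) (α : ℝ) : rot (dir χ α) = dir χ (α + Real.pi / 2) := by
  rw [dir, dir, Real.cos_add_pi_div_two, Real.sin_add_pi_div_two]
  ext i; fin_cases i <;> simp [rot]; ring

lemma frame_dir_circlePoint (χ : Plane) (α φ : ℝ) :
    frame (dir χ α) (circlePoint φ) = dir χ (φ + α) := by
  rw [frame, rot_dir, circlePoint, dir, dir, dir, Real.cos_add_pi_div_two, Real.sin_add_pi_div_two,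
    Real.cos_add, Real.sin_add]
  module

lemma norm_dir (hχ : ‖χ‖ = 1) (α : ℝ) : ‖dir χ α‖ = 1 := by
  have hframe := norm_frame_sq hχ (circlePoint α)
  rw [circlePoint, Real.cos_sq_add_sin_sq] at hframe
  exact (pow_eq_one_iff_of_nonneg (norm_nonneg _) two_ne_zero).1 hframe

lemma d2_dir_dir {h : Plane → ℝ} {x : Plane} (hh : ContDiffAt ℝ 2 h x) (χ : Plane) (θ : ℝ) :
    d2 h x (dir χ θ) (dir χ θ) = Real.cos θ ^ 2 * d2 h x χ χ +
      Real.sin θ * Real.cos θ * (2 * d2 h x χ (rot χ)) +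
      Real.sin θ ^ 2 * d2 h x (rot χ) (rot χ) := by
  have hsymm : d2 h x (rot χ) χ = d2 h x χ (rot χ) := hh.isSymmSndFDerivAt (by simp) _ _
  simp only [d2] at hsymm ⊢
  simp only [dir, map_add, map_smul, add_apply, smul_apply, smul_eq_mul, hsymm]
  ring

end Directions

section HCoeff

variable (s α : ℝ)

lemma hCoeff_eq_integral (κ : ℝ → ℝ) :
    hCoeff s α κ = 3 / 2 * nu (s * Real.sin α) *
      ∫ φ in -(Real.pi / 2)..(Real.pi / 2),
        s * Real.cos (φ + α) * κ (φ + α) / nu (s * Real.cos (φ + α)) ^ 5 := by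
  rw [hCoeff, intervalIntegral.integral_comp_add_right (fun θ =>
    s * Real.cos θ * κ θ / nu (s * Real.cos θ) ^ 5), neg_add_eq_sub, add_comm (Real.pi / 2)]
  congr 1
  refine intervalIntegral.integral_congr fun θ _ => ?_
  have := nu_pos (s * Real.cos θ)
  simp only [(hasDerivAt_nu (s * Real.cos θ)).deriv]
  field_simp

lemma continuous_weight {κ : ℝ → ℝ} (hκ : Continuous κ) : Continuous fun φ =>
    s * Real.cos (φ + α) * κ (φ + α) / nu (s * Real.cos (φ + α)) ^ 5 := by
  have := continuous_nu
  exact Continuous.div (by fun_prop) (by fun_prop) fun φ => (pow_pos (nu_pos _) 5).ne'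

lemma hCoeff_add {κ₁ κ₂ : ℝ → ℝ} (h₁ : Continuous κ₁) (h₂ : Continuous κ₂) :
    hCoeff s α (fun θ => κ₁ θ + κ₂ θ) = hCoeff s α κ₁ + hCoeff s α κ₂ := by
  simp only [hCoeff_eq_integral, mul_add, add_div]
  rw [intervalIntegral.integral_add ((continuous_weight s α h₁).intervalIntegrable _ _)
    ((continuous_weight s α h₂).intervalIntegrable _ _), mul_add]

lemma hCoeff_mul_const (κ : ℝ → ℝ) (c : ℝ) :
    hCoeff s α (fun θ => κ θ * c) = hCoeff s α κ * c := by
  simp only [hCoeff, ← mul_assoc]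
  rw [intervalIntegral.integral_mul_const, mul_assoc _ _ c]

end HCoeff

section Gradient

variable {h : Plane → ℝ} {x χ : Plane} {s : ℝ}

lemma fderiv_eq_inner_gradient (h : Plane → ℝ) (x v : Plane) :
    fderiv ℝ h x v = inner ℝ (gradient h x) v :=
  InnerProductSpace.toDual_symm_apply.symm

lemma fderiv_dir (hχ : ‖χ‖ = 1) (hgrad : gradient h x = s • χ) (θ : ℝ) :
    fderiv ℝ h x (dir χ θ) = s * Real.cos θ := by
  rw [fderiv_eq_inner_gradient, hgrad, dir, inner_smul_left, inner_add_right, inner_smul_right,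
    inner_smul_right, inner_self_rot, real_inner_self_eq_norm_sq, hχ]
  simp

lemma frameSlope_dir (hχ : ‖χ‖ = 1) (hgrad : gradient h x = s • χ) (α : ℝ) :
    frameSlope h x (dir χ α) = (s * Real.cos α, -(s * Real.sin α)) := by
  rw [frameSlope, rot_dir, fderiv_dir hχ hgrad, fderiv_dir hχ hgrad, Real.cos_add_pi_div_two,
    mul_neg]

end Gradient

section ContourRHS

variable {f u : Plane → ℝ} {x χ : Plane} {s α : ℝ}

lemma contourRHS_eq_sub_mul_hCoeff (hf : ContDiffAt ℝ 2 f x) (u : Plane → ℝ) (χ : Plane)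
    (α : ℝ) :
    contourRHS f u x χ α =
      d2 u x (rot (dir χ α)) (rot (dir χ α)) / nu (‖gradient f x‖ * Real.sin α) ^ 2 -
        ‖gradient u x‖ * hCoeff ‖gradient f x‖ α fun θ => d2 f x (dir χ θ) (dir χ θ) := by
  simp only [d2_dir_dir hf]
  rw [hCoeff_add _ _ (by fun_prop) (by fun_prop), hCoeff_add _ _ (by fun_prop) (by fun_prop),
    hCoeff_mul_const, hCoeff_mul_const, hCoeff_mul_const, contourRHS]
  ring

lemma asymmetry_chartCubic (hχ : ‖χ‖ = 1) (hgrad : gradient f x = s • χ) (α k : ℝ) :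
    asymmetry (frameSlope f x (dir χ α)) (chartCubic f x (dir χ α) k) =
      (∫ φ in -(Real.pi / 2)..(Real.pi / 2), s * Real.cos (φ + α) *
        d2 f x (dir χ (φ + α)) (dir χ (φ + α)) / nu (s * Real.cos (φ + α)) ^ 5) -
        k * (2 / (3 * nu (s * Real.sin α) ^ 3)) := by
  set b := frameSlope f x (dir χ α) with hb
  have hsplit : chartCubic f x (dir χ α) k = fun w =>
      fderiv ℝ f x (frame (dir χ α) w) * d2 f x (frame (dir χ α) w) (frame (dir χ α) w) -
        k * (w.2 ^ 2 * (w.1 + b.1 * (b.1 * w.1 + b.2 * w.2))) := by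
    funext w
    rw [hb, ← fderiv_frame, chartCubic, chartQuad, frameSlope]
    ring
  have hcubic : Continuous fun w =>
      fderiv ℝ f x (frame (dir χ α) w) * d2 f x (frame (dir χ α) w) (frame (dir χ α) w) :=
    ((fderiv ℝ f x).continuous.mul (continuous_d2_diag f x)).comp (continuous_frame _)
  have hslope : ∀ φ, b.1 * Real.cos φ + b.2 * Real.sin φ = s * Real.cos (φ + α) := fun φ => by
    rw [hb, frameSlope_dir hχ hgrad, Real.cos_add]; ring
  have hb₂ : nu b.2 = nu (s * Real.sin α) := by rw [hb, frameSlope_dir hχ hgrad, nu_neg]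
  rw [hsplit, asymmetry_sub_const_mul b hcubic (by fun_prop), asymmetry_shear, hb₂, asymmetry]
  simp only [frame_dir_circlePoint, graphNorm_circlePoint, hslope, fderiv_dir hχ hgrad]

theorem contourRHS_eq_asymmetry (hf : ContDiffAt ℝ 2 f x) (hχ : ‖χ‖ = 1)
    (hfχ : gradient f x = ‖gradient f x‖ • χ) {k : ℝ}
    (hk : k * ‖gradient u x‖ = d2 u x (rot (dir χ α)) (rot (dir χ α))) :
    contourRHS f u x χ α = -(3 / 2 * (‖gradient u x‖ * nu (frameSlope f x (dir χ α)).2 *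
      asymmetry (frameSlope f x (dir χ α)) (chartCubic f x (dir χ α) k))) := by
  rw [contourRHS_eq_sub_mul_hCoeff hf, hCoeff_eq_integral, asymmetry_chartCubic hχ hfχ,
    frameSlope_dir hχ hfχ, nu_neg, ← hk]
  have hnu := nu_pos (‖gradient f x‖ * Real.sin α)
  field_simp
  ring

end ContourRHS

/-! ### Forces -/

section Forces

variable {a s α : ℝ}

lemma quantileForce_eq (a s α : ℝ) :
    quantileForce a s α = a * nu (s * Real.sin α) / nu s := by
  rw [quantileForce, nu, nu, mul_pow, Real.sqrt_div (by positivity), mul_div_assoc]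

lemma offsetForce_eq (a s α : ℝ) :
    offsetForce a s α = Real.pi * quantileForce a s α / (Real.pi / nu s) := by
  have hnu := nu_pos s
  rw [offsetForce, quantileForce_eq]
  field_simp

lemma quadraticForce_eq (a s α : ℝ) :
    quadraticForce a s α = Real.pi / nu s * quantileForce a s α / Real.pi := by
  have hnu := nu_pos s
  rw [quadraticForce, quantileForce_eq]
  field_simp

lemma forces_of_mul_sin_eq_zero (ha : 0 ≤ a) (h : s * Real.sin α = 0) :
    offsetForce a s α = a ∧ edgeStop s * a ≤ quantileForce a s α ∧ quantileForce a s α ≤ a ∧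
      quadraticForce a s α = edgeStop s * a := by
  have hnu₀ : nu 0 = 1 := by simp [nu]
  have hnu := nu_pos s
  have hone := one_le_nu s
  rw [offsetForce, quantileForce_eq, quadraticForce, edgeStop, h, hnu₀, ← nu_sq, mul_one]
  refine ⟨rfl, ?_, div_le_self ha hone, mul_comm _ _⟩
  rw [one_div_mul_eq_div]
  exact div_le_div_of_nonneg_left ha hnu (le_self_pow₀ hone two_ne_zero)

end Forces

section RotationalSymmetry

variable {Ω : Set Plane} {f u h : Plane → ℝ} {x₀ z χ : Plane} {α : ℝ}

-- The reflection in the line through `z` and `x₀` preserves `h` near its fixed point `x₀`.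
lemma RotSymmetricAbout.gradient_mem_span (hh : RotSymmetricAbout Ω z h) (hΩ : Ω ∈ 𝓝 x₀) :
    gradient h x₀ ∈ Submodule.span ℝ {x₀ - z} := by
  set axis := Submodule.span ℝ {x₀ - z}
  set R := axis.reflection
  have hfix : R (x₀ - z) = x₀ - z :=
    axis.reflection_mem_subspace_eq_self (Submodule.mem_span_singleton_self _)
  have hcont : Tendsto (fun v => z + R v) (𝓝 (x₀ - z)) (𝓝 x₀) :=
    Continuous.tendsto' (by fun_prop) _ _ (by rw [hfix, add_sub_cancel])
  have hcont' : Tendsto (fun v => z + v) (𝓝 (x₀ - z)) (𝓝 x₀) :=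
    Continuous.tendsto' (by fun_prop) _ _ (by rw [add_sub_cancel])
  have hsymm : (fun v => h (z + v)) ∘ R =ᶠ[𝓝 (x₀ - z)] fun v => h (z + v) := by
    filter_upwards [hcont hΩ, hcont' hΩ] with v hRv hv
    exact hh _ hRv _ hv (by simp)
  have hg : fderiv ℝ (fun v => h (z + v)) (x₀ - z) = fderiv ℝ h x₀ := by
    rw [fderiv_comp_add_left, add_sub_cancel]
  have hinv : (fderiv ℝ h x₀).comp (R.toContinuousLinearEquiv : Plane →L[ℝ] Plane) =
      fderiv ℝ h x₀ := by
    have hcomp := R.toContinuousLinearEquiv.comp_right_fderiv (f := fun v => h (z + v))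
      (x := x₀ - z)
    simp only [LinearIsometryEquiv.coe_toContinuousLinearEquiv] at hcomp
    rw [hsymm.fderiv_eq, hfix, hg] at hcomp
    exact hcomp.symm
  rw [← axis.orthogonal_orthogonal, Submodule.mem_orthogonal']
  intro v hv
  have hneg : fderiv ℝ h x₀ (R v) = fderiv ℝ h x₀ v := DFunLike.congr_fun hinv v
  rw [axis.reflection_mem_subspace_orthogonalComplement_eq_neg hv, map_neg] at hneg
  rw [← fderiv_eq_inner_gradient]
  linarith

lemma norm_gradient_mul_sin_eq_zero (hΩ : Ω ∈ 𝓝 x₀) (hgrad : gradient u x₀ ≠ 0)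
    (hχ : ‖χ‖ = 1) (hfχ : gradient f x₀ = ‖gradient f x₀‖ • χ)
    (huα : gradient u x₀ = ‖gradient u x₀‖ • dir χ α)
    (hfz : RotSymmetricAbout Ω z f) (huz : RotSymmetricAbout Ω z u) :
    ‖gradient f x₀‖ * Real.sin α = 0 := by
  obtain ⟨a, ha⟩ := Submodule.mem_span_singleton.1 (huz.gradient_mem_span hΩ)
  obtain ⟨b, hb⟩ := Submodule.mem_span_singleton.1 (hfz.gradient_mem_span hΩ)
  have ha₀ : a ≠ 0 := by rintro rfl; exact hgrad (by rw [← ha, zero_smul])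
  have hradial : x₀ - z = (a⁻¹ * ‖gradient u x₀‖) • dir χ α := by
    rw [mul_smul, ← huα, ← ha, inv_smul_smul₀ ha₀]
  have hrot : fderiv ℝ f x₀ (rot (dir χ α)) = 0 := by
    rw [fderiv_eq_inner_gradient, ← hb, hradial, inner_smul_left, inner_smul_left, inner_self_rot,
      mul_zero, mul_zero]
  rw [rot_dir, fderiv_dir hχ hfχ, Real.cos_add_pi_div_two, mul_neg, neg_eq_zero] at hrot
  exact hrot

end RotationalSymmetry

theorem rankAsymptotics_amoeba_contourRHS {Ω : Set Plane} {f u : Plane → ℝ} {x₀ χ : Plane} {α : ℝ}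
    (hΩ : Ω ∈ 𝓝 x₀) (hf : ContDiffOn ℝ 1 f Ω) (hf₂ : ContDiffAt ℝ 2 f x₀)
    (hu : ContDiffAt ℝ 2 u x₀) (hgrad : gradient u x₀ ≠ 0) (hχ : ‖χ‖ = 1)
    (hfχ : gradient f x₀ = ‖gradient f x₀‖ • χ)
    (huα : gradient u x₀ = ‖gradient u x₀‖ • dir χ α) :
    RankAsymptotics (amoeba Ω f x₀) u x₀ (Real.pi / nu ‖gradient f x₀‖)
      (quantileForce ‖gradient u x₀‖ ‖gradient f x₀‖ α) (contourRHS f u x₀ χ α) := by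
  have hpos : 0 < ‖gradient u x₀‖ := norm_pos_iff.2 hgrad
  have hdir := norm_dir hχ α
  have hslope := frameSlope_dir hχ hfχ α
  have hu_dir : fderiv ℝ u x₀ (dir χ α) = ‖gradient u x₀‖ := by
    rw [fderiv_eq_inner_gradient, huα, inner_smul_left, real_inner_self_eq_norm_sq, hdir,
      norm_smul, hdir]
    simp
  have hu_rot : fderiv ℝ u x₀ (rot (dir χ α)) = 0 := by
    rw [fderiv_eq_inner_gradient, huα, inner_smul_left, inner_self_rot, mul_zero]
  obtain ⟨k, hk⟩ : ∃ k, k * ‖gradient u x₀‖ = d2 u x₀ (rot (dir χ α)) (rot (dir χ α)) :=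
    ⟨_, div_mul_cancel₀ _ hpos.ne'⟩
  have hnorm : ‖gradient f x₀‖ ^ 2 =
      (frameSlope f x₀ (dir χ α)).1 ^ 2 + (frameSlope f x₀ (dir χ α)).2 ^ 2 := by
    rw [hslope]
    linear_combination -(‖gradient f x₀‖ ^ 2) * Real.sin_sq_add_cos_sq α
  have h := rankAsymptotics_amoeba hΩ hf hf₂ hu hdir (hu_dir ▸ hpos) hu_rot
    (by rwa [hu_dir]) hnorm
  rwa [hu_dir, ← contourRHS_eq_asymmetry hf₂ hχ hfχ hk, hslope, nu_neg, ← quantileForce_eq] at h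

end Amoeba

end

open Amoeba in
theorem mainTheorem5_general
    {Ω : Set Plane} {f u : Plane → ℝ} {x₀ : Plane} (hΩ : Ω ∈ 𝓝 x₀)
    (hf : ContDiffOn ℝ 1 f Ω) (hf₂ : ContDiffAt ℝ 2 f x₀) (hu : ContDiffAt ℝ 2 u x₀)
    (hgrad : gradient u x₀ ≠ 0) {χ : Plane} {α : ℝ} (hχ : ‖χ‖ = 1)
    (hfχ : gradient f x₀ = ‖gradient f x₀‖ • χ)
    (huα : gradient u x₀ = ‖gradient u x₀‖ • dir χ α) :
    (∀ b : ℝ → ℝ, (b =o[𝓝[>] (0 : ℝ)] fun ρ : ℝ => ρ ^ 2) →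
      ApproximatesForce Ω f u x₀ χ α (fun ρ _ => b ρ) (fun ρ => 3 * b ρ / ρ ^ 3)
        (offsetForce ‖gradient u x₀‖ ‖gradient f x₀‖ α)) ∧
    (∀ q : ℝ → ℝ, Tendsto q (𝓝[>] (0 : ℝ)) (𝓝 0) →
      ApproximatesForce Ω f u x₀ χ α (fun ρ p => q ρ * p) (fun ρ => 3 * Real.pi * q ρ / ρ)
        (quantileForce ‖gradient u x₀‖ ‖gradient f x₀‖ α)) ∧
    (∀ q ∈ Ioo (-(1 / 2) : ℝ) (1 / 2),
      (∀ᶠ ρ in 𝓝[>] (0 : ℝ),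
        RankAttained (amoeba Ω f x₀ ρ) u (biasedRank Ω f x₀ ρ (fun p => q * p))) ∧
      Tendsto (fun ρ : ℝ => (biasedStep Ω f u x₀ ρ (fun p => q * p) - u x₀) / ρ)
        (𝓝[>] (0 : ℝ))
        (𝓝 (diskOffset q * quantileForce ‖gradient u x₀‖ ‖gradient f x₀‖ α))) ∧
    Tendsto (fun q : ℝ => diskOffset q / q) (𝓝[≠] (0 : ℝ)) (𝓝 (Real.pi / 2)) ∧
    (∀ r : ℝ → ℝ, Tendsto (fun ρ : ℝ => r ρ * ρ ^ 2) (𝓝[>] (0 : ℝ)) (𝓝 0) →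
      ApproximatesForce Ω f u x₀ χ α (fun ρ p => r ρ * p ^ 2)
        (fun ρ => 3 * Real.pi ^ 2 * ρ * r ρ)
        (quadraticForce ‖gradient u x₀‖ ‖gradient f x₀‖ α)) ∧
    (∀ z : Plane, RotSymmetricAbout Ω z f → RotSymmetricAbout Ω z u →
      offsetForce ‖gradient u x₀‖ ‖gradient f x₀‖ α = ‖gradient u x₀‖ ∧
      edgeStop ‖gradient f x₀‖ * ‖gradient u x₀‖
        ≤ quantileForce ‖gradient u x₀‖ ‖gradient f x₀‖ α ∧
      quantileForce ‖gradient u x₀‖ ‖gradient f x₀‖ α ≤ ‖gradient u x₀‖ ∧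
      quadraticForce ‖gradient u x₀‖ ‖gradient f x₀‖ α
        = edgeStop ‖gradient f x₀‖ * ‖gradient u x₀‖) := by
  have h := rankAsymptotics_amoeba_contourRHS hΩ hf hf₂ hu hgrad hχ hfχ huα
  rw [offsetForce_eq, quadraticForce_eq]
  refine ⟨fun b hb => h.approximatesForce_offset hb, fun q hq => h.approximatesForce_quantile hq,
    fun q hq => ⟨h.eventually_rankAttained_quantile hq, h.tendsto_rankValue_quantile hq⟩,
    tendsto_diskOffset_div, fun r hr => h.approximatesForce_quadratic hr, fun z hfz huz => ?_⟩
  rw [← offsetForce_eq, ← quadraticForce_eq]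
  exact forces_of_mul_sin_eq_zero (norm_nonneg _)
    (norm_gradient_mul_sin_eq_zero hΩ hgrad hχ hfχ huα hfz huz)

theorem mainTheorem5
    (Ω : Set Amoeba.Plane) (f u : Amoeba.Plane → ℝ)
    (hf : ContDiffOn ℝ ∞ f Ω) (hu : ContDiffOn ℝ ∞ u Ω)
    (x₀ : Amoeba.Plane) (hx₀ : x₀ ∈ interior Ω) (hgrad : gradient u x₀ ≠ 0)
    (χ : Amoeba.Plane) (α : ℝ) (hχ : ‖χ‖ = 1)
    (hfχ : gradient f x₀ = ‖gradient f x₀‖ • χ)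
    (huα : gradient u x₀ = ‖gradient u x₀‖ • Amoeba.dir χ α) :
    -- fixed offset bias: rank `p / 2 + b`
    (∀ b : ℝ → ℝ, (b =o[𝓝[>] (0 : ℝ)] fun ρ : ℝ => ρ ^ 2) →
      Amoeba.ApproximatesForce Ω f u x₀ χ α (fun ρ _ => b ρ) (fun ρ => 3 * b ρ / ρ ^ 3)
        (Amoeba.offsetForce ‖gradient u x₀‖ ‖gradient f x₀‖ α)) ∧
    -- quantile bias: rank `p / 2 + q p`
    (∀ q : ℝ → ℝ, Tendsto q (𝓝[>] (0 : ℝ)) (𝓝 0) →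
      Amoeba.ApproximatesForce Ω f u x₀ χ α (fun ρ p => q ρ * p)
        (fun ρ => 3 * Real.pi * q ρ / ρ)
        (Amoeba.quantileForce ‖gradient u x₀‖ ‖gradient f x₀‖ α)) ∧
    -- quantile bias whose strength `q` does not depend on `ρ`
    (∀ q ∈ Ioo (-(1 / 2) : ℝ) (1 / 2),
      (∀ᶠ ρ in 𝓝[>] (0 : ℝ), Amoeba.RankAttained (Amoeba.amoeba Ω f x₀ ρ) u
        (Amoeba.biasedRank Ω f x₀ ρ (fun p => q * p))) ∧
      Tendsto (fun ρ : ℝ => (Amoeba.biasedStep Ω f u x₀ ρ (fun p => q * p) - u x₀) / ρ)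
        (𝓝[>] (0 : ℝ))
        (𝓝 (Amoeba.diskOffset q *
          Amoeba.quantileForce ‖gradient u x₀‖ ‖gradient f x₀‖ α))) ∧
    Tendsto (fun q : ℝ => Amoeba.diskOffset q / q) (𝓝[≠] (0 : ℝ)) (𝓝 (Real.pi / 2)) ∧
    -- quadratic bias: rank `p / 2 + r p ^ 2`
    (∀ r : ℝ → ℝ, Tendsto (fun ρ : ℝ => r ρ * ρ ^ 2) (𝓝[>] (0 : ℝ)) (𝓝 0) →
      Amoeba.ApproximatesForce Ω f u x₀ χ α (fun ρ p => r ρ * p ^ 2)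
        (fun ρ => 3 * Real.pi ^ 2 * ρ * r ρ)
        (Amoeba.quadraticForce ‖gradient u x₀‖ ‖gradient f x₀‖ α)) ∧
    -- the force terms in the rotationally symmetric case
    (∀ z : Amoeba.Plane, Amoeba.RotSymmetricAbout Ω z f → Amoeba.RotSymmetricAbout Ω z u →
      Amoeba.offsetForce ‖gradient u x₀‖ ‖gradient f x₀‖ α = ‖gradient u x₀‖ ∧
      Amoeba.edgeStop ‖gradient f x₀‖ * ‖gradient u x₀‖
        ≤ Amoeba.quantileForce ‖gradient u x₀‖ ‖gradient f x₀‖ α ∧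
      Amoeba.quantileForce ‖gradient u x₀‖ ‖gradient f x₀‖ α ≤ ‖gradient u x₀‖ ∧
      Amoeba.quadraticForce ‖gradient u x₀‖ ‖gradient f x₀‖ α
        = Amoeba.edgeStop ‖gradient f x₀‖ * ‖gradient u x₀‖) :=
  have hΩ : Ω ∈ 𝓝 x₀ := mem_interior_iff_mem_nhds.1 hx₀
  mainTheorem5_general hΩ (hf.of_le (by norm_cast)) ((hf.contDiffAt hΩ).of_le (by norm_cast))
    ((hu.contDiffAt hΩ).of_le (by norm_cast)) hgrad hχ hfχ huα
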